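/- Let $T\subset H\subset G\subset GL_n$ be connected linear algebraic groups over $\mathbb R$, where $G$ and $H$ are reductive and realised so that they are stable under transposition, and $T$ is a maximal torus of $G$ with $T(\mathbb R)$ a compact torus. Let $\mathfrak t\subset\mathfrak h\subset\mathfrak g$ be the complexified Lie algebras, $W=W(\mathfrak g,\mathfrak t)$, $W_{\mathfrak h}=W(\mathfrak h,\mathfrak t)$ the Weyl groups with sign character $\epsilon$, fix positive roots of $\mathfrak g$ and the compatible positive roots of $\mathfrak h$, let $\rho,\rho_{\mathfrak h}$ be the half sums of positive roots, and assume that $\rho-\rho_{\mathfrak h}$ is the differential of a character of $T(\mathbb R)$. Put $q(G)=\frac12\dim G(\mathbb R)/K(\mathbb R)$ with $K(\mathbb R)$ maximal compact, and similarly $q(H)$. Then Labesse's canonical transfer factor $$\Delta(\gamma^{-1})=(-1)^{q(G)-q(H)}\frac{\sum_{w\in W}\epsilon(w)\gamma^{w\rho}}{\sum_{w\in W_{\mathfrak h}}\epsilon(w)\gamma^{w\rho_{\mathfrak h}}}$$ is well defined on the $H$-regular elements $\gamma\in T(\mathbb R)$ (on the right, $\gamma^\mu=e^{\mu(X)}$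 for any $X$ in the Lie algebra of $T(\mathbb R)$ with $\gamma=\exp X$). Let $B$ be a non-degenerate invariant symmetric bilinear form on $\mathfrak g$, $\mathfrak g=\mathfrak h\oplus\mathfrak s$ the orthogonal decomposition, with $B$ non-degenerate on $\mathfrak s$ and $Z_1,\dots,Z_m$ an orthonormal basis of $\mathfrak s$. Let $C(\mathfrak s)$ be the Clifford algebra with $uu'+u'u=-2B(u,u')$, and $S=S^+\oplus S^-$ its graded spin module, on which $\mathfrak h$ acts through $X\mapsto-\frac14\sum_j[X,Z_j]Z_j$. The two half-spin modules are determined up to interchange; label them so that the vectors of $S$ killed by all positive root vectors in $\mathfrak s$ lie in $S^+$ if $q(G)-q(H)$ is even and in $S^-$ if it is odd. Then the action of the Lie algebra of $T(\mathbb R)$ on $S^\pm$ integrates to $T(\mathbb R)$, and for all $H$-regular $\gamma\in T(\mathbb R)$: 1. $\Delta(\gamma^{-1})=\mathrm{ch}\,S^+(\gamma)-\mathrm{ch}\,S^-(\gamma)$. 2. $\Delta(\gamma^{-1})$ is the value at $\gamma$ of the character of the Dirac index of the trivial representation for the cubic Dirac operator $D(\mathfrak g,\mathfrak h)=\sum_iZ_i\otimes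 Z_i+1\otimes\frac12\sum_{i<j<k}B([Z_i,Z_j],Z_k)Z_iZ_jZ_k$. Here the Dirac index of $F$ is $\ker D^+-\mathrm{coker}\,D^+$, where $D^+\colon F\otimes S^+\to F\otimes S^-$ is the restriction of $D$. 3. Let $F_\lambda$ be an irreducible finite-dimensional representation of $G(\mathbb R)$ with highest weight $\lambda$. Then $\Delta(\gamma^{-1})\Theta_{F_\lambda}(\gamma)$ is the character of the Dirac index of $F_\lambda$, and $$\Delta(\gamma^{-1})\,\Theta_{F_\lambda}(\gamma)=(-1)^{q(G)-q(H)}\sum_{w\in W^1}\epsilon(w)\,\Theta_{E_{w(\lambda+\rho)-\rho_{\mathfrak h}}}(\gamma),$$ where $W^1=\{w\in W: w\rho \text{ is dominant for the positive roots of }\mathfrak h\}$ and $E_\mu$ denotes an irreducible finite-dimensional representation of $H(\mathbb R)$ with highest weight $\mu$. -/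

import Mathlib

open Filter Topology
open scoped TensorProduct Matrix

universe u v

attribute [local instance] LieRing.ofAssociativeRing

noncomputable section

namespace TransferFactor

theorem norm_exp_le_aux {A : Type*} [NormedRing A] [NormedAlgebra ℂ A] [CompleteSpace A]
    [NormOneClass A] (x : A) : ‖NormedSpace.exp x‖ ≤ Real.exp ‖x‖ := by
  rw [NormedSpace.exp_eq_tsum ℂ, Real.exp_eq_exp_ℝ, NormedSpace.exp_eq_tsum ℝ]
  refine tsum_of_norm_bounded (NormedSpace.expSeries_summable' (𝕂 := ℝ) ‖x‖).hasSum fun n => ?_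
  rw [norm_smul, norm_inv, Complex.norm_natCast, smul_eq_mul]
  gcongr
  exact norm_pow_le x n

theorem norm_pow_sub_pow_aux {A : Type*} [NormedRing A] [NormOneClass A] (a b : A) (M : ℝ)
    (hM : 1 ≤ M) (ha : ‖a‖ ≤ M) (hb : ‖b‖ ≤ M) (k : ℕ) :
    ‖a ^ k - b ^ k‖ ≤ k * M ^ k * ‖a - b‖ := by
  induction k with
  | zero => simp
  | succ k ih =>
    have h0 : (0 : ℝ) ≤ M := by linarith
    have e : a ^ (k + 1) - b ^ (k + 1) = a ^ k * (a - b) + (a ^ k - b ^ k) * b := by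
      rw [pow_succ, pow_succ]; noncomm_ring
    have h1 : ‖a ^ k * (a - b)‖ ≤ M ^ (k + 1) * ‖a - b‖ := by
      refine (norm_mul_le _ _).trans ?_
      gcongr
      exact (norm_pow_le a k).trans ((pow_le_pow_left₀ (norm_nonneg _) ha k).trans
        (pow_le_pow_right₀ hM (Nat.le_succ k)))
    have h2 : ‖(a ^ k - b ^ k) * b‖ ≤ (k * M ^ k * ‖a - b‖) * M := by
      refine (norm_mul_le _ _).trans ?_
      gcongr
    rw [e]
    refine (norm_add_le _ _).trans ((add_le_add h1 h2).trans (le_of_eq ?_))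
    push_cast; ring

theorem tendsto_exp_mul_exp_pow {A : Type*} [NormedRing A] [NormedAlgebra ℂ A] [CompleteSpace A]
    [NormOneClass A] (x y : A) :
    Tendsto (fun k : ℕ => (NormedSpace.exp ((k : ℂ)⁻¹ • x) * NormedSpace.exp ((k : ℂ)⁻¹ • y)) ^ k)
      atTop (𝓝 (NormedSpace.exp (x + y))) := by
  let f : ℂ → A := fun u => NormedSpace.exp (u • x) * NormedSpace.exp (u • y) -
    NormedSpace.exp (u • (x + y))
  have hd : HasDerivAt f 0 0 := by
    have h1 := hasDerivAt_exp_smul_const (𝕂 := ℂ) x 0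
    have h2 := hasDerivAt_exp_smul_const (𝕂 := ℂ) y 0
    have h3 := hasDerivAt_exp_smul_const (𝕂 := ℂ) (x + y) 0
    have := (h1.mul h2).sub h3
    refine (this.congr_deriv ?_)
    simp
  have hf0 : f 0 = 0 := by simp [f]
  have hz : Tendsto (fun k : ℕ => (k : ℂ)⁻¹) atTop (𝓝[≠] 0) := by
    refine tendsto_nhdsWithin_iff.2 ⟨tendsto_inv_atTop_nhds_zero_nat, ?_⟩
    filter_upwards [eventually_gt_atTop 0] with k hk
    simp [hk.ne']
  have hs := (hd.tendsto_slope.comp hz).norm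
  rw [norm_zero] at hs
  rw [tendsto_iff_norm_sub_tendsto_zero]
  have hs' := hs.const_mul (Real.exp (‖x‖ + ‖y‖))
  rw [mul_zero] at hs'
  refine squeeze_zero' (Eventually.of_forall fun _ => norm_nonneg _) ?_ hs'
  filter_upwards [eventually_gt_atTop 0] with k hk
  have hk' : (k : ℂ) ≠ 0 := by exact_mod_cast hk.ne'
  have hkr : (k : ℝ) ≠ 0 := by exact_mod_cast hk.ne'
  have e : NormedSpace.exp (x + y) = NormedSpace.exp ((k : ℂ)⁻¹ • (x + y)) ^ k := by
    let _ : NormedAlgebra ℚ A := NormedAlgebra.restrictScalars ℚ ℂ A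
    rw [← NormedSpace.exp_nsmul, ← Nat.cast_smul_eq_nsmul ℂ, smul_smul, mul_inv_cancel₀ hk', one_smul]
  have hn : ‖((k : ℂ)⁻¹)‖ = (k : ℝ)⁻¹ := by simp
  have hM : 1 ≤ Real.exp ((k : ℝ)⁻¹ * (‖x‖ + ‖y‖)) := Real.one_le_exp (by positivity)
  have ha : ‖NormedSpace.exp ((k : ℂ)⁻¹ • x) * NormedSpace.exp ((k : ℂ)⁻¹ • y)‖ ≤
      Real.exp ((k : ℝ)⁻¹ * (‖x‖ + ‖y‖)) := by
    refine (norm_mul_le _ _).trans ?_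
    rw [mul_add, Real.exp_add]
    gcongr
    · exact (norm_exp_le_aux _).trans (by rw [norm_smul, hn])
    · exact (norm_exp_le_aux _).trans (by rw [norm_smul, hn])
  have hb : ‖NormedSpace.exp ((k : ℂ)⁻¹ • (x + y))‖ ≤ Real.exp ((k : ℝ)⁻¹ * (‖x‖ + ‖y‖)) := by
    refine (norm_exp_le_aux _).trans (Real.exp_le_exp.2 ?_)
    rw [norm_smul, hn]
    gcongr
    exact norm_add_le x y
  rw [e]
  refine (norm_pow_sub_pow_aux _ _ _ hM ha hb k).trans (le_of_eq ?_)
  rw [← Real.exp_nat_mul, mul_inv_cancel_left₀ hkr]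
  simp only [Function.comp, slope, vsub_eq_sub, hf0, sub_zero, norm_smul, inv_inv]
  simp only [f, Complex.norm_natCast]
  ring

/-- A connected linear algebraic group defined over `ℝ`, given by its group `cpts` of complex
points: a connected subgroup of `GL_n(ℂ)` cut out by polynomials with real coefficients.
(Connectedness in the usual and in the Zariski topology agree.) -/
structure RealAlgGroup (n : ℕ) where
  cpts : Subgroup (GL (Fin n) ℂ)
  isAlgebraic : ∃ P : Set (MvPolynomial (Fin n × Fin n) ℝ), ∀ g : GL (Fin n) ℂ,
    g ∈ cpts ↔ ∀ p ∈ P, MvPolynomial.aeval (fun ij : Fin n × Fin n => (g : Matrix (Fin n) (Fin n) ℂ) ij.1 ij.2) p = 0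
  isConnected : IsConnected (cpts : Set (GL (Fin n) ℂ))

namespace RealAlgGroup

variable {n : ℕ} (G : RealAlgGroup n)

/-- The set underlying the Lie algebra of `G(ℂ)`: the generators `X` of the one-parameter
subgroups `z ↦ exp (zX)` of `G(ℂ)`. -/
def lieSet : Set (Matrix (Fin n) (Fin n) ℂ) :=
  {X | ∀ z : ℂ, ∃ g ∈ G.cpts, (g : Matrix (Fin n) (Fin n) ℂ) = NormedSpace.exp (z • X)}

theorem mem_of_tendsto {u : ℕ → GL (Fin n) ℂ} (hu : ∀ k, u k ∈ G.cpts)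
    {X : Matrix (Fin n) (Fin n) ℂ}
    (h : Tendsto (fun k => (u k : Matrix (Fin n) (Fin n) ℂ)) atTop (𝓝 (NormedSpace.exp X))) :
    ∃ g ∈ G.cpts, (g : Matrix (Fin n) (Fin n) ℂ) = NormedSpace.exp X := by
  obtain ⟨P, hP⟩ := G.isAlgebraic
  refine ⟨(Matrix.isUnit_exp X).unit, (hP _).2 fun p hp => ?_, IsUnit.unit_spec _⟩
  have hc : Continuous fun A : Matrix (Fin n) (Fin n) ℂ =>
      MvPolynomial.aeval (fun ij : Fin n × Fin n => A ij.1 ij.2) p := by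
    have : Continuous fun A : Matrix (Fin n) (Fin n) ℂ =>
      MvPolynomial.eval (fun ij : Fin n × Fin n => A ij.1 ij.2)
        (MvPolynomial.map (algebraMap ℝ ℂ) p) :=
      (MvPolynomial.continuous_eval _).comp (by fun_prop)
    simpa only [MvPolynomial.eval_map, MvPolynomial.aeval_def] using this
  have hl := (hc.tendsto _).comp h
  have h0 : ∀ k, MvPolynomial.aeval
      (fun ij : Fin n × Fin n => (u k : Matrix (Fin n) (Fin n) ℂ) ij.1 ij.2) p = 0 :=
    fun k => (hP _).1 (hu k) p hp
  simp only [Function.comp_def, h0] at hl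
  exact (tendsto_nhds_unique hl tendsto_const_nhds)

theorem conj_mem_lieSet {X : Matrix (Fin n) (Fin n) ℂ} (hX : X ∈ G.lieSet)
    {g : GL (Fin n) ℂ} (hg : g ∈ G.cpts) :
    (g : Matrix (Fin n) (Fin n) ℂ) * X * ((g⁻¹ : GL (Fin n) ℂ) : Matrix (Fin n) (Fin n) ℂ)
      ∈ G.lieSet := by
  intro z
  obtain ⟨x, hx, hx'⟩ := hX z
  refine ⟨g * x * g⁻¹, G.cpts.mul_mem (G.cpts.mul_mem hg hx) (G.cpts.inv_mem hg), ?_⟩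
  rw [← smul_mul_assoc, ← mul_smul_comm, Matrix.exp_units_conj g, ← hx']
  rfl

attribute [local instance] Matrix.linftyOpNormedRing Matrix.linftyOpNormedAlgebra in
theorem add_mem_lieSet {X Y : Matrix (Fin n) (Fin n) ℂ} (hX : X ∈ G.lieSet)
    (hY : Y ∈ G.lieSet) : X + Y ∈ G.lieSet := by
  intro z
  rcases isEmpty_or_nonempty (Fin n) with h | h
  · exact ⟨1, G.cpts.one_mem, Subsingleton.elim _ _⟩
  choose a ha ha' using hX
  choose b hb hb' using hY
  refine G.mem_of_tendsto (u := fun k : ℕ => (a ((k : ℂ)⁻¹ * z) * b ((k : ℂ)⁻¹ * z)) ^ k)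
    (fun k => G.cpts.pow_mem (G.cpts.mul_mem (ha _) (hb _)) _) ?_
  have := tendsto_exp_mul_exp_pow (z • X) (z • Y)
  rw [← smul_add] at this
  refine this.congr fun k => ?_
  rw [smul_smul, smul_smul, Units.val_pow_eq_pow_val, Units.val_mul]
  exact congrArg (· ^ k) (congrArg₂ (· * ·) (ha' _).symm (hb' _).symm)

/-- The Lie algebra of `G(ℂ)` as a vector space. -/
def lieSubmodule : Submodule ℂ (Matrix (Fin n) (Fin n) ℂ) where
  carrier := G.lieSet
  add_mem' := G.add_mem_lieSet
  zero_mem' := fun z => ⟨1, G.cpts.one_mem, by simp⟩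
  smul_mem' := fun c X hX z => by
    obtain ⟨g, hg, h⟩ := hX (z * c)
    exact ⟨g, hg, by rw [h, smul_smul]⟩

attribute [local instance] Matrix.linftyOpNormedRing Matrix.linftyOpNormedAlgebra in
theorem lie_mem_lieSubmodule {X Y : Matrix (Fin n) (Fin n) ℂ} (hX : X ∈ G.lieSubmodule)
    (hY : Y ∈ G.lieSubmodule) : ⁅X, Y⁆ ∈ G.lieSubmodule := by
  have hd : HasDerivAt (fun u : ℂ => NormedSpace.exp (u • X) * Y * NormedSpace.exp (u • (-X)))
      ⁅X, Y⁆ 0 := by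
    have h1 := hasDerivAt_exp_smul_const (𝕂 := ℂ) X 0
    have h2 := hasDerivAt_exp_smul_const (𝕂 := ℂ) (-X) 0
    have := (h1.mul_const Y).mul h2
    refine (this.congr_deriv ?_)
    simp [Ring.lie_def, sub_eq_add_neg]
  have hcl : IsClosed (G.lieSubmodule : Set (Matrix (Fin n) (Fin n) ℂ)) :=
    Submodule.closed_of_finiteDimensional _
  refine hcl.mem_of_tendsto hd.tendsto_slope (Eventually.of_forall fun u => ?_)
  refine G.lieSubmodule.smul_mem _ (G.lieSubmodule.sub_mem ?_ ?_)
  · obtain ⟨g, hg, h⟩ := hX u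
    have h' : ((g⁻¹ : GL (Fin n) ℂ) : Matrix (Fin n) (Fin n) ℂ) = NormedSpace.exp (u • (-X)) := by
      rw [smul_neg, Matrix.exp_neg, ← h, Matrix.coe_units_inv]
    have := G.conj_mem_lieSet hY hg
    rw [h, h'] at this
    exact this
  · simpa using hY

/-- The complex Lie algebra of `G`. Its real form, the Lie algebra of `G(ℝ)`, consists of the
real matrices in it. -/
def lie : LieSubalgebra ℂ (Matrix (Fin n) (Fin n) ℂ) :=
  { G.lieSubmodule with lie_mem' := fun hX hY => G.lie_mem_lieSubmodule hX hY }

/-- The group `G(ℝ)` of real points, as a subgroup of `GL_n(ℂ)`. -/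
def realPts : Subgroup (GL (Fin n) ℂ) :=
  G.cpts ⊓ (Matrix.GeneralLinearGroup.map (n := Fin n) Complex.ofRealHom).range

theorem realPts_mono {G G' : RealAlgGroup n} (h : G.cpts ≤ G'.cpts) :
    G.realPts ≤ G'.realPts :=
  inf_le_inf_right _ h

/-- `G` is stable under transposition. A connected linear algebraic group over `ℝ` is reductive if
and only if it has such a realisation. Then `g ↦ (gᵀ)⁻¹` is a Cartan involution of `G(ℝ)`, with
maximal compact subgroup `K(ℝ) = G(ℝ) ∩ O(n)`. -/
def IsSelfAdjoint : Prop :=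
  ∀ g ∈ G.cpts, ∃ g' ∈ G.cpts,
    (g' : Matrix (Fin n) (Fin n) ℂ) = (g : Matrix (Fin n) (Fin n) ℂ)ᵀ

/-- The symmetric matrices. -/
def symm (n : ℕ) : Submodule ℂ (Matrix (Fin n) (Fin n) ℂ) where
  carrier := {X | Xᵀ = X}
  add_mem' := fun {X Y} hX hY => by
    simp only [Set.mem_ofPred_eq] at *
    rw [Matrix.transpose_add, hX, hY]
  zero_mem' := by simp
  smul_mem' := fun c X hX => by
    simp only [Set.mem_ofPred_eq] at *
    rw [Matrix.transpose_smul, hX]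

/-- `q(G) = ½ dim G(ℝ)/K(ℝ) = ½ dim 𝔭`, where `𝔭` is the symmetric part of the Lie algebra of a
group `G` stable under transposition. -/
def q : ℕ := Module.finrank ℂ ↥(G.lieSubmodule ⊓ symm n) / 2

end RealAlgGroup

/-- A matrix with real entries. -/
def IsRealMatrix {n : ℕ} (X : Matrix (Fin n) (Fin n) ℂ) : Prop := ∀ i j, (X i j).im = 0

/-- `T` is a maximal torus of `G` (a connected commutative subgroup whose Lie algebra is its own
centraliser in that of `G`) and `T(ℝ)` is a compact torus. -/
structure IsCompactMaximalTorus {n : ℕ} (T G : RealAlgGroup n) : Prop where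
  le : T.cpts ≤ G.cpts
  comm : ∀ a ∈ T.cpts, ∀ b ∈ T.cpts, a * b = b * a
  compact_torus : ∃ r : ℕ, Nonempty (T.realPts ≃ₜ* (Fin r → Circle))
  cartan : ∀ X ∈ G.lie, (∀ Y ∈ T.lie, ⁅Y, X⁆ = 0) → X ∈ T.lie

section Roots

variable {n : ℕ} (𝔤 𝔱 : LieSubalgebra ℂ (Matrix (Fin n) (Fin n) ℂ))

/-- The `α`-weight space of `𝔱` in `𝔤`. -/
def rootSpace (α : Module.Dual ℂ 𝔱) : Submodule ℂ (Matrix (Fin n) (Fin n) ℂ) where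
  carrier := {X | X ∈ 𝔤 ∧ ∀ Y : 𝔱, ⁅(Y : Matrix (Fin n) (Fin n) ℂ), X⁆ = α Y • X}
  add_mem' := fun {X Y} hX hY =>
    ⟨add_mem hX.1 hY.1, fun A => by rw [lie_add, hX.2, hY.2, smul_add]⟩
  zero_mem' := ⟨zero_mem _, fun A => by simp⟩
  smul_mem' := fun c X hX =>
    ⟨𝔤.smul_mem c hX.1, fun A => by rw [lie_smul, hX.2, smul_comm]⟩

/-- The roots of `𝔱` in `𝔤`. -/
def roots : Set (Module.Dual ℂ 𝔱) := {α | α ≠ 0 ∧ rootSpace 𝔤 𝔱 α ≠ ⊥}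

/-- `c` is the coroot of `α`: the element of `[𝔤_α, 𝔤_{-α}]` with `α(c) = 2`. -/
def IsCoroot (α : Module.Dual ℂ 𝔱) (c : 𝔱) : Prop :=
  α c = 2 ∧ ∃ e ∈ rootSpace 𝔤 𝔱 α, ∃ f ∈ rootSpace 𝔤 𝔱 (-α),
    ⁅e, f⁆ = (c : Matrix (Fin n) (Fin n) ℂ)

/-- The Weyl group, generated by the root reflections of `𝔱*`. -/
def weylGroup : Subgroup (Module.Dual ℂ 𝔱 ≃ₗ[ℂ] Module.Dual ℂ 𝔱) :=
  Subgroup.closure {s | ∃ α ∈ roots 𝔤 𝔱, ∃ c : 𝔱, IsCoroot 𝔤 𝔱 α c ∧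
    ∀ μ : Module.Dual ℂ 𝔱, s μ = μ - μ c • α}

/-- The sign `ε(w) = det w` of a Weyl group element. -/
def weylSign {𝔱 : LieSubalgebra ℂ (Matrix (Fin n) (Fin n) ℂ)}
    (w : Module.Dual ℂ 𝔱 ≃ₗ[ℂ] Module.Dual ℂ 𝔱) : ℂ :=
  LinearMap.det (w : Module.Dual ℂ 𝔱 →ₗ[ℂ] Module.Dual ℂ 𝔱)

/-- `x` lies in an open Weyl chamber: every root takes a nonzero real value at `x`. -/
def IsRegularElement (x : 𝔱) : Prop := ∀ α ∈ roots 𝔤 𝔱, (α x).im = 0 ∧ α x ≠ 0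

/-- The system of positive roots given by the Weyl chamber of `x`. -/
def posRoots (x : 𝔱) : Set (Module.Dual ℂ 𝔱) := {α | α ∈ roots 𝔤 𝔱 ∧ 0 < (α x).re}

/-- Half the sum of the positive roots. -/
def rho (x : 𝔱) : Module.Dual ℂ 𝔱 := (1 / 2 : ℂ) • ∑ᶠ α ∈ posRoots 𝔤 𝔱 x, α

/-- `∑_{w ∈ W} ε(w) γ^{wμ}` for `γ = exp X`. -/
def altSum (μ : Module.Dual ℂ 𝔱) (X : 𝔱) : ℂ :=
  ∑ᶠ w : weylGroup 𝔤 𝔱, weylSign w.1 * Complex.exp (w.1 μ X)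

/-- `W¹`: the elements `w` of the Weyl group of `𝔤` such that `wρ` is dominant for the positive
roots of `𝔥`. -/
def weylOne (𝔥 : LieSubalgebra ℂ (Matrix (Fin n) (Fin n) ℂ)) (x : 𝔱) :
    Set (Module.Dual ℂ 𝔱 ≃ₗ[ℂ] Module.Dual ℂ 𝔱) :=
  {w | w ∈ weylGroup 𝔤 𝔱 ∧ ∀ α ∈ posRoots 𝔥 𝔱 x, ∀ c : 𝔱, IsCoroot 𝔥 𝔱 α c →
    0 ≤ (w (rho 𝔤 𝔱 x) c).re}

end Roots

/-- `μ ∈ 𝔱*` is the differential of a character of `T(ℝ)`. -/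
def IsCharacter {n : ℕ} (T : RealAlgGroup n) (μ : Module.Dual ℂ T.lie) : Prop :=
  ∃ χ : T.realPts →ₜ* Circle, ∀ X : T.lie, IsRealMatrix (X : Matrix (Fin n) (Fin n) ℂ) →
    ∀ γ : T.realPts, ((γ : GL (Fin n) ℂ) : Matrix (Fin n) (Fin n) ℂ) =
      NormedSpace.exp (X : Matrix (Fin n) (Fin n) ℂ) → (χ γ : ℂ) = Complex.exp (μ X)

/-- `γ ∈ T(ℝ)` is regular in `H`: the centraliser of `γ` in the Lie algebra of `H` is that
of `T`. -/
def IsRegularIn {n : ℕ} (T H : RealAlgGroup n) (γ : T.realPts) : Prop :=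
  ∀ X ∈ H.lie, ((γ : GL (Fin n) ℂ) : Matrix (Fin n) (Fin n) ℂ) * X =
    X * ((γ : GL (Fin n) ℂ) : Matrix (Fin n) (Fin n) ℂ) → X ∈ T.lie

/-- `Δ` is the canonical transfer factor on the `H`-regular elements of `T(ℝ)`:
`Δ(γ⁻¹) = (-1)^{q(G)-q(H)} (∑_{w ∈ W(𝔤)} ε(w) γ^{wρ}) / (∑_{w ∈ W(𝔥)} ε(w) γ^{wρ_H})`, where the
right-hand side is computed with any logarithm `X` of `γ` in the Lie algebra of `T(ℝ)`. -/
def IsTransferFactor {n : ℕ} (T H G : RealAlgGroup n) (x : T.lie) (Δ : T.realPts → ℂ) : Prop :=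
  ∀ X : T.lie, IsRealMatrix (X : Matrix (Fin n) (Fin n) ℂ) → ∀ γ : T.realPts,
    ((γ : GL (Fin n) ℂ) : Matrix (Fin n) (Fin n) ℂ) =
      NormedSpace.exp (X : Matrix (Fin n) (Fin n) ℂ) →
    IsRegularIn T H γ →
    Δ γ⁻¹ = (-1 : ℂ) ^ ((G.q : ℤ) - H.q) *
      (altSum G.lie T.lie (rho G.lie T.lie x) X / altSum H.lie T.lie (rho H.lie T.lie x) X)

/-- A finite-dimensional complex representation `act` of `G(ℝ)`, together with its differential
`lieAct` (which it determines: `d/ds|₀ act(exp sX) v = lieAct(X) v` for `X` in the Lie algebra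
of `G(ℝ)`), extended to the complex Lie algebra. -/
structure RealRep {n : ℕ} (G : RealAlgGroup n) where
  V : Type u
  [addCommGroup : AddCommGroup V]
  [module : Module ℂ V]
  [finite : FiniteDimensional ℂ V]
  act : G.realPts →* Module.End ℂ V
  continuous_act : ∀ (v : V) (f : Module.Dual ℂ V), Continuous fun g => f (act g v)
  lieAct : G.lie →ₗ⁅ℂ⁆ Module.End ℂ V
  hasDerivAt : ∀ X : G.lie, IsRealMatrix (X : Matrix (Fin n) (Fin n) ℂ) → ∀ p : ℝ → G.realPts,
    (∀ s : ℝ, ((p s : GL (Fin n) ℂ) : Matrix (Fin n) (Fin n) ℂ) =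
      NormedSpace.exp ((s : ℂ) • (X : Matrix (Fin n) (Fin n) ℂ))) →
    ∀ (v : V) (f : Module.Dual ℂ V), HasDerivAt (fun s => f (act (p s) v)) (f (lieAct X v)) 0

attribute [instance] RealRep.addCommGroup RealRep.module RealRep.finite

namespace RealRep

variable {n : ℕ} {G : RealAlgGroup n}

/-- The trivial representation. -/
def trivialRep (G : RealAlgGroup n) : RealRep.{0} G where
  V := ℂ
  act := 1
  continuous_act := fun v f => by simpa using continuous_const
  lieAct := 0
  hasDerivAt := fun X _ p _ v f => by simpa using hasDerivAt_const (0 : ℝ) (f v)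

/-- Irreducibility, under the complexified Lie algebra (for a representation of `G(ℝ)` with a
highest weight this is the same as irreducibility under `G(ℝ)`). -/
def IsIrreducible (F : RealRep G) : Prop :=
  Nontrivial F.V ∧ ∀ U : Submodule ℂ F.V, (∀ X : G.lie, ∀ v ∈ U, F.lieAct X v ∈ U) →
    U = ⊥ ∨ U = ⊤

/-- `F` has a highest weight vector of weight `μ`, for the positive roots given by `x`. -/
def HasHighestWeight (F : RealRep G) {T : RealAlgGroup n} (x : T.lie)
    (μ : Module.Dual ℂ T.lie) : Prop :=
  ∃ v : F.V, v ≠ 0 ∧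
    (∀ (X : G.lie) (Y : T.lie),
      (X : Matrix (Fin n) (Fin n) ℂ) = (Y : Matrix (Fin n) (Fin n) ℂ) →
        F.lieAct X v = μ Y • v) ∧
    ∀ α ∈ posRoots G.lie T.lie x, ∀ X : G.lie,
      (X : Matrix (Fin n) (Fin n) ℂ) ∈ rootSpace G.lie T.lie α → F.lieAct X v = 0

/-- The restriction to `T(ℝ)`. -/
def resAct (F : RealRep G) {T : RealAlgGroup n} (h : T.cpts ≤ G.cpts) :
    T.realPts →* Module.End ℂ F.V :=
  F.act.comp (Subgroup.inclusion (RealAlgGroup.realPts_mono h))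

/-- The character `Θ_F`, as a function on `T(ℝ)`. -/
def character (F : RealRep G) {T : RealAlgGroup n} (h : T.cpts ≤ G.cpts) (γ : T.realPts) : ℂ :=
  LinearMap.trace ℂ F.V (F.resAct h γ)

end RealRep

/-- The trace on an invariant subspace `U` (and `0` if `U` is not invariant). -/
def traceOn {V : Type*} [AddCommGroup V] [Module ℂ V] (A : Module.End ℂ V)
    (U : Submodule ℂ V) : ℂ :=
  open Classical in
  if h : ∀ v ∈ U, A v ∈ U then LinearMap.trace ℂ U (A.restrict h) else 0

/-- A spin module: a simple module over the Clifford algebra, with a grading by an even part `Sp`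
(`S⁺`) and an odd part `Sm` (`S⁻`) exchanged by the Clifford action of vectors. -/
structure SpinModule {E : Type*} [AddCommGroup E] [Module ℂ E] (Q : QuadraticForm ℂ E) where
  S : Type v
  [addCommGroup : AddCommGroup S]
  [module : Module ℂ S]
  [finite : FiniteDimensional ℂ S]
  c : CliffordAlgebra Q →ₐ[ℂ] Module.End ℂ S
  nontrivial : Nontrivial S
  simple : ∀ U : Submodule ℂ S, (∀ a, ∀ v ∈ U, c a v ∈ U) → U = ⊥ ∨ U = ⊤
  Sp : Submodule ℂ S
  Sm : Submodule ℂ S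
  isCompl : IsCompl Sp Sm
  map_Sp : ∀ u, ∀ v ∈ Sp, c (CliffordAlgebra.ι Q u) v ∈ Sm
  map_Sm : ∀ u, ∀ v ∈ Sm, c (CliffordAlgebra.ι Q u) v ∈ Sp

attribute [instance] SpinModule.addCommGroup SpinModule.module SpinModule.finite

section Dirac

variable {n : ℕ} {T H G : RealAlgGroup n} {B : LinearMap.BilinForm ℂ G.lie}

/-- The orthogonal complement `𝔰` of `𝔥` in `𝔤`. -/
def orthCompl (H G : RealAlgGroup n) (B : LinearMap.BilinForm ℂ G.lie) : Submodule ℂ G.lie where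
  carrier := {X | ∀ Y : G.lie, (Y : Matrix (Fin n) (Fin n) ℂ) ∈ H.lie → B X Y = 0}
  add_mem' := fun {X X'} hX hX' Y hY => by
    rw [map_add, LinearMap.add_apply, hX Y hY, hX' Y hY, add_zero]
  zero_mem' := fun Y _ => by simp
  smul_mem' := fun a X hX Y hY => by
    rw [map_smul, LinearMap.smul_apply, hX Y hY, smul_zero]

/-- The quadratic form `u ↦ -B(u, u)` on `𝔰`. In its Clifford algebra `C(𝔰)` one has
`u u' + u' u = -2 B(u, u')`. -/
def cliffordForm (H G : RealAlgGroup n) (B : LinearMap.BilinForm ℂ G.lie) :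
    QuadraticForm ℂ (orthCompl H G B) :=
  -(LinearMap.BilinMap.toQuadraticMap (B.restrict (orthCompl H G B)))

variable {m : ℕ} (Z : Module.Basis (Fin m) ℂ (orthCompl H G B))

/-- `Z` is an orthonormal basis of `𝔰`. -/
def IsOrthonormalBasis : Prop :=
  ∀ i j, B (Z i : G.lie) (Z j : G.lie) = if i = j then 1 else 0

/-- The map `α(X) = -¼ ∑_j [X, Z_j] Z_j` from `𝔥` to `C(𝔰)`, with `[X, Z_j] ∈ 𝔰` expanded
as `∑_k B([X, Z_j], Z_k) Z_k`. -/
def spinMap (X : G.lie) : CliffordAlgebra (cliffordForm H G B) :=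
  (-(1 / 4) : ℂ) • ∑ j, ∑ k, B ⁅X, (Z j : G.lie)⁆ (Z k : G.lie) •
    (CliffordAlgebra.ι (cliffordForm H G B) (Z k) * CliffordAlgebra.ι (cliffordForm H G B) (Z j))

/-- The cubic element `v = ½ ∑_{i<j<k} B([Z_i, Z_j], Z_k) Z_i Z_j Z_k` of `C(𝔰)`. -/
def cubicElement : CliffordAlgebra (cliffordForm H G B) :=
  (1 / 2 : ℂ) • ∑ i, ∑ j, ∑ k, if i < j ∧ j < k then
    B ⁅(Z i : G.lie), (Z j : G.lie)⁆ (Z k : G.lie) •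
      (CliffordAlgebra.ι (cliffordForm H G B) (Z i) *
        CliffordAlgebra.ι (cliffordForm H G B) (Z j) *
        CliffordAlgebra.ι (cliffordForm H G B) (Z k)) else 0

variable (S : SpinModule.{v} (cliffordForm H G B))

/-- `σ` is the representation of `T(ℝ)` on the spin module with differential `X ↦ α(X)`;
it respects the grading. -/
def IsSpinRep (T : RealAlgGroup n) (σ : T.realPts →* Module.End ℂ S.S) : Prop :=
  (∀ γ, (∀ v ∈ S.Sp, σ γ v ∈ S.Sp) ∧ ∀ v ∈ S.Sm, σ γ v ∈ S.Sm) ∧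
  ∀ (X : G.lie), (X : Matrix (Fin n) (Fin n) ℂ) ∈ T.lie →
    IsRealMatrix (X : Matrix (Fin n) (Fin n) ℂ) → ∀ p : ℝ → T.realPts,
    (∀ s : ℝ, ((p s : GL (Fin n) ℂ) : Matrix (Fin n) (Fin n) ℂ) =
      NormedSpace.exp ((s : ℂ) • (X : Matrix (Fin n) (Fin n) ℂ))) →
    ∀ (v : S.S) (f : Module.Dual ℂ S.S),
      HasDerivAt (fun s => f (σ (p s) v)) (f (S.c (spinMap Z X) v)) 0

/-- The normalisation of the labelling of the half-spin modules (which are determined by `S` up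
to interchange): the vectors killed by the positive root vectors in `𝔰`, which form the line of
weight `ρ - ρ_𝔥`, lie in `S⁺` if `q(G) - q(H)` is even and in `S⁻` if it is odd. -/
def IsNormalized (x : T.lie) : Prop :=
  ∀ v : S.S, (∀ α ∈ posRoots G.lie T.lie x, ∀ u : orthCompl H G B,
      ((u : G.lie) : Matrix (Fin n) (Fin n) ℂ) ∈ rootSpace G.lie T.lie α →
        S.c (CliffordAlgebra.ι (cliffordForm H G B) u) v = 0) →
    (Even ((G.q : ℤ) - H.q) → v ∈ S.Sp) ∧ (¬ Even ((G.q : ℤ) - H.q) → v ∈ S.Sm)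

/-- The cubic Dirac operator `D = ∑ Z_i ⊗ Z_i + 1 ⊗ v` acting on `F ⊗ S`. -/
def diracOp (F : RealRep G) : Module.End ℂ (F.V ⊗[ℂ] S.S) :=
  ∑ i, TensorProduct.map (F.lieAct (Z i : G.lie))
      (S.c (CliffordAlgebra.ι (cliffordForm H G B) (Z i))) +
    TensorProduct.map LinearMap.id (S.c (cubicElement Z))

/-- The subspace `F ⊗ U` of `F ⊗ S`. -/
def tensorSub (F : RealRep G) (U : Submodule ℂ S.S) : Submodule ℂ (F.V ⊗[ℂ] S.S) :=
  LinearMap.range (TensorProduct.map (LinearMap.id : F.V →ₗ[ℂ] F.V) U.subtype)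

/-- The character on `T(ℝ)` of the Dirac index of `F`, i.e. of the virtual representation
`ker D⁺ - coker D⁺`, where `D⁺ : F ⊗ S⁺ → F ⊗ S⁻` is the restriction of `D`; the trace on
`coker D⁺ = (F ⊗ S⁻) / D(F ⊗ S⁺)` is written as a difference. -/
def diracIndexChar (F : RealRep G) (hTG : T.cpts ≤ G.cpts)
    (σ : T.realPts →* Module.End ℂ S.S) (γ : T.realPts) : ℂ :=
  traceOn (TensorProduct.map (F.resAct hTG γ) (σ γ))
      (LinearMap.ker (diracOp Z S F) ⊓ tensorSub S F S.Sp) -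
    (traceOn (TensorProduct.map (F.resAct hTG γ) (σ γ)) (tensorSub S F S.Sm) -
      traceOn (TensorProduct.map (F.resAct hTG γ) (σ γ))
        ((tensorSub S F S.Sp).map (diracOp Z S F)))

end Dirac

end TransferFactor

end

open TransferFactor

/-!
The transfer factor is a quotient of two Weyl denominators, and the graded character of the spin
module is the same quotient.

As `T(ℝ)` is compact, the real elements of its Lie algebra are semisimple with imaginary eigenvalues
(`exists_torusData`). Hence `𝔱` acts diagonally on `ℂⁿ`, on `𝔤` and on `𝔥`, and the trace form,
positive on the real span of the weights, makes the weights of `𝔤` and of `𝔥` reduced root systems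
with one-dimensional root spaces (`rootSys`, `splitData`). Every element of `T(ℝ)` is an exponential
(`exists_log`), so characters of `T(ℝ)` are evaluations of formal exponentials `e^μ` (`evT`).

The space `𝔰` is the sum of the root spaces for the roots of `𝔤` that are not roots of `𝔥`, and
root vectors for positive and negative roots are dual bases of isotropic subspaces (`polarS`). They
act on the spin module `S` as annihilation and creation operators, so `S` is a Fock space. Its
vacuum, killed by the positive root vectors, has weight `ρ - ρ_𝔥` (`PolarBasis.spinMap_vacuum`), and
its parity is fixed by the normalisation of the half-spin modules. The trace of the torus times the
grading is therefore `(-1)^{q(G) - q(H)} e^{ρ - ρ_𝔥} ∏ (1 - e^{-α})`, with `α` running over the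
positive roots in `𝔰` (`IsCAR.trace_eq`, `exists_spin_basis`). This is the quotient of the products
`∏ (e^{α/2} - e^{-α/2})` for `𝔤` and `𝔥` (`evT_den_mul`), and so, by the Weyl denominator formula
(`RootSys.den_eq_alt`), the quotient of the two alternating sums. The denominator does not vanish
at `H`-regular elements (`evT_den_ne_zero`). The weights of `S` are `ρ - ρ_𝔥` minus sums of
roots, hence integral, so that the action on `S` integrates to `T(ℝ)` (`exists_spinRep`).

The cubic Dirac operator commutes with `𝔱` (`diracOp_comm`). By the Euler-Poincaré principle
(`traceOn_ker_add_map`) the character of the Dirac index of `F` is that of `F ⊗ S⁺ - F ⊗ S⁻`, that is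
`Θ_F (ch S⁺ - ch S⁻)` (`diracIndexChar_eq`); neither the square nor the kernel of the operator has
to be computed.

The last formula is a comparison of Weyl numerators. The Weyl character formula for `𝔤` and `𝔥`
(`SplitData.IsHighest.weyl_character`) is proved with the Casimir operator: Freudenthal's formula
says that the product of the character and the denominator is an eigenvector of the Laplacian on
formal exponentials, and an alternating eigenvector with top term `e^{λ + ρ}` is the alternating sum
over the orbit of `λ + ρ`. As `W¹` represents the cosets of `W_𝔥` in `W`, the numerator for `𝔤` is a
signed sum of numerators for `𝔥` (`RootSys.alt_eq_sum`, `character_mul_den`).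
-/


noncomputable section

namespace WeylChar

/-! ### Finite root systems in a complex vector space -/

/-- A reduced root system `Φ` in a complex vector space, presented by a symmetric bilinear form
which is positive definite on the root lattice, together with a real-valued height functional
`ht` without zeros on `Φ`, which singles out the positive roots. -/
structure RootSys (V : Type*) [AddCommGroup V] [Module ℂ V] where
  Φ : Finset V
  form : LinearMap.BilinForm ℂ V
  symm : ∀ μ ν, form μ ν = form ν μ
  ht : V →ₗ[ℝ] ℝ
  ht_ne : ∀ α ∈ Φ, ht α ≠ 0
  pos_def : ∀ β ∈ AddSubgroup.closure (Φ : Set V), β ≠ 0 → 0 < (form β β).re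
  im_eq : ∀ α ∈ Φ, (form α α).im = 0
  int : ∀ α ∈ Φ, ∀ β ∈ Φ, ∃ k : ℤ, 2 * form α β / form α α = k
  refl_mem : ∀ α ∈ Φ, ∀ β ∈ Φ, β - (2 * form α β / form α α) • α ∈ Φ
  reduced : ∀ α ∈ Φ, ∀ β ∈ Φ, ∀ c : ℝ, β = (c : ℂ) • α → β = α ∨ β = -α

namespace RootSys

variable {V : Type*} [AddCommGroup V] [Module ℂ V] (R : RootSys V)

/-- The coroot of `α` as a functional, `μ ↦ 2(α, μ) / (α, α)`. -/
def cor (α : V) : Module.Dual ℂ V := (2 / R.form α α) • R.form α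

theorem cor_apply (α μ : V) : R.cor α μ = 2 * R.form α μ / R.form α α := by
  simp [cor]; ring

theorem ne_zero {α : V} (h : α ∈ R.Φ) : α ≠ 0 := by
  rintro rfl; exact R.ht_ne 0 h (map_zero _)

theorem form_self_re_pos {α : V} (h : α ∈ R.Φ) : 0 < (R.form α α).re :=
  R.pos_def α (AddSubgroup.subset_closure h) (R.ne_zero h)

theorem form_self_ne {α : V} (h : α ∈ R.Φ) : R.form α α ≠ 0 := fun h' => by
  have := R.form_self_re_pos h
  simp [h'] at this

theorem form_self_eq {α : V} (h : α ∈ R.Φ) : R.form α α = ((R.form α α).re : ℂ) :=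
  Complex.ext rfl (by simpa using R.im_eq α h)

theorem cor_self {α : V} (h : α ∈ R.Φ) : R.cor α α = 2 := by
  rw [cor_apply, mul_div_assoc, div_self (R.form_self_ne h), mul_one]

/-- The reflection `μ ↦ μ - 2(α, μ) / (α, α) α`. For isotropic `α` the division by zero makes it
the identity. -/
def refl (α : V) : V ≃ₗ[ℂ] V :=
  LinearEquiv.ofInvolutive (LinearMap.id - (R.cor α).smulRight α) <| by
    intro μ
    by_cases h : R.form α α = 0
    · simp [cor_apply, h]
    · have : R.cor α α = 2 := by rw [cor_apply, mul_div_assoc, div_self h, mul_one]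
      simp [this, mul_two]

theorem refl_apply (α μ : V) : R.refl α μ = μ - R.cor α μ • α := rfl

theorem refl_self {α : V} (h : α ∈ R.Φ) : R.refl α α = -α := by
  rw [refl_apply, R.cor_self h, two_smul]; abel

theorem refl_mem' {α β : V} (h : α ∈ R.Φ) (hβ : β ∈ R.Φ) : R.refl α β ∈ R.Φ := by
  rw [refl_apply, cor_apply]; exact R.refl_mem α h β hβ

theorem neg_mem {α : V} (h : α ∈ R.Φ) : -α ∈ R.Φ := by
  rw [← R.refl_self h]; exact R.refl_mem' h h

theorem refl_refl (α μ : V) : R.refl α (R.refl α μ) = μ := by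
  by_cases h : R.form α α = 0
  · simp [refl_apply, cor_apply, h]
  · have : R.cor α α = 2 := by rw [cor_apply, mul_div_assoc, div_self h, mul_one]
    simp [refl_apply, this, mul_two]

theorem refl_mul_self (α : V) : R.refl α * R.refl α = 1 := by
  ext μ; exact R.refl_refl α μ

theorem refl_inv (α : V) : (R.refl α)⁻¹ = R.refl α :=
  inv_eq_of_mul_eq_one_left (R.refl_mul_self α)

theorem refl_neg (α : V) : R.refl (-α) = R.refl α := by
  ext μ; simp [refl_apply, cor_apply, neg_div]

theorem form_refl (α μ ν : V) : R.form (R.refl α μ) (R.refl α ν) = R.form μ ν := by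
  by_cases h : R.form α α = 0
  · simp [refl_apply, cor_apply, h]
  · simp only [refl_apply, cor_apply, map_sub, map_smul, LinearMap.sub_apply,
      LinearMap.smul_apply, smul_eq_mul, R.symm μ α]
    field_simp
    ring

/-- Isometries conjugate reflections. -/
theorem refl_map {w : V ≃ₗ[ℂ] V} (hw : ∀ μ ν, R.form (w μ) (w ν) = R.form μ ν) (α : V) :
    R.refl (w α) = w * R.refl α * w⁻¹ := by
  ext μ
  obtain ⟨ν, rfl⟩ := w.surjective μ
  change _ = w (R.refl α (w.symm (w ν)))
  simp [refl_apply, cor_apply, hw]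

/-- The Weyl group. -/
def weyl : Subgroup (V ≃ₗ[ℂ] V) := Subgroup.closure {s | ∃ α ∈ R.Φ, s = R.refl α}

theorem refl_mem_weyl {α : V} (h : α ∈ R.Φ) : R.refl α ∈ R.weyl :=
  Subgroup.subset_closure ⟨α, h, rfl⟩

theorem weyl_induction {p : (V ≃ₗ[ℂ] V) → Prop} (h1 : p 1)
    (hs : ∀ α ∈ R.Φ, ∀ w, p w → p (R.refl α * w)) {w : V ≃ₗ[ℂ] V} (hw : w ∈ R.weyl) : p w := by
  induction hw using Subgroup.closure_induction_left with
  | one => exact h1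
  | mul_left x hx y _ ih => obtain ⟨α, hα, rfl⟩ := hx; exact hs α hα _ ih
  | inv_mul_cancel x hx y _ ih =>
    obtain ⟨α, hα, rfl⟩ := hx; rw [refl_inv]; exact hs α hα _ ih

theorem form_weyl {w : V ≃ₗ[ℂ] V} (hw : w ∈ R.weyl) (μ ν : V) :
    R.form (w μ) (w ν) = R.form μ ν := by
  refine R.weyl_induction (p := fun w => ∀ μ ν, R.form (w μ) (w ν) = R.form μ ν)
    (fun _ _ => rfl) (fun α _ w h μ ν => ?_) hw μ ν
  simp only [LinearEquiv.mul_apply, form_refl, h]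

theorem weyl_mem {w : V ≃ₗ[ℂ] V} (hw : w ∈ R.weyl) {β : V} (hβ : β ∈ R.Φ) : w β ∈ R.Φ := by
  refine R.weyl_induction (p := fun w => w β ∈ R.Φ) hβ (fun α hα w h => ?_) hw
  exact R.refl_mem' hα h

/-! ### Positive and simple roots -/

open Classical in
/-- The positive roots. -/
def pos : Finset V := R.Φ.filter (0 < R.ht ·)

theorem mem_pos {α : V} : α ∈ R.pos ↔ α ∈ R.Φ ∧ 0 < R.ht α := by simp [pos]

theorem pos_sub {α : V} (h : α ∈ R.pos) : α ∈ R.Φ := (R.mem_pos.1 h).1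

theorem pos_or_neg {α : V} (h : α ∈ R.Φ) : α ∈ R.pos ∨ -α ∈ R.pos := by
  rcases lt_or_gt_of_ne (R.ht_ne α h) with h' | h'
  · exact .inr (R.mem_pos.2 ⟨R.neg_mem h, by simpa using h'⟩)
  · exact .inl (R.mem_pos.2 ⟨h, h'⟩)

theorem neg_notMem_pos {α : V} (h : α ∈ R.pos) : -α ∉ R.pos := fun h' => by
  have h1 := (R.mem_pos.1 h).2
  have h2 := (R.mem_pos.1 h').2
  rw [map_neg] at h2
  linarith

/-- The bilinear form takes real values on the root lattice; `reForm β` is the real functional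
`μ ↦ Re (μ, β)`. -/
def reForm (β : V) : V →ₗ[ℝ] ℝ := Complex.reLm ∘ₗ (R.form β).restrictScalars ℝ

@[simp] theorem reForm_apply (β μ : V) : R.reForm β μ = (R.form β μ).re := rfl

theorem cor_eq_re {α : V} (hα : α ∈ R.Φ) (μ : V) (h : (R.form α μ).im = 0) :
    R.cor α μ = ((2 * (R.form α μ).re / (R.form α α).re : ℝ) : ℂ) := by
  have e : R.form α μ = ((R.form α μ).re : ℂ) := Complex.ext rfl (by simpa using h)
  rw [cor_apply, R.form_self_eq hα, e]; push_cast; simp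

theorem form_im {α β : V} (hα : α ∈ R.Φ) (hβ : β ∈ R.Φ) : (R.form α β).im = 0 := by
  obtain ⟨k, hk⟩ := R.int α hα β hβ
  have : R.form α β = ((k * (R.form α α).re / 2 : ℝ) : ℂ) := by
    rw [div_eq_iff (R.form_self_ne hα), R.form_self_eq hα] at hk
    push_cast
    linear_combination hk / 2
  rw [this, Complex.ofReal_im]

theorem eq_of_pos_smul {α β : V} (hα : α ∈ R.pos) (hβ : β ∈ R.pos) (c : ℝ)
    (h : α = (c : ℂ) • β) : α = β := by
  refine (R.reduced β (R.pos_sub hβ) α (R.pos_sub hα) c h).resolve_right fun h' => ?_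
  exact R.neg_notMem_pos hβ (h' ▸ hα)

open NNReal in
/-- The cone of nonnegative real combinations. -/
abbrev cone (S : Set V) : Submodule ℝ≥0 V := Submodule.span ℝ≥0 S

/-- A simple root: a positive root whose reflection permutes the other positive roots. -/
def IsSimple (γ : V) : Prop := γ ∈ R.pos ∧ ∀ α ∈ R.pos, α ≠ γ → R.refl γ α ∈ R.pos

open NNReal in
theorem cone_pos_or (S : Set V) (ψ : V →ₗ[ℝ] ℝ) (h : ∀ γ ∈ S, 0 < ψ γ) {v : V}
    (hv : v ∈ cone S) : v = 0 ∨ 0 < ψ v := by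
  induction hv using Submodule.span_induction with
  | mem x hx => exact .inr (h x hx)
  | zero => exact .inl rfl
  | add x y _ _ hx hy =>
    rcases hx with rfl | hx
    · simpa using hy
    · rcases hy with rfl | hy
      · simpa using Or.inr hx
      · right; rw [map_add]; positivity
  | smul a x _ hx =>
    rcases hx with rfl | hx
    · simp
    · rcases eq_or_ne a 0 with rfl | ha
      · simp
      · right
        change 0 < ψ ((a : ℝ) • x)
        rw [map_smul, smul_eq_mul]
        have : (0 : ℝ) < a := by positivity
        positivity

open NNReal in
theorem cone_nonneg (S : Set V) (ψ : V →ₗ[ℝ] ℝ) (h : ∀ γ ∈ S, 0 ≤ ψ γ) {v : V}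
    (hv : v ∈ cone S) : 0 ≤ ψ v := by
  induction hv using Submodule.span_induction with
  | mem x hx => exact h x hx
  | zero => simp
  | add x y _ _ hx hy => rw [map_add]; positivity
  | smul a x _ hx =>
    change 0 ≤ ψ ((a : ℝ) • x)
    rw [map_smul, smul_eq_mul]
    have : (0 : ℝ) ≤ a := a.2
    positivity

open NNReal Classical in
/-- A minimal set of positive roots generating the cone of positive roots consists of simple
roots. -/
theorem exists_simple_cone : ∃ Δ : Finset V, (∀ γ ∈ Δ, R.IsSimple γ) ∧
    ∀ α ∈ R.pos, α ∈ cone (Δ : Set V) := by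
  obtain ⟨Δ, hΔ, hmin⟩ := Finset.exists_min_image
    (R.pos.powerset.filter fun Δ : Finset V => ∀ α ∈ R.pos, α ∈ cone (Δ : Set V)) Finset.card
    ⟨R.pos, by simpa using fun α hα => Submodule.subset_span (by simpa using hα)⟩
  simp only [Finset.mem_filter, Finset.mem_powerset] at hΔ hmin
  obtain ⟨hsub, hgen⟩ := hΔ
  refine ⟨Δ, fun β hβ => ⟨hsub hβ, fun α hα hne => ?_⟩, hgen⟩
  by_contra hneg
  have hβp := hsub hβ
  set δ := -R.refl β α with hδ
  have hδp : δ ∈ R.pos :=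
    (R.pos_or_neg (R.refl_mem' (R.pos_sub hβp) (R.pos_sub hα))).resolve_left hneg
  have hins : (Δ : Set V) = insert β ((Δ.erase β : Finset V) : Set V) := by
    rw [Finset.coe_erase, Set.insert_sdiff_singleton, Set.insert_eq_of_mem (by simpa using hβ)]
  have hdec : ∀ v ∈ R.pos, ∃ a : ℝ≥0, ∃ v' ∈ cone ((Δ.erase β : Finset V) : Set V),
      v = a • β + v' := by
    intro v hv
    have := hgen v hv
    rw [hins, cone, Submodule.mem_span_insert] at this
    obtain ⟨a, z, hz, h⟩ := this
    exact ⟨a, z, hz, h⟩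
  obtain ⟨a, α', hα', eα⟩ := hdec α hα
  obtain ⟨b, δ', hδ', eδ⟩ := hdec δ hδp
  have hk := R.cor_eq_re (R.pos_sub hβp) α (R.form_im (R.pos_sub hβp) (R.pos_sub hα))
  set k : ℝ := 2 * (R.form β α).re / (R.form β β).re with hkdef
  have hsum : α + δ = (k : ℝ) • β := by
    rw [hδ, R.refl_apply, hk, Complex.coe_smul]; abel
  have eα' : α = (a : ℝ) • β + α' := eα
  have eδ' : δ = (b : ℝ) • β + δ' := eδ
  have key : α' + δ' = (k - a - b : ℝ) • β := by
    have : α' + δ' = (α + δ) - (a : ℝ) • β - (b : ℝ) • β := by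
      conv_rhs => rw [eα', eδ']
      abel
    rw [this, hsum, ← sub_smul, ← sub_smul]
  have hht : ∀ γ ∈ ((Δ.erase β : Finset V) : Set V), 0 < R.ht γ := fun γ hγ =>
    (R.mem_pos.1 (hsub (Finset.mem_of_mem_erase (Finset.mem_coe.1 hγ)))).2
  have hβht := (R.mem_pos.1 hβp).2
  rcases lt_or_ge 0 (k - a - b) with hc | hc
  · -- `β` would be redundant, against minimality
    have hβc : β ∈ cone ((Δ.erase β : Finset V) : Set V) := by
      obtain ⟨c, hcβ⟩ : ∃ c : ℝ≥0, β = c • (α' + δ') := by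
        refine ⟨⟨(k - a - b)⁻¹, by positivity⟩, ?_⟩
        change β = ((k - a - b)⁻¹ : ℝ) • (α' + δ')
        rw [key, smul_smul, inv_mul_cancel₀ hc.ne', one_smul]
      have h2 := Submodule.smul_mem _ c (Submodule.add_mem _ hα' hδ')
      rwa [← hcβ] at h2
    have hle := hmin (Δ.erase β) ⟨(Finset.erase_subset _ _).trans hsub, fun v hv => by
      obtain ⟨c, v', hv', rfl⟩ := hdec v hv
      exact Submodule.add_mem _ (Submodule.smul_mem _ _ hβc) hv'⟩
    exact absurd hle (not_le.2 (Finset.card_erase_lt_of_mem hβ))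
  · have h0 : R.ht (α' + δ') ≤ 0 := by
      rw [key, map_smul, smul_eq_mul]
      exact mul_nonpos_of_nonpos_of_nonneg hc hβht.le
    have hα0 : α' = 0 := by
      rcases cone_pos_or _ R.ht hht hα' with h | h
      · exact h
      · have := cone_nonneg _ R.ht (fun γ hγ => (hht γ hγ).le) hδ'
        rw [map_add] at h0
        linarith
    refine hne (R.eq_of_pos_smul hα hβp a ?_)
    rw [Complex.coe_smul, eα', hα0, add_zero]

theorem pos_of_simple (ψ : V →ₗ[ℝ] ℝ) (h : ∀ γ, R.IsSimple γ → 0 < ψ γ) {α : V}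
    (hα : α ∈ R.pos) : 0 < ψ α := by
  obtain ⟨Δ, hΔ, hc⟩ := R.exists_simple_cone
  exact (cone_pos_or _ ψ (fun γ hγ => h γ (hΔ γ hγ)) (hc α hα)).resolve_left
    (R.ne_zero (R.pos_sub hα))

theorem nonneg_of_simple (ψ : V →ₗ[ℝ] ℝ) (h : ∀ γ, R.IsSimple γ → 0 ≤ ψ γ) {α : V}
    (hα : α ∈ R.pos) : 0 ≤ ψ α := by
  obtain ⟨Δ, hΔ, hc⟩ := R.exists_simple_cone
  exact cone_nonneg _ ψ (fun γ hγ => h γ (hΔ γ hγ)) (hc α hα)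

/-! ### The Weyl group acts freely on chambers -/

/-- The product of the reflections in a list of roots. -/
def word (l : List V) : V ≃ₗ[ℂ] V := (l.map R.refl).prod

theorem word_mem {l : List V} (hl : ∀ γ ∈ l, γ ∈ R.Φ) : R.word l ∈ R.weyl := by
  refine Subgroup.list_prod_mem _ fun s hs => ?_
  obtain ⟨γ, hγ, rfl⟩ := List.mem_map.1 hs
  exact R.refl_mem_weyl (hl γ hγ)

/-- Every Weyl group element is a product of simple reflections. -/
theorem exists_word {w : V ≃ₗ[ℂ] V} (hw : w ∈ R.weyl) :
    ∃ l : List V, (∀ γ ∈ l, R.IsSimple γ) ∧ w = R.word l := by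
  classical
  let Γ : Subgroup (V ≃ₗ[ℂ] V) := Subgroup.closure {s | ∃ γ, R.IsSimple γ ∧ s = R.refl γ}
  -- Among the positive roots whose reflection is not a product of simple reflections take one of
  -- minimal height; a simple reflection lowers its height and conjugates its reflection.
  have hpos : ∀ β ∈ R.pos, R.refl β ∈ Γ := by
    by_contra! hcon
    obtain ⟨β₀, hβ₀, hβ₀'⟩ := hcon
    obtain ⟨β, hβ, hmin⟩ := Finset.exists_min_image (R.pos.filter fun β => R.refl β ∉ Γ) R.ht
      ⟨β₀, by simp [hβ₀, hβ₀']⟩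
    simp only [Finset.mem_filter] at hβ hmin
    obtain ⟨γ, hγ, hγβ⟩ : ∃ γ, R.IsSimple γ ∧ 0 < (R.form β γ).re := by
      by_contra! hcon
      have := R.nonneg_of_simple (-R.reForm β) (fun γ hγ => by simpa using hcon γ hγ) hβ.1
      have h2 := R.form_self_re_pos (R.pos_sub hβ.1)
      simp at this
      linarith
    have hne : β ≠ γ := by
      rintro rfl
      exact hβ.2 (Subgroup.subset_closure ⟨β, hγ, rfl⟩)
    have hmem := hγ.2 β hβ.1 hne
    have hγΦ := R.pos_sub hγ.1
    have hlt : R.ht (R.refl γ β) < R.ht β := by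
      rw [refl_apply, R.cor_eq_re hγΦ β (R.form_im hγΦ (R.pos_sub hβ.1)), Complex.coe_smul,
        map_sub, map_smul, smul_eq_mul]
      have h1 := R.form_self_re_pos hγΦ
      have h2 := (R.mem_pos.1 hγ.1).2
      rw [R.symm β γ] at hγβ
      have : 0 < 2 * (R.form γ β).re / (R.form γ γ).re * R.ht γ := by positivity
      linarith
    have hΓ : R.refl (R.refl γ β) ∈ Γ := by
      by_contra h
      exact absurd (hmin _ ⟨hmem, h⟩) (not_le.2 hlt)
    rw [R.refl_map (R.form_refl γ)] at hΓ
    have hγΓ : R.refl γ ∈ Γ := Subgroup.subset_closure ⟨γ, hγ, rfl⟩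
    rw [Subgroup.mul_mem_cancel_right _ (Γ.inv_mem hγΓ), Subgroup.mul_mem_cancel_left _ hγΓ] at hΓ
    exact hβ.2 hΓ
  have hwΓ : w ∈ Γ := by
    refine (Subgroup.closure_le Γ).2 ?_ hw
    rintro s ⟨α, hα, rfl⟩
    rcases R.pos_or_neg hα with h | h
    · exact hpos α h
    · rw [← R.refl_neg]; exact hpos _ h
  induction hwΓ using Subgroup.closure_induction_left with
  | one => exact ⟨[], by simp, by simp [word]⟩
  | mul_left x hx y hy ih =>
    obtain ⟨γ, hγ, rfl⟩ := hx
    obtain ⟨l, hl, rfl⟩ := ih (by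
      rwa [Subgroup.mul_mem_cancel_left _ (R.refl_mem_weyl (R.pos_sub hγ.1))] at hw)
    exact ⟨γ :: l, by simpa using ⟨hγ, hl⟩, by simp [word]⟩
  | inv_mul_cancel x hx y hy ih =>
    obtain ⟨γ, hγ, rfl⟩ := hx
    rw [refl_inv] at hw ⊢
    obtain ⟨l, hl, rfl⟩ := ih (by
      rwa [Subgroup.mul_mem_cancel_left _ (R.refl_mem_weyl (R.pos_sub hγ.1))] at hw)
    exact ⟨γ :: l, by simpa using ⟨hγ, hl⟩, by simp [word]⟩

/-- The exchange property. -/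
theorem exchange (l : List V) (hl : ∀ γ ∈ l, R.IsSimple γ) {γ : V} (hγ : R.IsSimple γ)
    (h : R.word l γ ∉ R.pos) : ∃ l' : List V, (∀ γ ∈ l', R.IsSimple γ) ∧
      l'.length + 1 = l.length ∧ R.word l = R.word l' * R.refl γ := by
  induction l with
  | nil => exact absurd hγ.1 (by simpa [word] using h)
  | cons β l ih =>
    have hβ : R.IsSimple β := hl β (by simp)
    have hl' : ∀ γ ∈ l, R.IsSimple γ := fun γ h => hl γ (by simp [h])
    have e : R.word (β :: l) = R.refl β * R.word l := by simp [word]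
    by_cases hp : R.word l γ ∈ R.pos
    · have heq : R.word l γ = β := by
        by_contra hne
        exact h (by rw [e]; exact hβ.2 _ hp hne)
      refine ⟨l, hl', rfl, ?_⟩
      have hw := R.form_weyl (R.word_mem fun γ hγ => R.pos_sub (hl' γ hγ).1)
      rw [e, ← heq, R.refl_map hw]
      group
    · obtain ⟨l', h1, h2, h3⟩ := ih hl' hp
      refine ⟨β :: l', by simpa using ⟨hβ, h1⟩, by simp [h2], ?_⟩
      rw [e, h3, ← mul_assoc]
      simp [word]

/-- A Weyl group element which preserves positivity of roots is trivial. -/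
theorem eq_one_of_pos {w : V ≃ₗ[ℂ] V} (hw : w ∈ R.weyl) (h : ∀ α ∈ R.pos, w α ∈ R.pos) :
    w = 1 := by
  obtain ⟨l, hl, rfl⟩ := R.exists_word hw
  induction hn : l.length using Nat.strong_induction_on generalizing l with
  | _ n ih =>
    rcases l.eq_nil_or_concat with rfl | ⟨l0, γ, rfl⟩
    · simp [word]
    · rw [List.concat_eq_append] at *
      have hγ : R.IsSimple γ := hl γ (by simp)
      have e : R.word (l0 ++ [γ]) = R.word l0 * R.refl γ := by simp [word]
      have hl0 : ∀ γ ∈ l0, R.IsSimple γ := fun γ h => hl γ (by simp [h])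
      have hneg : R.word l0 γ ∉ R.pos := fun hp => by
        have := h γ hγ.1
        rw [e, LinearEquiv.mul_apply, R.refl_self (R.pos_sub hγ.1), map_neg] at this
        exact R.neg_notMem_pos hp this
      obtain ⟨l', h1, h2, h3⟩ := R.exchange l0 hl0 hγ hneg
      have e' : R.word (l0 ++ [γ]) = R.word l' := by
        rw [e, h3, mul_assoc, refl_mul_self, mul_one]
      rw [e'] at h hw ⊢
      exact ih l'.length (by simp at hn; omega) l' h1 hw h rfl

instance weyl_finite : Finite R.weyl := by
  classical
  let F : R.weyl → (R.Φ → R.Φ) := fun w α => ⟨w.1 α, R.weyl_mem w.2 α.2⟩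
  refine Finite.of_injective F fun w w' h => ?_
  have : w'.1⁻¹ * w.1 = 1 := by
    refine R.eq_one_of_pos (R.weyl.mul_mem (R.weyl.inv_mem w'.2) w.2) fun α hα => ?_
    have : w.1 α = w'.1 α := congrArg Subtype.val (congrFun h ⟨α, R.pos_sub hα⟩)
    rw [LinearEquiv.mul_apply, this]
    change w'.1.symm (w'.1 α) ∈ _
    simpa using hα
  exact Subtype.ext (inv_mul_eq_one.1 this).symm

/-- A vector is strictly dominant if it pairs to a positive real number with every positive
root. -/
def StrictDom (μ : V) : Prop := ∀ α ∈ R.pos, (R.form α μ).im = 0 ∧ 0 < (R.form α μ).re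

/-- A vector is dominant if it pairs to a nonnegative real number with every positive root. -/
def Dom (μ : V) : Prop := ∀ α ∈ R.pos, (R.form α μ).im = 0 ∧ 0 ≤ (R.form α μ).re

/-- The Weyl group acts simply transitively on chambers: only the identity maps a strictly dominant
vector to a strictly dominant vector. -/
theorem eq_one_of_strictDom {w : V ≃ₗ[ℂ] V} (hw : w ∈ R.weyl) {μ ν : V} (hμ : R.StrictDom μ)
    (hν : R.StrictDom ν) (h : w μ = ν) : w = 1 := by
  refine R.eq_one_of_pos hw fun α hα => ?_
  refine (R.pos_or_neg (R.weyl_mem hw (R.pos_sub hα))).resolve_right fun hn => ?_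
  have h1 := (hν _ hn).2
  rw [map_neg, LinearMap.neg_apply, ← h, R.form_weyl hw] at h1
  have h2 := (hμ α hα).2
  simp at h1
  linarith

theorem weyl_form_im {μ : V} (h : ∀ α ∈ R.Φ, (R.form α μ).im = 0) {w : V ≃ₗ[ℂ] V}
    (hw : w ∈ R.weyl) : ∀ α ∈ R.Φ, (R.form α (w μ)).im = 0 := by
  intro α hα
  have := R.form_weyl hw (w⁻¹ α) μ
  have e : w (w⁻¹ α) = α := w.apply_symm_apply α
  rw [e] at this
  rw [this]
  exact h _ (R.weyl_mem (R.weyl.inv_mem hw) hα)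

/-- An element of maximal height in a Weyl group orbit is dominant. -/
theorem exists_dom (μ : V) (h : ∀ α ∈ R.Φ, (R.form α μ).im = 0) :
    ∃ w ∈ R.weyl, R.Dom (w μ) := by
  obtain ⟨w, hw⟩ := Finite.exists_max fun w : R.weyl => R.ht (w.1 μ)
  refine ⟨w.1, w.2, fun α hα => ?_⟩
  have hΦ := R.pos_sub hα
  have him := R.weyl_form_im h w.2 α hΦ
  refine ⟨him, ?_⟩
  have h1 := hw ⟨R.refl α * w.1, R.weyl.mul_mem (R.refl_mem_weyl hΦ) w.2⟩
  simp only [LinearEquiv.mul_apply, refl_apply, R.cor_eq_re hΦ _ him, Complex.coe_smul, map_sub,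
    map_smul, smul_eq_mul] at h1
  have h2 := R.form_self_re_pos hΦ
  have h3 := (R.mem_pos.1 hα).2
  by_contra hneg
  push Not at hneg
  have : 2 * (R.form α (w.1 μ)).re / (R.form α α).re * R.ht α < 0 :=
    mul_neg_of_neg_of_pos (div_neg_of_neg_of_pos (by linarith) h2) h3
  linarith

/-- Half the sum of the positive roots. -/
def hρ : V := (1 / 2 : ℂ) • ∑ α ∈ R.pos, α

theorem refl_hρ {γ : V} (hγ : R.IsSimple γ) : R.refl γ R.hρ = R.hρ - γ := by
  classical
  have h1 : ∑ α ∈ R.pos, α = γ + ∑ α ∈ R.pos.erase γ, α :=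
    (Finset.add_sum_erase _ _ hγ.1).symm
  have h2 : R.refl γ (∑ α ∈ R.pos.erase γ, α) = ∑ α ∈ R.pos.erase γ, α := by
    rw [map_sum]
    refine Finset.sum_bij' (fun α _ => R.refl γ α) (fun α _ => R.refl γ α) ?_ ?_ ?_ ?_ ?_
    · intro α hα
      obtain ⟨hne, hp⟩ := Finset.mem_erase.1 hα
      refine Finset.mem_erase.2 ⟨fun h => ?_, hγ.2 α hp hne⟩
      have : α = -γ := by
        rw [← R.refl_self (R.pos_sub hγ.1), ← R.refl_refl γ α, h]
      exact R.neg_notMem_pos hγ.1 (this ▸ hp)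
    · intro α hα
      obtain ⟨hne, hp⟩ := Finset.mem_erase.1 hα
      refine Finset.mem_erase.2 ⟨fun h => ?_, hγ.2 α hp hne⟩
      have : α = -γ := by
        rw [← R.refl_self (R.pos_sub hγ.1), ← R.refl_refl γ α, h]
      exact R.neg_notMem_pos hγ.1 (this ▸ hp)
    · intro α _; exact R.refl_refl _ _
    · intro α _; exact R.refl_refl _ _
    · intro α _; rfl
  rw [hρ, map_smul, h1, map_add, h2, R.refl_self (R.pos_sub hγ.1)]
  module

theorem cor_hρ {γ : V} (hγ : R.IsSimple γ) : R.cor γ R.hρ = 1 := by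
  have h := R.refl_hρ hγ
  rw [refl_apply, sub_right_inj] at h
  have := sub_smul (R.cor γ R.hρ) 1 γ
  rw [h, one_smul, sub_self, smul_eq_zero] at this
  exact sub_eq_zero.1 (this.resolve_right (R.ne_zero (R.pos_sub hγ.1)))

theorem hρ_form_im {α : V} (hα : α ∈ R.Φ) : (R.form α R.hρ).im = 0 := by
  have h : R.form α R.hρ = (1 / 2 : ℝ) • ∑ β ∈ R.pos, R.form α β := by
    rw [hρ, map_smul, map_sum, ← Complex.coe_smul]; norm_num
  rw [h, Complex.smul_im, Complex.im_sum,
    Finset.sum_eq_zero fun β hβ => R.form_im hα (R.pos_sub hβ), smul_zero]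

theorem hρ_strictDom : R.StrictDom R.hρ := by
  intro α hα
  refine ⟨R.hρ_form_im (R.pos_sub hα), ?_⟩
  rw [R.symm]
  refine R.pos_of_simple (R.reForm R.hρ) (fun γ hγ => ?_) hα
  have hΦ := R.pos_sub hγ.1
  have h := R.cor_hρ hγ
  rw [R.cor_eq_re hΦ _ (R.hρ_form_im hΦ)] at h
  have h1 : 2 * (R.form γ R.hρ).re / (R.form γ γ).re = 1 := by exact_mod_cast h
  have h2 := R.form_self_re_pos hΦ
  rw [div_eq_one_iff_eq h2.ne'] at h1
  rw [reForm_apply, R.symm]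
  linarith

theorem det_refl [FiniteDimensional ℂ V] {α : V} (hα : α ∈ R.Φ) :
    LinearMap.det (R.refl α : V →ₗ[ℂ] V) = -1 := by
  have : (R.refl α : V →ₗ[ℂ] V) = LinearMap.transvection (R.cor α) (-α) := by
    ext μ
    simp [refl_apply, LinearMap.transvection.apply, sub_eq_add_neg]
  rw [this, LinearMap.transvection.det]
  rw [map_neg, R.cor_self hα]; norm_num

end RootSys

end WeylChar

namespace WeylChar

/-! ### The group algebra of formal exponentials -/

section GroupAlgebra

variable {V : Type*} [AddCommGroup V]

/-- The algebra spanned by the formal exponentials `e^μ`, `μ ∈ V`. -/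
abbrev GA (V : Type*) [AddCommGroup V] := AddMonoidAlgebra ℂ V

/-- The formal exponential `e^μ`. -/
def ex (μ : V) : GA V := AddMonoidAlgebra.single μ 1

theorem ex_mul (μ ν : V) : ex μ * ex ν = ex (μ + ν) := by simp [ex]

theorem ex_zero : ex (0 : V) = 1 := rfl

theorem coeff_ex [DecidableEq V] (μ ν : V) :
    (ex μ).coeff ν = if μ = ν then (1 : ℂ) else 0 := by
  simp [ex, Finsupp.single_apply]

theorem ex_prod {ι : Type*} (s : Finset ι) (f : ι → V) : ∏ i ∈ s, ex (f i) = ex (∑ i ∈ s, f i) := by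
  classical
  induction s using Finset.induction_on with
  | empty => simp [ex_zero]
  | insert a s ha ih => rw [Finset.prod_insert ha, Finset.sum_insert ha, ih, ex_mul]

/-- To check a linear statement on `GA V`, exponentials suffice. -/
theorem ga_induction {p : GA V → Prop} (h0 : p 0) (hadd : ∀ f g, p f → p g → p (f + g))
    (hs : ∀ (c : ℂ) μ, p (c • ex μ)) (f : GA V) : p f := by
  induction f using AddMonoidAlgebra.induction_linear with
  | zero => exact h0
  | add f g hf hg => exact hadd f g hf hg
  | single μ c => simpa [ex, AddMonoidAlgebra.smul_single] using hs c μ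

/-- Evaluation of formal exponentials, `e^μ ↦ exp (φ μ)`. -/
def ev (φ : V →+ ℂ) : GA V →ₐ[ℂ] ℂ :=
  AddMonoidAlgebra.lift ℂ ℂ V
    { toFun := fun μ => Complex.exp (φ μ.toAdd)
      map_one' := by simp
      map_mul' := fun a b => by simp [Complex.exp_add] }

@[simp] theorem ev_ex (φ : V →+ ℂ) (μ : V) : ev φ (ex μ) = Complex.exp (φ μ) := by
  simp [ev, ex]

variable [Module ℂ V]

/-- The action of linear automorphisms on formal exponentials. -/
def gact (w : V ≃ₗ[ℂ] V) : GA V ≃ₐ[ℂ] GA V := AddMonoidAlgebra.domCongr ℂ ℂ w.toAddEquiv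

@[simp] theorem gact_ex (w : V ≃ₗ[ℂ] V) (μ : V) : gact w (ex μ) = ex (w μ) := by
  simp [gact, ex]

theorem gact_mul (w w' : V ≃ₗ[ℂ] V) (f : GA V) : gact (w * w') f = gact w (gact w' f) := by
  induction f using ga_induction with
  | h0 => simp
  | hadd f g hf hg => simp [hf, hg]
  | hs c μ => simp

theorem gact_one (f : GA V) : gact 1 f = f := by
  induction f using ga_induction with
  | h0 => simp
  | hadd f g hf hg => rw [map_add, hf, hg]
  | hs c μ => simp

theorem coeff_gact (w : V ≃ₗ[ℂ] V) (f : GA V) (μ : V) :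
    (gact w f).coeff (w μ) = f.coeff μ := by
  classical
  induction f using ga_induction with
  | h0 => simp
  | hadd f g hf hg => simp [hf, hg]
  | hs c ν => simp [coeff_ex]

/-- The sign of an automorphism, its determinant. -/
def sgn (w : V ≃ₗ[ℂ] V) : ℂ := LinearMap.det (w : V →ₗ[ℂ] V)

theorem sgn_mul (w w' : V ≃ₗ[ℂ] V) : sgn (w * w') = sgn w * sgn w' := by
  simp only [sgn]
  rw [← map_mul]; rfl

theorem sgn_one : sgn (1 : V ≃ₗ[ℂ] V) = 1 := by
  simp only [sgn]
  exact LinearMap.det_id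

/-- `∂_ν`, the linear operator `e^μ ↦ (ν, μ) e^μ`. -/
def dLin (B : LinearMap.BilinForm ℂ V) (ν : V) : GA V →ₗ[ℂ] GA V :=
  (AddMonoidAlgebra.coeffLinearEquiv ℂ).symm.toLinearMap ∘ₗ
    Finsupp.lsum ℂ (fun μ => B ν μ • Finsupp.lsingle μ) ∘ₗ
    (AddMonoidAlgebra.coeffLinearEquiv ℂ).toLinearMap

theorem dLin_ex (B : LinearMap.BilinForm ℂ V) (ν μ : V) : dLin B ν (ex μ) = B ν μ • ex μ := by
  simp [dLin, ex, AddMonoidAlgebra.coeffLinearEquiv]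

theorem dLin_mul (B : LinearMap.BilinForm ℂ V) (ν : V) (f g : GA V) :
    dLin B ν (f * g) = dLin B ν f * g + f * dLin B ν g := by
  induction f using ga_induction with
  | h0 => simp
  | hadd f f' hf hf' => rw [add_mul, map_add, hf, hf', map_add]; ring
  | hs c μ =>
    induction g using ga_induction with
    | h0 => simp
    | hadd f f' hf hf' => rw [mul_add, map_add, hf, hf', map_add]; ring
    | hs c' μ' =>
      simp only [map_smul, ex_mul, dLin_ex, map_add, smul_mul_assoc,
        mul_smul_comm]
      module

theorem dLin_prod {ι : Type*} [DecidableEq ι] (B : LinearMap.BilinForm ℂ V) (ν : V) (s : Finset ι)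
    (f : ι → GA V) :
    dLin B ν (∏ i ∈ s, f i) = ∑ i ∈ s, (∏ j ∈ s.erase i, f j) * dLin B ν (f i) := by
  induction s using Finset.induction_on with
  | empty =>
    rw [Finset.prod_empty, Finset.sum_empty, ← ex_zero, dLin_ex]; simp
  | insert a s ha ih =>
    rw [Finset.prod_insert ha, Finset.sum_insert ha, dLin_mul, ih, Finset.erase_insert ha,
      Finset.mul_sum, mul_comm]
    congr 1
    refine Finset.sum_congr rfl fun i hi => ?_
    have hne : a ≠ i := fun h => ha (h ▸ hi)
    rw [Finset.erase_insert_of_ne hne, Finset.prod_insert (by simp [ha]), mul_assoc]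

/-- The Laplacian, the linear operator `e^μ ↦ (μ, μ) e^μ`. -/
def lap (B : LinearMap.BilinForm ℂ V) : GA V →ₗ[ℂ] GA V :=
  (AddMonoidAlgebra.coeffLinearEquiv ℂ).symm.toLinearMap ∘ₗ
    Finsupp.lsum ℂ (fun μ => B μ μ • Finsupp.lsingle μ) ∘ₗ
    (AddMonoidAlgebra.coeffLinearEquiv ℂ).toLinearMap

theorem lap_ex (B : LinearMap.BilinForm ℂ V) (μ : V) : lap B (ex μ) = B μ μ • ex μ := by
  simp [lap, ex, AddMonoidAlgebra.coeffLinearEquiv]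

theorem coeff_lap (B : LinearMap.BilinForm ℂ V) (f : GA V) (μ : V) :
    (lap B f).coeff μ = B μ μ * f.coeff μ := by
  classical
  induction f using ga_induction with
  | h0 => simp
  | hadd f g hf hg => simp [hf, hg, mul_add]
  | hs c ν =>
    rw [map_smul, lap_ex]
    by_cases h : ν = μ
    · subst h; simp [coeff_ex, mul_comm]
    · simp [coeff_ex, h]

theorem lap_ex_mul (B : LinearMap.BilinForm ℂ V) (hB : ∀ μ ν, B μ ν = B ν μ) (ν : V) (g : GA V) :
    lap B (ex ν * g) = lap B (ex ν) * g + (2 : ℂ) • (ex ν * dLin B ν g) + ex ν * lap B g := by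
  induction g using ga_induction with
  | h0 => simp
  | hadd f g hf hg =>
    rw [mul_add, map_add, hf, hg, map_add, map_add]
    simp only [mul_add, smul_add]
    abel
  | hs c μ =>
    simp only [map_smul, mul_smul_comm, ex_mul, dLin_ex, lap_ex, smul_mul_assoc, map_add,
      LinearMap.add_apply, hB μ ν]
    module

end GroupAlgebra

/-! ### Alternating sums and the denominator formula -/

namespace RootSys

variable {V : Type*} [AddCommGroup V] [Module ℂ V] (R : RootSys V)

instance : Fintype R.weyl := Fintype.ofFinite _

/-- The alternating sum `∑_{w ∈ W} ε(w) e^{wΛ}`. -/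
def alt (Λ : V) : GA V := ∑ w : R.weyl, sgn w.1 • ex (w.1 Λ)

/-- The positive root cone: sums of positive roots. -/
def Qp : AddSubmonoid V := AddSubmonoid.closure (R.pos : Set V)

theorem Qp_ht {β : V} (h : β ∈ R.Qp) : β = 0 ∨ 0 < R.ht β := by
  induction h using AddSubmonoid.closure_induction with
  | mem x hx => exact .inr (R.mem_pos.1 hx).2
  | zero => exact .inl rfl
  | add x y _ _ hx hy =>
    rcases hx with rfl | hx
    · simpa using hy
    · rcases hy with rfl | hy
      · simpa using Or.inr hx
      · right; rw [map_add]; positivity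

theorem Qp_add_ne {β γ : V} (hβ : β ∈ R.Qp) (hγ : γ ∈ R.Qp) (h : β ≠ 0) : β + γ ≠ 0 := by
  intro h0
  have h1 := (R.Qp_ht hβ).resolve_left h
  have h2 : 0 ≤ R.ht γ := by
    rcases R.Qp_ht hγ with rfl | h
    · simp
    · exact h.le
  have := congrArg R.ht h0
  rw [map_add, map_zero] at this
  linarith

theorem Qp_sub_root {β : V} (h : β ∈ R.Qp) : β ∈ AddSubgroup.closure (R.Φ : Set V) := by
  have : R.Qp ≤ (AddSubgroup.closure (R.Φ : Set V)).toAddSubmonoid :=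
    (AddSubmonoid.closure_le).2 fun α hα => AddSubgroup.subset_closure (R.pos_sub hα)
  exact this h

/-- A functional which is nonnegative on positive roots is nonnegative on sums of them. -/
theorem Qp_nonneg (ψ : V →ₗ[ℝ] ℝ) (h : ∀ γ ∈ R.pos, 0 ≤ ψ γ) {β : V} (hβ : β ∈ R.Qp) :
    0 ≤ ψ β := by
  induction hβ using AddSubmonoid.closure_induction with
  | mem x hx => exact h x hx
  | zero => simp
  | add x y _ _ hx hy => rw [map_add]; positivity

theorem Qp_pos (ψ : V →ₗ[ℝ] ℝ) (h : ∀ γ ∈ R.pos, 0 < ψ γ) {β : V} (hβ : β ∈ R.Qp) :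
    β = 0 ∨ 0 < ψ β := by
  induction hβ using AddSubmonoid.closure_induction with
  | mem x hx => exact .inr (h x hx)
  | zero => exact .inl rfl
  | add x y _ _ hx hy =>
    rcases hx with rfl | hx
    · simpa using hy
    · rcases hy with rfl | hy
      · simpa using Or.inr hx
      · right; rw [map_add]; positivity

/-- The span of the `e^{Λ - β}` with `β` a nonzero sum of positive roots. -/
def lower (Λ : V) : Submodule ℂ (GA V) :=
  Submodule.span ℂ {f | ∃ β ∈ R.Qp, β ≠ 0 ∧ f = ex (Λ - β)}

/-- `f` is `e^Λ` plus lower terms. -/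
def HasTop (f : GA V) (Λ : V) : Prop := f - ex Λ ∈ R.lower Λ

theorem lower_coeff {Λ : V} {f : GA V} (hf : f ∈ R.lower Λ) {μ : V} (h : f.coeff μ ≠ 0) :
    ∃ β ∈ R.Qp, β ≠ 0 ∧ μ = Λ - β := by
  classical
  by_contra hcon
  apply h
  induction hf using Submodule.span_induction with
  | mem f hf =>
    obtain ⟨β, hβ, h0, rfl⟩ := hf
    rw [coeff_ex, if_neg]
    rintro rfl
    exact hcon ⟨β, hβ, h0, rfl⟩
  | zero => simp
  | add f g _ _ hf hg =>
    by_cases h1 : f.coeff μ = 0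
    · by_cases h2 : g.coeff μ = 0
      · simp [h1, h2]
      · exact absurd (hg h2) h2
    · exact absurd (hf h1) h1
  | smul c f _ hf =>
    by_cases h1 : f.coeff μ = 0
    · simp [h1]
    · exact absurd (hf h1) h1

theorem HasTop.coeff_top {f : GA V} {Λ : V} (h : R.HasTop f Λ) : f.coeff Λ = 1 := by
  classical
  have h0 : (f - ex Λ).coeff Λ = 0 := by
    by_contra hne
    obtain ⟨β, hβ, h0, h1⟩ := R.lower_coeff h hne
    exact h0 (sub_eq_self.1 h1.symm)
  have : f = (f - ex Λ) + ex Λ := by abel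
  rw [this, AddMonoidAlgebra.coeff_add, Finsupp.add_apply, h0, coeff_ex]; simp

theorem HasTop.coeff_support {f : GA V} {Λ : V} (h : R.HasTop f Λ) {μ : V} (hμ : f.coeff μ ≠ 0) :
    ∃ β ∈ R.Qp, μ = Λ - β := by
  classical
  by_cases hne : Λ = μ
  · exact ⟨0, zero_mem _, by simp [hne]⟩
  · have e : f = (f - ex Λ) + ex Λ := by abel
    rw [e, AddMonoidAlgebra.coeff_add, Finsupp.add_apply, coeff_ex, if_neg hne, add_zero] at hμ
    obtain ⟨β, hβ, _, h1⟩ := R.lower_coeff h hμ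
    exact ⟨β, hβ, h1⟩

theorem ex_mul_lower {Λ : V} (μ : V) {f : GA V} (hf : f ∈ R.lower Λ) :
    ex μ * f ∈ R.lower (μ + Λ) := by
  induction hf using Submodule.span_induction with
  | mem f hf =>
    obtain ⟨β, hβ, h0, rfl⟩ := hf
    exact Submodule.subset_span ⟨β, hβ, h0, by rw [ex_mul]; congr 1; abel⟩
  | zero => simp
  | add f g _ _ hf hg => rw [mul_add]; exact add_mem hf hg
  | smul c f _ hf => rw [mul_smul_comm]; exact Submodule.smul_mem _ _ hf

theorem lower_mul_lower {Λ Λ' : V} {f g : GA V} (hf : f ∈ R.lower Λ) (hg : g ∈ R.lower Λ') :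
    f * g ∈ R.lower (Λ + Λ') := by
  induction hf using Submodule.span_induction with
  | mem f hf =>
    obtain ⟨β, hβ, h0, rfl⟩ := hf
    induction hg using Submodule.span_induction with
    | mem g hg =>
      obtain ⟨γ, hγ, h0', rfl⟩ := hg
      exact Submodule.subset_span ⟨β + γ, add_mem hβ hγ, R.Qp_add_ne hβ hγ h0, by
        rw [ex_mul]; congr 1; abel⟩
    | zero => simp
    | add f g _ _ hf hg => rw [mul_add]; exact add_mem hf hg
    | smul c f _ hf => rw [mul_smul_comm]; exact Submodule.smul_mem _ _ hf
  | zero => simp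
  | add f g _ _ hf hg => rw [add_mul]; exact add_mem hf hg
  | smul c f _ hf => rw [smul_mul_assoc]; exact Submodule.smul_mem _ _ hf

theorem hasTop_ex (Λ : V) : R.HasTop (ex Λ) Λ := by simp [HasTop]

theorem HasTop.mul {f g : GA V} {Λ Λ' : V} (hf : R.HasTop f Λ) (hg : R.HasTop g Λ') :
    R.HasTop (f * g) (Λ + Λ') := by
  have h1 := R.ex_mul_lower Λ hg
  have h2 := R.ex_mul_lower Λ' hf
  have h3 := R.lower_mul_lower hf hg
  rw [add_comm Λ' Λ] at h2
  have e : f * g - ex (Λ + Λ') = ex Λ * (g - ex Λ') + ex Λ' * (f - ex Λ) +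
      (f - ex Λ) * (g - ex Λ') := by
    rw [← ex_mul]; ring
  rw [HasTop, e]
  exact add_mem (add_mem h1 h2) h3

/-- The Weyl denominator `∏_{α > 0} (e^{α/2} - e^{-α/2})`. -/
def den : GA V := ∏ α ∈ R.pos, (ex ((1 / 2 : ℂ) • α) - ex (-((1 / 2 : ℂ) • α)))

theorem den_eq : R.den = ex R.hρ * ∏ α ∈ R.pos, (1 - ex (-α)) := by
  rw [hρ, Finset.smul_sum, ← ex_prod, ← Finset.prod_mul_distrib, den]
  refine Finset.prod_congr rfl fun α _ => ?_
  rw [mul_sub, mul_one, ex_mul]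
  congr 2
  module

theorem den_hasTop : R.HasTop R.den R.hρ := by
  have h : ∀ s ⊆ R.pos, R.HasTop (∏ α ∈ s, (1 - ex (-α))) 0 := by
    classical
    intro s hs
    induction s using Finset.induction_on with
    | empty => simpa [ex_zero] using R.hasTop_ex 0
    | insert a s ha ih =>
      rw [Finset.prod_insert ha]
      have hap := hs (Finset.mem_insert_self a s)
      have h1 : R.HasTop (1 - ex (-a)) 0 := by
        have e : (1 - ex (-a)) - ex 0 = -ex (0 - a) := by rw [ex_zero, zero_sub]; ring
        rw [HasTop, e]
        refine Submodule.neg_mem _ (Submodule.subset_span ?_)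
        exact ⟨a, AddSubmonoid.subset_closure hap, R.ne_zero (R.pos_sub hap), rfl⟩
      simpa using HasTop.mul R h1 (ih fun x hx => hs (Finset.mem_insert_of_mem hx))
  have := HasTop.mul R (R.hasTop_ex R.hρ) (h R.pos subset_rfl)
  rwa [add_zero, ← den_eq] at this

/-- `f` is alternating under the Weyl group. -/
def Alternating (f : GA V) : Prop := ∀ w ∈ R.weyl, gact w f = sgn w • f

theorem Alternating.coeff {f : GA V} (h : R.Alternating f) {w : V ≃ₗ[ℂ] V} (hw : w ∈ R.weyl)
    (μ : V) : f.coeff (w μ) * sgn w = f.coeff μ := by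
  rw [← coeff_gact w f μ, h w hw]; simp [mul_comm]

theorem den_alternating [FiniteDimensional ℂ V] : R.Alternating R.den := by
  classical
  have hs : ∀ γ, R.IsSimple γ → gact (R.refl γ) R.den = -R.den := by
    intro γ hγ
    have hΦ := R.pos_sub hγ.1
    have e1 : R.den = (ex ((1 / 2 : ℂ) • γ) - ex (-((1 / 2 : ℂ) • γ))) *
        ∏ α ∈ R.pos.erase γ, (ex ((1 / 2 : ℂ) • α) - ex (-((1 / 2 : ℂ) • α))) :=
      (Finset.mul_prod_erase R.pos
        (fun α => ex ((1 / 2 : ℂ) • α) - ex (-((1 / 2 : ℂ) • α))) hγ.1).symm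
    have hmem : ∀ α ∈ R.pos.erase γ, R.refl γ α ∈ R.pos.erase γ := by
      intro α hα
      obtain ⟨hne, hp⟩ := Finset.mem_erase.1 hα
      refine Finset.mem_erase.2 ⟨fun h => ?_, hγ.2 α hp hne⟩
      have : α = -γ := by
        rw [← R.refl_self (R.pos_sub hγ.1), ← R.refl_refl γ α, h]
      exact R.neg_notMem_pos hγ.1 (this ▸ hp)
    have e2 : gact (R.refl γ) (∏ α ∈ R.pos.erase γ,
        (ex ((1 / 2 : ℂ) • α) - ex (-((1 / 2 : ℂ) • α)))) =
        ∏ α ∈ R.pos.erase γ, (ex ((1 / 2 : ℂ) • α) - ex (-((1 / 2 : ℂ) • α))) := by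
      rw [map_prod]
      refine Finset.prod_bij' (fun α _ => R.refl γ α) (fun α _ => R.refl γ α) hmem hmem
        (fun α _ => R.refl_refl _ _) (fun α _ => R.refl_refl _ _) (fun α _ => ?_)
      simp only [map_sub, gact_ex, map_neg, map_smul]
    rw [e1, map_mul, e2, map_sub, gact_ex, gact_ex, map_neg, map_smul, R.refl_self hΦ]
    simp only [smul_neg, neg_neg]
    ring
  intro w hw
  obtain ⟨l, hl, rfl⟩ := R.exists_word hw
  clear hw
  induction l with
  | nil => simp [word, gact_one, sgn_one]
  | cons γ l ih =>
    have e : R.word (γ :: l) = R.refl γ * R.word l := by simp [word]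
    rw [e, gact_mul, ih fun γ h => hl γ (by simp [h]), map_smul, hs γ (hl γ (by simp)), sgn_mul]
    have : sgn (R.refl γ) = -1 := R.det_refl (R.pos_sub (hl γ (by simp)).1)
    rw [this]
    simp

/-- An alternating element with top term `e^Λ`, `Λ` strictly dominant, all of whose dominant
exponents equal `Λ`, is the alternating sum over the orbit of `Λ`. -/
theorem eq_alt {f : GA V} {Λ : V} (hf : R.Alternating f) (ht : R.HasTop f Λ)
    (hΛ : R.StrictDom Λ) (hd : ∀ μ, f.coeff μ ≠ 0 → R.Dom μ → μ = Λ)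
    (hs : ∀ w ∈ R.weyl, sgn w ≠ 0 ∧ sgn w⁻¹ = sgn w) : f = R.alt Λ := by
  classical
  have hΛim : ∀ α ∈ R.Φ, (R.form α Λ).im = 0 := by
    intro α hα
    rcases R.pos_or_neg hα with h | h
    · exact (hΛ α h).1
    · simpa using (hΛ _ h).1
  have him : ∀ β ∈ R.Qp, ∀ α ∈ R.Φ, (R.form α β).im = 0 := by
    intro β hβ α hα
    induction hβ using AddSubmonoid.closure_induction with
    | mem x hx => exact R.form_im hα (R.pos_sub hx)
    | zero => simp
    | add x y _ _ hx hy => simp [hx, hy]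
  have horb : ∀ μ, f.coeff μ ≠ 0 → ∃ w ∈ R.weyl, μ = w Λ := by
    intro μ hμ
    obtain ⟨β, hβ, e⟩ := ht.coeff_support R hμ
    obtain ⟨w, hw, hdom⟩ := R.exists_dom μ fun α hα => by
      rw [e, map_sub, Complex.sub_im, hΛim α hα, him β hβ α hα, sub_zero]
    have hne : f.coeff (w μ) ≠ 0 := fun h0 => hμ (by rw [← hf.coeff R hw, h0, zero_mul])
    refine ⟨w⁻¹, R.weyl.inv_mem hw, ?_⟩
    rw [← hd _ hne hdom]
    exact (w.symm_apply_apply μ).symm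
  ext μ
  have hsum : (R.alt Λ).coeff μ = ∑ w : R.weyl, sgn w.1 * if w.1 Λ = μ then 1 else 0 := by
    simp [alt, Finsupp.finsetSum_apply, coeff_ex]
  rw [hsum]
  by_cases h : ∃ w ∈ R.weyl, μ = w Λ
  · obtain ⟨w, hw, rfl⟩ := h
    rw [Finset.sum_eq_single (⟨w, hw⟩ : R.weyl)]
    · rw [if_pos rfl, mul_one]
      have h1 := hf.coeff R (R.weyl.inv_mem hw) (w Λ)
      have h2 : w⁻¹ (w Λ) = Λ := w.symm_apply_apply Λ
      rw [h2, ht.coeff_top R, one_mul, (hs w hw).2] at h1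
      exact h1.symm
    · intro w' _ hne
      rw [if_neg, mul_zero]
      intro heq
      apply hne
      have h1 : (w⁻¹ * w'.1) Λ = Λ := by
        rw [LinearEquiv.mul_apply, heq]; exact w.symm_apply_apply Λ
      have := R.eq_one_of_strictDom (R.weyl.mul_mem (R.weyl.inv_mem hw) w'.2) hΛ hΛ h1
      exact Subtype.ext (inv_mul_eq_one.1 this).symm
    · simp
  · rw [Finset.sum_eq_zero]
    · by_contra hne
      exact h (horb μ hne)
    · intro w _
      rw [if_neg, mul_zero]
      rintro rfl
      exact h ⟨w.1, w.2, rfl⟩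

theorem sgn_weyl [FiniteDimensional ℂ V] {w : V ≃ₗ[ℂ] V} (hw : w ∈ R.weyl) :
    sgn w = 1 ∨ sgn w = -1 := by
  refine R.weyl_induction (p := fun w => sgn w = 1 ∨ sgn w = -1) (.inl sgn_one)
    (fun α hα w h => ?_) hw
  have : sgn (R.refl α) = -1 := R.det_refl hα
  rw [sgn_mul, this]
  rcases h with h | h <;> simp [h]

theorem sgn_weyl_ne [FiniteDimensional ℂ V] {w : V ≃ₗ[ℂ] V} (hw : w ∈ R.weyl) :
    sgn w ≠ 0 ∧ sgn w⁻¹ = sgn w := by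
  have h : sgn w⁻¹ * sgn w = 1 := by rw [← sgn_mul, inv_mul_cancel, sgn_one]
  rcases R.sgn_weyl hw with h1 | h1
  · rw [h1, mul_one] at h; simp [h, h1]
  · rw [h1] at h ⊢
    refine ⟨by norm_num, by linear_combination -h⟩

theorem Qp_cor_int {γ β : V} (hγ : γ ∈ R.Φ) (hβ : β ∈ R.Qp) : ∃ k : ℤ, R.cor γ β = k := by
  induction hβ using AddSubmonoid.closure_induction with
  | mem x hx =>
    obtain ⟨k, hk⟩ := R.int γ hγ x (R.pos_sub hx)
    exact ⟨k, by rw [cor_apply, hk]⟩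
  | zero => exact ⟨0, by simp⟩
  | add x y _ _ hx hy =>
    obtain ⟨k, hk⟩ := hx
    obtain ⟨l, hl⟩ := hy
    exact ⟨k + l, by simp [hk, hl]⟩

/-- The Weyl denominator formula. -/
theorem den_eq_alt [FiniteDimensional ℂ V] : R.den = R.alt R.hρ := by
  refine R.eq_alt R.den_alternating R.den_hasTop R.hρ_strictDom ?_ fun w hw => R.sgn_weyl_ne hw
  intro μ hμ hdom
  obtain ⟨β, hβ, e⟩ := R.den_hasTop.coeff_support R hμ
  -- `μ` is not fixed by any reflection, since `den` is alternating
  have hreg : ∀ γ ∈ R.pos, 0 < (R.form γ μ).re := by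
    intro γ hγ
    refine lt_of_le_of_ne (hdom γ hγ).2 fun h0 => hμ ?_
    have hz : R.form γ μ = 0 := Complex.ext h0.symm (hdom γ hγ).1
    have h1 := R.den_alternating.coeff R (R.refl_mem_weyl (R.pos_sub hγ)) μ
    have h2 : R.refl γ μ = μ := by simp [refl_apply, cor_apply, hz]
    have h3 : sgn (R.refl γ) = -1 := R.det_refl (R.pos_sub hγ)
    rw [h2, h3] at h1
    have : (2 : ℂ) * R.den.coeff μ = 0 := by linear_combination -h1
    simpa using this
  -- `μ = ρ - β` pairs with a simple coroot to a positive integer and `ρ` pairs with it to `1`, so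
  -- `(β, γ) ≤ 0` for simple `γ`; hence `(β, β) ≤ 0` and `β = 0`
  have hint := fun γ hγ => R.Qp_cor_int (γ := γ) hγ hβ
  have hle : ∀ γ, R.IsSimple γ → 0 ≤ (-R.reForm β) γ := by
    intro γ hγ
    have hΦ := R.pos_sub hγ.1
    obtain ⟨k, hk⟩ := hint γ hΦ
    have h1 : R.cor γ μ = ((1 - k : ℤ) : ℂ) := by
      rw [e, map_sub, R.cor_hρ hγ, hk]; push_cast; ring
    rw [R.cor_eq_re hΦ μ (hdom γ hγ.1).1] at h1
    have h2 : 2 * (R.form γ μ).re / (R.form γ γ).re = ((1 - k : ℤ) : ℝ) := by exact_mod_cast h1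
    have h3 := R.form_self_re_pos hΦ
    have h4 : (0 : ℝ) < ((1 - k : ℤ) : ℝ) := by
      rw [← h2]
      have := hreg γ hγ.1
      positivity
    have h5 : k ≤ 0 := by
      have : (0 : ℤ) < 1 - k := by exact_mod_cast h4
      omega
    have h6 : R.form γ β = ((k * (R.form γ γ).re / 2 : ℝ) : ℂ) := by
      rw [cor_apply, div_eq_iff (R.form_self_ne hΦ), R.form_self_eq hΦ] at hk
      push_cast
      linear_combination hk / 2
    have h7 : (R.form β γ).re = k * (R.form γ γ).re / 2 := by
      rw [R.symm, h6, Complex.ofReal_re]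
    have h8 : (k : ℝ) ≤ 0 := by exact_mod_cast h5
    simp only [LinearMap.neg_apply, reForm_apply, h7]
    nlinarith
  have h9 : 0 ≤ (-R.reForm β) β :=
    R.Qp_nonneg _ (fun γ hγ => R.nonneg_of_simple _ hle hγ) hβ
  by_contra hne
  have hβ0 : β ≠ 0 := by
    rintro rfl
    exact hne (by simpa using e)
  have := R.pos_def β (R.Qp_sub_root hβ) hβ0
  simp at h9
  linarith

end RootSys

end WeylChar

namespace WeylChar

/-! ### Bases of weight vectors -/

section WeightBasis

variable {t V ι : Type*} [AddCommGroup t] [Module ℂ t] [AddCommGroup V] [Module ℂ V]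

/-- `b` is a basis of joint eigenvectors of the operators `ρ Y`, with weights `wt`. -/
def IsWeightBasis (ρ : t →ₗ[ℂ] Module.End ℂ V) (b : Module.Basis ι ℂ V)
    (wt : ι → Module.Dual ℂ t) : Prop := ∀ Y i, ρ Y (b i) = wt i Y • b i

/-- The weight space of weight `μ`. -/
def wspace (ρ : t →ₗ[ℂ] Module.End ℂ V) (μ : Module.Dual ℂ t) : Submodule ℂ V where
  carrier := {v | ∀ Y, ρ Y v = μ Y • v}
  add_mem' := fun {v w} hv hw Y => by rw [map_add, hv, hw, smul_add]
  zero_mem' := fun Y => by simp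
  smul_mem' := fun c v hv Y => by rw [map_smul, hv, smul_comm]

/-- A spanning set of weight vectors contains a basis of weight vectors. -/
theorem exists_weightBasis [FiniteDimensional ℂ V] (s : Set V) (hs : Submodule.span ℂ s = ⊤) :
    ∃ b : Module.Basis (Fin (Module.finrank ℂ V)) ℂ V, ∀ i, b i ∈ s := by
  obtain ⟨s', hs', hspan, hli⟩ := exists_linearIndependent ℂ s
  let b' : Module.Basis s' ℂ V := Module.Basis.mk hli (by
    rw [Subtype.range_coe, hspan, hs])
  have : Finite s' := Module.Finite.finite_basis b'
  let _ := Fintype.ofFinite s'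
  let e : s' ≃ Fin (Module.finrank ℂ V) :=
    Fintype.equivFinOfCardEq (Module.finrank_eq_card_basis b').symm
  refine ⟨b'.reindex e, fun i => ?_⟩
  rw [Module.Basis.reindex_apply, Module.Basis.mk_apply]
  exact hs' (e.symm i).2

namespace IsWeightBasis

variable {ρ : t →ₗ[ℂ] Module.End ℂ V} {b : Module.Basis ι ℂ V} {wt : ι → Module.Dual ℂ t}

theorem repr_apply [Fintype ι] (hb : IsWeightBasis ρ b wt) (Y : t) (v : V) (i : ι) :
    b.repr (ρ Y v) i = wt i Y * b.repr v i := by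
  classical
  conv_lhs => rw [← b.sum_repr v]
  simp only [map_sum, map_smul, hb Y, Finsupp.finsetSum_apply, Finsupp.smul_apply,
    Module.Basis.repr_self, Finsupp.single_apply, smul_eq_mul]
  simp [mul_comm]

theorem wt_of_repr [Fintype ι] (hb : IsWeightBasis ρ b wt) {μ : Module.Dual ℂ t} {v : V}
    (hv : v ∈ wspace ρ μ) {i : ι} (hi : b.repr v i ≠ 0) : wt i = μ := by
  ext Y
  have h := hb.repr_apply Y v i
  rw [hv Y, map_smul, Finsupp.smul_apply, smul_eq_mul] at h
  exact (mul_right_cancel₀ hi h).symm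

theorem exists_wt [Fintype ι] (hb : IsWeightBasis ρ b wt) {μ : Module.Dual ℂ t} {v : V}
    (hv : v ∈ wspace ρ μ) (h0 : v ≠ 0) : ∃ i, wt i = μ := by
  by_contra! hne
  refine h0 (b.repr.injective (Finsupp.ext fun i => ?_))
  by_contra h
  exact hne i (hb.wt_of_repr hv (by simpa using h))

/-- Matrix coefficients of an operator of weight `α` shift weights by `α`. -/
theorem wt_of_shift [Fintype ι] (hb : IsWeightBasis ρ b wt) {α : Module.Dual ℂ t}
    {x : Module.End ℂ V} (hx : ∀ Y, ρ Y * x = x * ρ Y + α Y • x) {i j : ι}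
    (h : b.repr (x (b j)) i ≠ 0) : wt i = wt j + α := by
  refine hb.wt_of_repr (v := x (b j)) (fun Y => ?_) h
  have := LinearMap.congr_fun (hx Y) (b j)
  simp only [Module.End.mul_apply, LinearMap.add_apply, LinearMap.smul_apply, hb Y, map_smul] at this
  rw [this, LinearMap.add_apply, add_smul]

theorem span_wspace [Fintype ι] (hb : IsWeightBasis ρ b wt) (μ : Module.Dual ℂ t) :
    wspace ρ μ = Submodule.span ℂ (b '' {i | wt i = μ}) := by
  refine le_antisymm (fun v hv => ?_) (Submodule.span_le.2 ?_)
  · rw [← b.sum_repr v]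
    refine Submodule.sum_mem _ fun i _ => ?_
    by_cases h : b.repr v i = 0
    · simp [h]
    · exact Submodule.smul_mem _ _ (Submodule.subset_span ⟨i, hb.wt_of_repr hv h, rfl⟩)
  · rintro _ ⟨i, rfl, rfl⟩ Y
    exact hb Y i

open Classical in
theorem finrank_wspace [Fintype ι] (hb : IsWeightBasis ρ b wt) (μ : Module.Dual ℂ t) :
    Module.finrank ℂ (wspace ρ μ) = (Finset.univ.filter fun i => wt i = μ).card := by
  rw [hb.span_wspace μ, Set.image_eq_range]
  have := finrank_span_eq_card (R := ℂ)
    (b.linearIndependent.comp (fun i : {i | wt i = μ} => (i : ι)) Subtype.val_injective)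
  rw [Fintype.card_subtype] at this
  exact this

end IsWeightBasis

/-- The formal character of a weight basis. -/
def chi [Fintype ι] (wt : ι → Module.Dual ℂ t) : GA (Module.Dual ℂ t) := ∑ i, ex (wt i)

theorem coeff_chi [Fintype ι] {ρ : t →ₗ[ℂ] Module.End ℂ V} {b : Module.Basis ι ℂ V}
    {wt : ι → Module.Dual ℂ t} (hb : IsWeightBasis ρ b wt) (μ : Module.Dual ℂ t) :
    (chi wt).coeff μ = Module.finrank ℂ (wspace ρ μ) := by
  classical
  rw [hb.finrank_wspace]
  simp [chi, Finsupp.finsetSum_apply, coeff_ex]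

end WeightBasis

/-! ### Actions of `sl₂` -/

section Exp

variable {A : Type*} [Ring A] [Algebra ℚ A]

/-- Commuting `z` past a power of `a`, when the third commutator vanishes. -/
theorem mul_pow_of_comm {a z w u : A} (h1 : z * a = a * z + w) (h2 : w * a = a * w + u)
    (h3 : u * a = a * u) (n : ℕ) :
    z * a ^ (n + 2) = a ^ (n + 2) * z + (n + 2 : ℚ) • (a ^ (n + 1) * w) +
      ((n + 2) * (n + 1) / 2 : ℚ) • (a ^ n * u) := by
  induction n with
  | zero =>
    have : z * a ^ 2 = a ^ 2 * z + a * w + a * w + u := by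
      rw [pow_two, ← mul_assoc, h1, add_mul, mul_assoc, h1, h2]; noncomm_ring
    simp only [zero_add, pow_one, pow_zero, one_mul, Nat.cast_zero, this]
    module
  | succ n ih =>
    rw [show n + 1 + 2 = (n + 2) + 1 from rfl, pow_succ a (n + 2), ← mul_assoc, ih, add_mul, add_mul,
      smul_mul_assoc, smul_mul_assoc, mul_assoc _ z, mul_assoc _ w, mul_assoc _ u, h1, h2, h3,
      mul_add, mul_add, ← mul_assoc _ a, ← mul_assoc _ a, ← mul_assoc _ a, ← pow_succ, ← pow_succ,
      ← pow_succ]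
    push_cast
    module

/-- Commuting `z` past an exponential, when the third commutator vanishes. -/
theorem mul_exp_of_comm {a z w u : A} (ha : IsNilpotent a) (h1 : z * a = a * z + w)
    (h2 : w * a = a * w + u) (h3 : u * a = a * u) :
    z * IsNilpotent.exp a = IsNilpotent.exp a * (z + w + (1 / 2 : ℚ) • u) := by
  have key : ∀ N : ℕ, z * ∑ k ∈ Finset.range (N + 2), (k.factorial : ℚ)⁻¹ • a ^ k =
      (∑ k ∈ Finset.range (N + 2), (k.factorial : ℚ)⁻¹ • a ^ k) * z +
      (∑ k ∈ Finset.range (N + 1), (k.factorial : ℚ)⁻¹ • a ^ k) * w +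
      (∑ k ∈ Finset.range N, (k.factorial : ℚ)⁻¹ • a ^ k) * ((1 / 2 : ℚ) • u) := by
    intro N
    induction N with
    | zero =>
      simp [Finset.sum_range_succ, mul_add, add_mul, h1, add_assoc]
    | succ N ih =>
      have e1 : ((N + 2).factorial : ℚ)⁻¹ * (N + 2) = ((N + 1).factorial : ℚ)⁻¹ := by
        rw [Nat.factorial_succ (N + 1)]; push_cast
        have : ((N + 1).factorial : ℚ) ≠ 0 := by positivity
        field_simp
        ring
      have e2 : ((N + 2).factorial : ℚ)⁻¹ * ((N + 2) * (N + 1) / 2) =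
          (1 / 2) * (N.factorial : ℚ)⁻¹ := by
        rw [Nat.factorial_succ (N + 1), Nat.factorial_succ N]; push_cast
        have : (N.factorial : ℚ) ≠ 0 := by positivity
        field_simp
        ring
      rw [Finset.sum_range_succ _ (N + 2), mul_add, ih, mul_smul_comm (_ : ℚ) z,
        mul_pow_of_comm h1 h2 h3,
        smul_add, smul_add, smul_smul, smul_smul, e1, e2,
        Finset.sum_range_succ _ (N + 1), Finset.sum_range_succ _ N]
      simp only [add_mul, smul_mul_assoc, mul_smul_comm, smul_add, smul_smul]
      abel
  obtain ⟨N, hN⟩ := ha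
  have hz : ∀ k, IsNilpotent.exp a = ∑ k ∈ Finset.range (N + k), (k.factorial : ℚ)⁻¹ • a ^ k :=
    fun k => IsNilpotent.exp_eq_sum (by rw [pow_add, hN, zero_mul])
  have := key N
  rw [← hz 2, ← hz 1] at this
  have h0 := hz 0
  rw [add_zero] at h0
  rw [← h0] at this
  rw [this, mul_add, mul_add]

end Exp

section Sl2

variable {t V ι : Type*} [AddCommGroup t] [Module ℂ t] [AddCommGroup V] [Module ℂ V]

/-- Operators `x`, `y` of weights `α`, `-α` which together with `ρ c` span a copy of `sl₂`. -/
structure Sl2Act (ρ : t →ₗ[ℂ] Module.End ℂ V) (α : Module.Dual ℂ t) (c : t)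
    (x y : Module.End ℂ V) : Prop where
  hx : ∀ Y, ρ Y * x = x * ρ Y + α Y • x
  hy : ∀ Y, ρ Y * y = y * ρ Y + (-α) Y • y
  hxy : x * y = y * x + ρ c
  hc : α c = 2

/-- Operators of nonzero weight are nilpotent. -/
theorem IsWeightBasis.isNilpotent [Finite ι] {ρ : t →ₗ[ℂ] Module.End ℂ V}
    {b : Module.Basis ι ℂ V} {wt : ι → Module.Dual ℂ t} (hb : IsWeightBasis ρ b wt)
    {α : Module.Dual ℂ t} (hα : α ≠ 0)
    {x : Module.End ℂ V} (hx : ∀ Y, ρ Y * x = x * ρ Y + α Y • x) : IsNilpotent x := by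
  classical
  let _ := Fintype.ofFinite ι
  have hw : ∀ (i : ι) (k : ℕ), (x ^ k) (b i) ∈ wspace ρ (wt i + (k : ℂ) • α) := by
    intro i k
    induction k with
    | zero => intro Y; simpa using hb Y i
    | succ k ih =>
      intro Y
      have := LinearMap.congr_fun (hx Y) ((x ^ k) (b i))
      simp only [Module.End.mul_apply, LinearMap.add_apply, LinearMap.smul_apply, ih Y, map_smul]
        at this
      rw [pow_succ', Module.End.mul_apply, this]
      simp only [LinearMap.add_apply, LinearMap.smul_apply, smul_eq_mul]
      push_cast
      module
  refine ⟨Fintype.card ι, b.ext fun i => ?_⟩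
  by_contra hne
  have hne' : ∀ k : Fin (Fintype.card ι + 1), (x ^ (k : ℕ)) (b i) ≠ 0 := by
    intro k h0
    apply hne
    obtain ⟨d, hd⟩ := Nat.exists_eq_add_of_le (Nat.lt_succ_iff.1 k.2)
    rw [hd, add_comm, pow_add, Module.End.mul_apply, h0, map_zero]; rfl
  choose f hf using fun k : Fin (Fintype.card ι + 1) => hb.exists_wt (hw i k) (hne' k)
  have hinj : Function.Injective f := by
    intro k l h
    have h1 := hf k
    rw [h, hf l, add_right_inj] at h1
    have h2 := sub_eq_zero.2 h1
    rw [← sub_smul, smul_eq_zero, sub_eq_zero] at h2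
    exact Fin.ext (by exact_mod_cast (h2.resolve_right hα).symm)
  have := Fintype.card_le_of_injective f hinj
  simp at this

namespace Sl2Act

variable {ρ : t →ₗ[ℂ] Module.End ℂ V} {α : Module.Dual ℂ t} {c : t} {x y : Module.End ℂ V}

theorem ne_zero (h : Sl2Act ρ α c x y) : α ≠ 0 := by
  rintro rfl; simpa using h.hc

/-- A vector killed by `x` which is an eigenvector of `ρ c` has a natural number as eigenvalue. -/
theorem exists_nat [FiniteDimensional ℂ V] (h : Sl2Act ρ α c x y) {v : V} (hv : v ≠ 0) {m : ℂ}
    (hm : ρ c v = m • v) (hx : x v = 0) : ∃ n : ℕ, m = n := by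
  by_cases h0 : ρ c = 0
  · refine ⟨0, ?_⟩
    rw [h0, LinearMap.zero_apply, eq_comm, smul_eq_zero] at hm
    simpa using hm.resolve_right hv
  · have ht : IsSl2Triple (ρ c) x y :=
      { h_ne_zero := h0
        lie_e_f := by rw [Ring.lie_def, h.hxy]; abel
        lie_h_e_nsmul := by
          rw [Ring.lie_def, h.hx, h.hc, ← Nat.cast_smul_eq_nsmul ℂ]; push_cast; abel
        lie_h_f_nsmul := by
          rw [Ring.lie_def, h.hy, LinearMap.neg_apply, h.hc, ← Nat.cast_smul_eq_nsmul ℂ]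
          push_cast; module }
    have hp : ht.HasPrimitiveVectorWith v m := ⟨hv, hm, hx⟩
    exact hp.exists_nat

theorem wt_int [FiniteDimensional ℂ V] [Finite ι] {b : Module.Basis ι ℂ V}
    {wt : ι → Module.Dual ℂ t} (h : Sl2Act ρ α c x y) (hb : IsWeightBasis ρ b wt) (i : ι) :
    ∃ k : ℤ, wt i c = k := by
  have hw : ∀ k : ℕ, ρ c ((x ^ k) (b i)) = (wt i c + 2 * k) • (x ^ k) (b i) := by
    intro k
    induction k with
    | zero => simpa using hb c i
    | succ k ih =>
      have := LinearMap.congr_fun (h.hx c) ((x ^ k) (b i))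
      simp only [Module.End.mul_apply, LinearMap.add_apply, LinearMap.smul_apply, ih, map_smul,
        h.hc] at this
      rw [pow_succ', Module.End.mul_apply, this]
      push_cast
      module
  obtain ⟨N, hN⟩ := hb.isNilpotent h.ne_zero h.hx
  obtain ⟨k, hk, hk'⟩ := Nat.exists_not_and_succ_of_not_zero_of_exists
    (p := fun k => (x ^ k) (b i) = 0) (by simpa using b.ne_zero i) ⟨N, by simp [hN]⟩
  rw [pow_succ', Module.End.mul_apply] at hk'
  obtain ⟨n, hn⟩ := h.exists_nat hk (hw k) hk'
  exact ⟨n - 2 * k, by push_cast; linear_combination hn⟩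

/-- The exponentials of `x` and `y` realise the reflection in `α`. -/
theorem exists_reflect [Finite ι] {b : Module.Basis ι ℂ V} {wt : ι → Module.Dual ℂ t}
    (h : Sl2Act ρ α c x y) (hb : IsWeightBasis ρ b wt) :
    ∃ θ : Module.End ℂ V, IsUnit θ ∧ ∀ Y, ρ Y * θ = θ * (ρ Y - α Y • ρ c) := by
  let _ : Algebra ℚ (Module.End ℂ V) := Algebra.compHom _ (algebraMap ℚ ℂ)
  have hxn := hb.isNilpotent h.ne_zero h.hx
  have hyn : IsNilpotent (-y) := (hb.isNilpotent (neg_ne_zero.2 h.ne_zero) h.hy).neg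
  refine ⟨IsNilpotent.exp x * IsNilpotent.exp (-y) * IsNilpotent.exp x,
    ((IsNilpotent.isUnit_exp hxn).mul (IsNilpotent.isUnit_exp hyn)).mul
      (IsNilpotent.isUnit_exp hxn), fun Y => ?_⟩
  have hq : ∀ (q : ℚ) (u : Module.End ℂ V), q • u = (q : ℂ) • u := fun q u => rfl
  have hcx := h.hx c
  have hcy := h.hy c
  rw [LinearMap.neg_apply, h.hc] at hcy
  rw [h.hc] at hcx
  have h1 := mul_exp_of_comm (z := ρ Y) (w := α Y • x) (u := 0) hxn (h.hx Y)
    (by simp) (by simp)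
  have h2 := mul_exp_of_comm (a := -y) (z := ρ Y + α Y • x) (w := α Y • y - α Y • ρ c)
    (u := (-2 * α Y) • y) hyn
    (by
      simp only [add_mul, mul_add, mul_neg, neg_mul, h.hy, smul_mul_assoc, mul_smul_comm, h.hxy,
        LinearMap.neg_apply, smul_add]
      module)
    (by
      simp only [sub_mul, mul_sub, mul_neg, neg_mul, hcy, smul_mul_assoc, mul_smul_comm, smul_add]
      module)
    (by simp)
  have h3 := mul_exp_of_comm (a := x) (z := ρ Y + α Y • x - α Y • ρ c) (w := -(α Y • x)) (u := 0)
    hxn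
    (by
      simp only [add_mul, mul_add, sub_mul, mul_sub, h.hx Y, hcx, smul_mul_assoc, mul_smul_comm,
        smul_add]
      module)
    (by simp) (by simp)
  have e2 : ρ Y + α Y • x + (α Y • y - α Y • ρ c) + (1 / 2 : ℚ) • (-2 * α Y) • y =
      ρ Y + α Y • x - α Y • ρ c := by
    rw [hq]; push_cast; module
  have e3 : ρ Y + α Y • x - α Y • ρ c + -(α Y • x) + (1 / 2 : ℚ) • (0 : Module.End ℂ V) =
      ρ Y - α Y • ρ c := by
    rw [smul_zero]; module
  rw [smul_zero, add_zero] at h1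
  rw [e2] at h2
  rw [e3] at h3
  rw [← mul_assoc, ← mul_assoc, h1, mul_assoc _ _ (IsNilpotent.exp (-y)), h2, ← mul_assoc,
    mul_assoc _ _ (IsNilpotent.exp x), h3, ← mul_assoc]

/-- The formal character is invariant under the reflection `μ ↦ μ - μ(c) α`. -/
theorem finrank_reflect [FiniteDimensional ℂ V] [Finite ι] {b : Module.Basis ι ℂ V}
    {wt : ι → Module.Dual ℂ t} (h : Sl2Act ρ α c x y) (hb : IsWeightBasis ρ b wt)
    (μ : Module.Dual ℂ t) :
    Module.finrank ℂ (wspace ρ (μ - μ c • α)) = Module.finrank ℂ (wspace ρ μ) := by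
  obtain ⟨θ, hθ, hcomm⟩ := h.exists_reflect hb
  have hinj : Function.Injective θ := ((Module.End.isUnit_iff θ).1 hθ).1
  have hle : ∀ μ : Module.Dual ℂ t, Module.finrank ℂ (wspace ρ μ) ≤
      Module.finrank ℂ (wspace ρ (μ - μ c • α)) := by
    intro μ
    have hm : ∀ v ∈ wspace ρ μ, θ v ∈ wspace ρ (μ - μ c • α) := by
      intro v hv Y
      have := LinearMap.congr_fun (hcomm Y) v
      simp only [Module.End.mul_apply, LinearMap.sub_apply, LinearMap.smul_apply, hv Y, hv c] at this
      rw [this]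
      simp only [map_sub, map_smul, LinearMap.sub_apply, LinearMap.smul_apply, smul_eq_mul]
      module
    exact LinearMap.finrank_le_finrank_of_injective (f := θ.restrict hm) fun a b hab =>
      Subtype.ext (hinj (congrArg Subtype.val hab))
  refine le_antisymm ?_ (hle μ)
  have := hle (μ - μ c • α)
  have e : μ - μ c • α - (μ - μ c • α) c • α = μ := by
    rw [LinearMap.sub_apply, LinearMap.smul_apply, h.hc, smul_eq_mul]; module
  rwa [e] at this

end Sl2Act

end Sl2

end WeylChar

namespace WeylChar

namespace RootSys

variable {V : Type*} [AddCommGroup V] [Module ℂ V] (R : RootSys V)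

theorem sum_roots {M : Type*} [AddCommMonoid M] (f : V → M) :
    ∑ α ∈ R.Φ, f α = ∑ α ∈ R.pos, (f α + f (-α)) := by
  classical
  have h1 : ∑ α ∈ R.Φ with 0 < R.ht α, f α = ∑ α ∈ R.pos, f α :=
    Finset.sum_congr (by ext α; simp [mem_pos]) fun _ _ => rfl
  have h2 : ∑ α ∈ R.Φ with ¬ 0 < R.ht α, f α = ∑ α ∈ R.pos, f (-α) := by
    refine Finset.sum_bij' (fun α _ => -α) (fun α _ => -α) ?_ ?_ ?_ ?_ ?_
    · intro α hα
      obtain ⟨h1, h2⟩ := Finset.mem_filter.1 hα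
      exact (R.pos_or_neg h1).resolve_left fun h => h2 (R.mem_pos.1 h).2
    · intro α hα
      refine Finset.mem_filter.2 ⟨R.neg_mem (R.pos_sub hα), ?_⟩
      have := (R.mem_pos.1 hα).2
      rw [map_neg]; linarith
    all_goals simp
  rw [← Finset.sum_filter_add_sum_filter_not R.Φ (0 < R.ht ·), h1, h2, Finset.sum_add_distrib]

end RootSys

/-! ### Reductive Lie algebras with a split Cartan subalgebra -/

/-- A Lie algebra `L` with an invariant form `κ`, a commutative subalgebra `i : t → L`, and a root
space decomposition with one-dimensional root spaces, spanned by vectors `e α`. The element `tt μ`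
of `t` represents `μ` with respect to `κ`, and the form of the root system is dual to `κ`. -/
structure SplitData (t L : Type*) [AddCommGroup t] [Module ℂ t] [LieRing L] [LieAlgebra ℂ L] where
  i : t →ₗ[ℂ] L
  κ : LinearMap.BilinForm ℂ L
  κ_symm : ∀ X Y, κ X Y = κ Y X
  κ_inv : ∀ X Y W, κ ⁅X, Y⁆ W = κ X ⁅Y, W⁆
  R : RootSys (Module.Dual ℂ t)
  tt : Module.Dual ℂ t → t
  form_eq : ∀ μ ν, R.form μ ν = ν (tt μ)
  κ_tt : ∀ μ Y, κ (i (tt μ)) (i Y) = μ Y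
  e : Module.Dual ℂ t → L
  lie_i : ∀ Y Y', ⁅i Y, i Y'⁆ = 0
  lie_e : ∀ α ∈ R.Φ, ∀ Y, ⁅i Y, e α⁆ = α Y • e α
  lie_ee : ∀ α ∈ R.Φ, ⁅e α, e (-α)⁆ = i (tt α)
  κ_e : ∀ α ∈ R.Φ, κ (e α) (e (-α)) = 1
  span : ∀ X : L, ∃ Y, ∃ c : Module.Dual ℂ t → ℂ, X = i Y + ∑ α ∈ R.Φ, c α • e α

/-- The vectors obtained from `v` by applying the operators `ops` repeatedly. -/
inductive Gen {V κ : Type*} [AddCommGroup V] [Module ℂ V] (ops : κ → Module.End ℂ V) (v : V) :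
    V → Prop
  | base : Gen ops v v
  | step (k : κ) (w : V) : Gen ops v w → Gen ops v (ops k w)

theorem Gen.map_span {V κ : Type*} [AddCommGroup V] [Module ℂ V] {ops : κ → Module.End ℂ V}
    {v : V} (k : κ) {w : V} (hw : w ∈ Submodule.span ℂ {w | Gen ops v w}) :
    ops k w ∈ Submodule.span ℂ {w | Gen ops v w} := by
  induction hw using Submodule.span_induction with
  | mem x hx => exact Submodule.subset_span (Gen.step k x hx)
  | zero => simp
  | add x y _ _ hx hy => rw [map_add]; exact add_mem hx hy
  | smul c x _ hx => rw [map_smul]; exact Submodule.smul_mem _ _ hx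

/-- The Casimir operator attached to dual families commutes with the Lie algebra. -/
theorem casimir_comm {L V ι : Type*} [LieRing L] [LieAlgebra ℂ L] [AddCommGroup V] [Module ℂ V]
    [Fintype ι] (κ : LinearMap.BilinForm ℂ L) (hs : ∀ X Y, κ X Y = κ Y X)
    (hinv : ∀ X Y W, κ ⁅X, Y⁆ W = κ X ⁅Y, W⁆) (π : L →ₗ⁅ℂ⁆ Module.End ℂ V) (u u' : ι → L)
    (h : ∀ X, X = ∑ a, κ (u' a) X • u a) (h' : ∀ X, X = ∑ a, κ (u a) X • u' a) (X : L) :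
    π X * ∑ a, π (u a) * π (u' a) = (∑ a, π (u a) * π (u' a)) * π X := by
  have e1 : ∀ a, π X * (π (u a) * π (u' a)) = π (u a) * π (u' a) * π X +
      (π ⁅X, u a⁆ * π (u' a) + π (u a) * π ⁅X, u' a⁆) := by
    intro a
    rw [LieHom.map_lie, LieHom.map_lie, Ring.lie_def, Ring.lie_def]
    noncomm_ring
  have e2 : ∑ a, (π ⁅X, u a⁆ * π (u' a) + π (u a) * π ⁅X, u' a⁆) = 0 := by
    rw [Finset.sum_add_distrib]
    have h1 : ∀ a, π ⁅X, u a⁆ = ∑ b, κ (u' b) ⁅X, u a⁆ • π (u b) := fun a => by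
      conv_lhs => rw [h ⁅X, u a⁆]
      simp only [map_sum, map_smul]
    have h2 : ∀ a, π ⁅X, u' a⁆ = ∑ b, κ (u b) ⁅X, u' a⁆ • π (u' b) := fun a => by
      conv_lhs => rw [h' ⁅X, u' a⁆]
      simp only [map_sum, map_smul]
    simp only [h1, h2, Finset.sum_mul, Finset.mul_sum, smul_mul_assoc, mul_smul_comm]
    rw [Finset.sum_comm, ← Finset.sum_add_distrib]
    refine Finset.sum_eq_zero fun a _ => ?_
    rw [← Finset.sum_add_distrib]
    refine Finset.sum_eq_zero fun b _ => ?_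
    have : κ (u' a) ⁅X, u b⁆ = -κ (u b) ⁅X, u' a⁆ := by
      rw [← hinv, ← lie_skew, map_neg, LinearMap.neg_apply, hs]
    rw [this, neg_smul, neg_add_cancel]
  rw [Finset.mul_sum, Finset.sum_mul, Finset.sum_congr rfl fun a _ => e1 a,
    Finset.sum_add_distrib, e2, add_zero]

namespace SplitData

variable {t L : Type*} [AddCommGroup t] [Module ℂ t] [LieRing L] [LieAlgebra ℂ L]
  (D : SplitData t L)

theorem κ_ie {α : Module.Dual ℂ t} (hα : α ∈ D.R.Φ) (Y : t) : D.κ (D.i Y) (D.e α) = 0 := by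
  obtain ⟨Y', hY'⟩ : ∃ Y', α Y' ≠ 0 := by
    by_contra! h
    exact D.R.ne_zero hα (LinearMap.ext h)
  have h := D.κ_inv (D.i Y) (D.i Y') (D.e α)
  rw [D.lie_i, D.lie_e α hα, map_zero, LinearMap.zero_apply, map_smul, smul_eq_mul] at h
  exact (mul_eq_zero.1 h.symm).resolve_left hY'

theorem κ_ee {α β : Module.Dual ℂ t} (hα : α ∈ D.R.Φ) (hβ : β ∈ D.R.Φ) (h : α + β ≠ 0) :
    D.κ (D.e α) (D.e β) = 0 := by
  obtain ⟨Y, hY⟩ : ∃ Y, (α + β) Y ≠ 0 := by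
    by_contra! h'
    exact h (LinearMap.ext h')
  have h := D.κ_inv (D.e α) (D.i Y) (D.e β)
  rw [← lie_skew, D.lie_e α hα, D.lie_e β hβ, map_neg, LinearMap.neg_apply, map_smul,
    LinearMap.smul_apply, map_smul, smul_eq_mul, smul_eq_mul] at h
  have h2 : (α + β) Y * D.κ (D.e α) (D.e β) = 0 := by
    rw [LinearMap.add_apply]; linear_combination -h
  exact (mul_eq_zero.1 h2).resolve_left hY

theorem κ_ee_ite [DecidableEq (Module.Dual ℂ t)] {α β : Module.Dual ℂ t} (hα : α ∈ D.R.Φ)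
    (hβ : β ∈ D.R.Φ) : D.κ (D.e (-α)) (D.e β) = if α = β then 1 else 0 := by
  split_ifs with h
  · subst h; rw [D.κ_symm, D.κ_e α hα]
  · exact D.κ_ee (D.R.neg_mem hα) hβ fun h' => h (by rwa [neg_add_eq_zero] at h')

theorem κ_resolution (X : L) {Y : t} {c : Module.Dual ℂ t → ℂ}
    (h : X = D.i Y + ∑ α ∈ D.R.Φ, c α • D.e α) {α : Module.Dual ℂ t} (hα : α ∈ D.R.Φ) :
    D.κ (D.e (-α)) X = c α := by
  classical
  rw [h, map_add, D.κ_symm, D.κ_ie (D.R.neg_mem hα), zero_add, map_sum,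
    Finset.sum_congr rfl fun β hβ => by rw [map_smul, D.κ_ee_ite hα hβ, smul_eq_mul]]
  simp [hα]

theorem κ_resolution_i (X : L) {Y : t} {c : Module.Dual ℂ t → ℂ}
    (h : X = D.i Y + ∑ α ∈ D.R.Φ, c α • D.e α) (Y' : t) :
    D.κ (D.i Y') X = D.κ (D.i Y') (D.i Y) := by
  rw [h, map_add, map_sum, Finset.sum_eq_zero fun β hβ => by rw [map_smul, D.κ_ie hβ, smul_zero],
    add_zero]

variable [FiniteDimensional ℂ t]

/-- A basis of `t`, used to write down the Casimir element. -/
def hb : Module.Basis (Fin (Module.finrank ℂ t)) ℂ t := Module.finBasis ℂ t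

/-- The basis of `t` dual to `hb`. -/
def hb' (D : SplitData t L) (j : Fin (Module.finrank ℂ t)) : t := D.tt (hb.coord j)

theorem eq_sum_hb (Y : t) : Y = ∑ j, D.κ (D.i (D.hb' j)) (D.i Y) • hb j := by
  conv_lhs => rw [← hb.sum_repr Y]
  exact Finset.sum_congr rfl fun j _ => by rw [hb', D.κ_tt]; rfl

theorem t_ext {Y Y' : t} (h : ∀ Z, D.κ (D.i Z) (D.i Y) = D.κ (D.i Z) (D.i Y')) : Y = Y' := by
  rw [D.eq_sum_hb Y, D.eq_sum_hb Y']
  simp only [h]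

theorem eq_sum_hb' (Y : t) : Y = ∑ j, D.κ (D.i (hb j)) (D.i Y) • D.hb' j := by
  refine D.t_ext fun Z => ?_
  simp only [map_sum, map_smul, smul_eq_mul]
  conv_lhs => rw [D.eq_sum_hb Z]
  simp only [map_sum, map_smul, LinearMap.sum_apply, LinearMap.smul_apply, smul_eq_mul]
  exact Finset.sum_congr rfl fun j _ => by rw [D.κ_symm (D.i Z)]; ring

theorem form_self (μ : Module.Dual ℂ t) : D.R.form μ μ = ∑ j, μ (hb j) * μ (D.hb' j) := by
  rw [D.form_eq]
  conv_lhs => rw [D.eq_sum_hb' (D.tt μ)]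
  simp only [map_sum, map_smul, smul_eq_mul]
  exact Finset.sum_congr rfl fun j _ => by rw [D.κ_symm, D.κ_tt]

variable {V : Type*} [AddCommGroup V] [Module ℂ V]
  (π : L →ₗ⁅ℂ⁆ Module.End ℂ V)

/-- The Casimir operator. -/
def casimir : Module.End ℂ V :=
  ∑ j, π (D.i (hb j)) * π (D.i (D.hb' j)) + ∑ α ∈ D.R.Φ, π (D.e α) * π (D.e (-α))

theorem casimir_comm (X : L) : π X * D.casimir π = D.casimir π * π X := by
  classical
  let u : Fin (Module.finrank ℂ t) ⊕ D.R.Φ → L :=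
    Sum.elim (fun j => D.i (hb j)) (fun α => D.e α)
  let u' : Fin (Module.finrank ℂ t) ⊕ D.R.Φ → L :=
    Sum.elim (fun j => D.i (D.hb' j)) (fun α => D.e (-(α : Module.Dual ℂ t)))
  have e : D.casimir π = ∑ a, π (u a) * π (u' a) := by
    rw [Fintype.sum_sum_type, casimir, ← Finset.sum_coe_sort D.R.Φ]
    rfl
  rw [e]
  refine WeylChar.casimir_comm D.κ D.κ_symm D.κ_inv π u u' (fun X => ?_) (fun X => ?_) X
  · obtain ⟨Y, c, h⟩ := D.span X
    rw [Fintype.sum_sum_type]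
    simp only [u, u', Sum.elim_inl, Sum.elim_inr]
    have e2 : ∑ α ∈ D.R.Φ, D.κ (D.e (-α)) X • D.e α = ∑ α ∈ D.R.Φ, c α • D.e α :=
      Finset.sum_congr rfl fun α hα => by rw [D.κ_resolution X h hα]
    rw [Finset.sum_coe_sort D.R.Φ (fun α => D.κ (D.e (-α)) X • D.e α), e2]
    simp only [D.κ_resolution_i X h]
    conv_lhs => rw [h, D.eq_sum_hb Y]
    simp only [map_sum, map_smul]
  · obtain ⟨Y, c, h⟩ := D.span X
    rw [Fintype.sum_sum_type]
    simp only [u, u', Sum.elim_inl, Sum.elim_inr]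
    rw [Finset.sum_coe_sort D.R.Φ (fun α => D.κ (D.e α) X • D.e (-α))]
    have e2 : ∑ α ∈ D.R.Φ, D.κ (D.e α) X • D.e (-α) = ∑ α ∈ D.R.Φ, c α • D.e α := by
      refine Finset.sum_bij' (fun α _ => -α) (fun α _ => -α) (fun α h => D.R.neg_mem h)
        (fun α h => D.R.neg_mem h) (by simp) (by simp) fun α hα => ?_
      rw [← D.κ_resolution X h (D.R.neg_mem hα), neg_neg]
    simp only [D.κ_resolution_i X h]
    rw [e2]
    conv_lhs => rw [h, D.eq_sum_hb' Y]
    simp only [map_sum, map_smul]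

/-- The action of `t` through the representation `π`. -/
def tact : t →ₗ[ℂ] Module.End ℂ V := (π : L →ₗ[ℂ] Module.End ℂ V) ∘ₗ D.i

omit [FiniteDimensional ℂ t] in
theorem tact_apply (Y : t) : D.tact π Y = π (D.i Y) := rfl

/-- `v` is a highest weight vector of weight `lam`, generating an irreducible representation. -/
structure IsHighest (lam : Module.Dual ℂ t) (v : V) : Prop where
  irr : ∀ U : Submodule ℂ V, (∀ X, ∀ w ∈ U, π X w ∈ U) → U = ⊥ ∨ U = ⊤
  ne : v ≠ 0
  wt : ∀ Y, π (D.i Y) v = lam Y • v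
  kill : ∀ α ∈ D.R.pos, π (D.e α) v = 0

omit [FiniteDimensional ℂ t] in
theorem op_shift {α : Module.Dual ℂ t} (hα : α ∈ D.R.Φ) (Y : t) :
    D.tact π Y * π (D.e α) = π (D.e α) * D.tact π Y + α Y • π (D.e α) := by
  have h := congrArg π (D.lie_e α hα Y)
  rw [LieHom.map_lie, Ring.lie_def, map_smul, sub_eq_iff_eq_add'] at h
  exact h

omit [FiniteDimensional ℂ t] in
/-- The `sl₂` of a root. -/
theorem sl2 {α : Module.Dual ℂ t} (hα : α ∈ D.R.Φ) :
    Sl2Act (D.tact π) α ((2 / D.R.form α α) • D.tt α) (π (D.e α))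
      ((2 / D.R.form α α) • π (D.e (-α))) where
  hx := D.op_shift π hα
  hy := fun Y => by
    rw [mul_smul_comm, D.op_shift π (D.R.neg_mem hα), smul_mul_assoc, smul_add, smul_comm]
  hxy := by
    rw [mul_smul_comm, smul_mul_assoc, map_smul, tact_apply, ← D.lie_ee α hα, LieHom.map_lie,
      Ring.lie_def, smul_sub]
    abel
  hc := by
    rw [map_smul, ← D.form_eq, smul_eq_mul, div_mul_cancel₀ _ (D.R.form_self_ne hα)]

omit [FiniteDimensional ℂ t] in
theorem apply_coroot {α : Module.Dual ℂ t} (μ : Module.Dual ℂ t) :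
    μ ((2 / D.R.form α α) • D.tt α) = D.R.cor α μ := by
  rw [map_smul, ← D.form_eq, smul_eq_mul, D.R.cor_apply]; ring

variable {π} {lam : Module.Dual ℂ t} {v : V}

omit [FiniteDimensional ℂ t] in
/-- The highest weight is dominant: a highest weight vector has a natural number as its weight for
the `sl₂` of every positive root. -/
theorem IsHighest.dom [FiniteDimensional ℂ V] (h : D.IsHighest π lam v) : D.R.Dom lam := by
  intro α hα
  have hΦ := D.R.pos_sub hα
  obtain ⟨n, hn⟩ := (D.sl2 π hΦ).exists_nat h.ne (h.wt _) (h.kill α hα)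
  rw [apply_coroot, D.R.cor_apply, div_eq_iff (D.R.form_self_ne hΦ), D.R.form_self_eq hΦ] at hn
  have e : D.R.form α lam = ((n * (D.R.form α α).re / 2 : ℝ) : ℂ) := by
    push_cast; linear_combination hn / 2
  have := D.R.form_self_re_pos hΦ
  rw [e, Complex.ofReal_im, Complex.ofReal_re]
  exact ⟨rfl, by positivity⟩

/-- The lowering operators. -/
def negOps (π : L →ₗ⁅ℂ⁆ Module.End ℂ V) (α : D.R.pos) : Module.End ℂ V :=
  π (D.e (-(α : Module.Dual ℂ t)))

omit [FiniteDimensional ℂ t] in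
/-- An irreducible representation is spanned by the vectors obtained from a highest weight vector by
lowering operators. -/
theorem IsHighest.span_gen (h : D.IsHighest π lam v) :
    Submodule.span ℂ {w | Gen (D.negOps π) v w} = ⊤ := by
  set U := Submodule.span ℂ {w | Gen (D.negOps π) v w} with hU
  have hvU : v ∈ U := Submodule.subset_span .base
  have hneg : ∀ α ∈ D.R.pos, ∀ w ∈ U, π (D.e (-α)) w ∈ U := fun α hα w hw =>
    Gen.map_span (ops := D.negOps π) ⟨α, hα⟩ hw
  have hgen : ∀ w, Gen (D.negOps π) v w → ∀ X, π X w ∈ U := by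
    intro w hw
    induction hw with
    | base =>
      intro X
      obtain ⟨Y, c, rfl⟩ := D.span X
      rw [map_add, map_sum, LinearMap.add_apply, LinearMap.sum_apply, h.wt]
      refine add_mem (Submodule.smul_mem _ _ hvU) (Submodule.sum_mem _ fun α hα => ?_)
      rw [map_smul, LinearMap.smul_apply]
      refine Submodule.smul_mem _ _ ?_
      rcases D.R.pos_or_neg hα with hp | hp
      · rw [h.kill α hp]; exact zero_mem _
      · have := hneg _ hp v hvU
        rwa [neg_neg] at this
    | step α w _ ih =>
      intro X
      have e : π X (D.negOps π α w) = D.negOps π α (π X w) + π ⁅X, D.e (-α.1)⁆ w := by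
        rw [LieHom.map_lie, Ring.lie_def, LinearMap.sub_apply]
        simp [negOps]
      rw [e]
      exact add_mem (hneg α α.2 _ (ih X)) (ih _)
  refine (h.irr U fun X w hw => ?_).resolve_left fun h0 => h.ne (by
    rw [h0] at hvU; simpa using hvU)
  induction hw using Submodule.span_induction with
  | mem x hx => exact hgen x hx X
  | zero => simp
  | add x y _ _ hx hy => rw [map_add]; exact add_mem hx hy
  | smul c x _ hx => rw [map_smul]; exact Submodule.smul_mem _ _ hx

omit [FiniteDimensional ℂ t] in
/-- An irreducible representation with a highest weight has a basis of weight vectors, with the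
highest weight occurring once and the others obtained by subtracting positive roots. -/
theorem IsHighest.exists_basis [FiniteDimensional ℂ V] (h : D.IsHighest π lam v) :
    ∃ (b : Module.Basis (Fin (Module.finrank ℂ V)) ℂ V)
      (wt : Fin (Module.finrank ℂ V) → Module.Dual ℂ t),
      IsWeightBasis (D.tact π) b wt ∧ D.R.HasTop (chi wt) lam := by
  classical
  obtain ⟨b, hb⟩ := exists_weightBasis _ (h.span_gen D)
  have hw : ∀ w, Gen (D.negOps π) v w → ∃ β ∈ D.R.Qp, w ∈ wspace (D.tact π) (lam - β) ∧
      (β ≠ 0 ∨ w = v) := by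
    intro w hw
    induction hw with
    | base => exact ⟨0, zero_mem _, fun Y => by rw [sub_zero]; exact h.wt Y, .inr rfl⟩
    | step α w _ ih =>
      obtain ⟨β, hβ, hβw, _⟩ := ih
      have hαQ : α.1 ∈ D.R.Qp := AddSubmonoid.subset_closure α.2
      refine ⟨α.1 + β, add_mem hαQ hβ, fun Y => ?_,
        .inl (D.R.Qp_add_ne hαQ hβ (D.R.ne_zero (D.R.pos_sub α.2)))⟩
      have := LinearMap.congr_fun (D.op_shift π (D.R.neg_mem (D.R.pos_sub α.2)) Y) w
      simp only [Module.End.mul_apply, LinearMap.add_apply, LinearMap.smul_apply, hβw Y, map_smul]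
        at this
      rw [negOps, this]
      simp only [LinearMap.neg_apply, LinearMap.sub_apply, LinearMap.add_apply]
      module
  choose β hβ hβw hβ0 using fun j => hw (b j) (hb j)
  have hwb : IsWeightBasis (D.tact π) b (fun j => lam - β j) := fun Y j => hβw j Y
  refine ⟨b, fun j => lam - β j, hwb, ?_⟩
  obtain ⟨j0, hj0⟩ := hwb.exists_wt (v := v) (μ := lam) (fun Y => h.wt Y) h.ne
  have hβj0 : β j0 = 0 := by simpa using hj0
  have hbj0 : b j0 = v := (hβ0 j0).resolve_left (by simp [hβj0])
  have hsum : chi (fun j => lam - β j) - ex lam = ∑ j ∈ Finset.univ.erase j0, ex (lam - β j) := by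
    rw [chi, ← Finset.add_sum_erase _ _ (Finset.mem_univ j0), hj0]
    abel
  rw [RootSys.HasTop, hsum]
  refine Submodule.sum_mem _ fun j hj => Submodule.subset_span ⟨β j, hβ j, ?_, rfl⟩
  refine (hβ0 j).resolve_right fun hbj => (Finset.mem_erase.1 hj).1 ?_
  exact b.injective (hbj.trans hbj0.symm)

/-- The Casimir operator acts by the scalar `(λ, λ + 2ρ)`: this is its eigenvalue on the highest
weight vector, and its eigenspaces are invariant. -/
theorem IsHighest.casimir_eq (h : D.IsHighest π lam v) :
    D.casimir π = (D.R.form lam lam + 2 * D.R.form D.R.hρ lam) • LinearMap.id := by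
  set c := D.R.form lam lam + 2 * D.R.form D.R.hρ lam with hc
  have hv : D.casimir π v = c • v := by
    rw [casimir, LinearMap.add_apply, LinearMap.sum_apply, LinearMap.sum_apply,
      D.R.sum_roots fun α => (π (D.e α) * π (D.e (-α))) v]
    have h1 : ∀ j, (π (D.i (hb j)) * π (D.i (D.hb' j))) v =
        (lam (hb j) * lam (D.hb' j)) • v := fun j => by
      rw [Module.End.mul_apply, h.wt, map_smul, h.wt, smul_smul, mul_comm]
    have h2 : ∀ α ∈ D.R.pos, (π (D.e α) * π (D.e (-α))) v +
        (π (D.e (-α)) * π (D.e (- -α))) v = D.R.form α lam • v := fun α hα => by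
      rw [neg_neg, Module.End.mul_apply (π (D.e (-α))), h.kill α hα, map_zero, add_zero]
      have := LinearMap.congr_fun (LieHom.map_lie π (D.e α) (D.e (-α))) v
      rw [Ring.lie_def, LinearMap.sub_apply, Module.End.mul_apply (π (D.e (-α))), h.kill α hα,
        map_zero, sub_zero, D.lie_ee α (D.R.pos_sub hα), h.wt, ← D.form_eq] at this
      exact this.symm
    rw [Finset.sum_congr rfl fun j _ => h1 j, Finset.sum_congr rfl h2, ← Finset.sum_smul,
      ← Finset.sum_smul, ← D.form_self, ← add_smul, hc, RootSys.hρ]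
    congr 2
    simp only [map_smul, map_sum, LinearMap.smul_apply, LinearMap.sum_apply, smul_eq_mul]
    ring
  have hker := (h.irr (LinearMap.ker (D.casimir π - c • LinearMap.id)) fun X w hw => by
    rw [LinearMap.mem_ker, LinearMap.sub_apply, sub_eq_zero] at hw ⊢
    have := LinearMap.congr_fun (D.casimir_comm π X) w
    rw [Module.End.mul_apply, Module.End.mul_apply, hw] at this
    rw [← this]; simp).resolve_left fun h0 => h.ne (by
      have : v ∈ LinearMap.ker (D.casimir π - c • LinearMap.id) := by
        rw [LinearMap.mem_ker, LinearMap.sub_apply, hv]; simp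
      rw [h0] at this; simpa using this)
  exact sub_eq_zero.1 (LinearMap.ker_eq_top.1 hker)

/-! ### Freudenthal's formula and the Weyl character formula -/

section Freudenthal

variable {ι : Type*} [Fintype ι] {b : Module.Basis ι ℂ V} {wt : ι → Module.Dual ℂ t}

/-- The generating function of the traces of `e_α e_{-α}` on the weight spaces. -/
def gfun (π : L →ₗ⁅ℂ⁆ Module.End ℂ V) (b : Module.Basis ι ℂ V) (wt : ι → Module.Dual ℂ t)
    (α : Module.Dual ℂ t) : GA (Module.Dual ℂ t) :=
  ∑ k, b.repr ((π (D.e α) * π (D.e (-α))) (b k)) k • ex (wt k)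

omit [FiniteDimensional ℂ t] in
theorem repr_mul (x y : Module.End ℂ V) (k : ι) :
    b.repr ((x * y) (b k)) k = ∑ j, b.repr (y (b k)) j * b.repr (x (b j)) k := by
  rw [Module.End.mul_apply]
  conv_lhs => rw [← b.sum_repr (y (b k)), map_sum, map_sum]
  simp [Finsupp.finsetSum_apply]

omit [FiniteDimensional ℂ t] in
/-- Cyclicity of the trace and `[e_α, e_{-α}] = t_α` give a recursion for `gfun` along
`α`-strings. -/
theorem gfun_rec (hb : IsWeightBasis (D.tact π) b wt) {α : Module.Dual ℂ t} (hα : α ∈ D.R.Φ) :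
    (1 - ex (-α)) * D.gfun π b wt α = ∑ k, D.R.form α (wt k) • ex (wt k) := by
  have h1 : ∀ k, D.R.form α (wt k) = b.repr ((π (D.e α) * π (D.e (-α))) (b k)) k -
      b.repr ((π (D.e (-α)) * π (D.e α)) (b k)) k := by
    intro k
    have : D.tact π (D.tt α) = π (D.e α) * π (D.e (-α)) - π (D.e (-α)) * π (D.e α) := by
      rw [tact_apply, ← D.lie_ee α hα, LieHom.map_lie, Ring.lie_def]
    have h2 := LinearMap.congr_fun this (b k)
    rw [hb, LinearMap.sub_apply] at h2
    rw [← Finsupp.sub_apply, ← map_sub, ← h2, map_smul, ← D.form_eq]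
    simp
  have h3 : ex (-α) * D.gfun π b wt α =
      ∑ k, b.repr ((π (D.e (-α)) * π (D.e α)) (b k)) k • ex (wt k) := by
    simp only [gfun, repr_mul, Finset.mul_sum, Finset.sum_smul, mul_smul_comm, ex_mul]
    rw [Finset.sum_comm]
    refine Finset.sum_congr rfl fun j _ => Finset.sum_congr rfl fun k _ => ?_
    by_cases h0 : b.repr (π (D.e α) (b j)) k = 0
    · simp [h0]
    · rw [hb.wt_of_shift (D.op_shift π hα) h0, mul_comm (b.repr _ _)]
      congr 2
      abel
  rw [sub_mul, one_mul, h3, gfun, ← Finset.sum_sub_distrib]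
  exact Finset.sum_congr rfl fun k _ => by rw [h1, sub_smul]

/-- The generating function form of Freudenthal's formula: the trace of the Casimir operator on
weight spaces. -/
theorem freudenthal (hb : IsWeightBasis (D.tact π) b wt) {c : ℂ}
    (hc : D.casimir π = c • LinearMap.id) :
    c • chi wt = lap D.R.form (chi wt) + ∑ α ∈ D.R.Φ, D.gfun π b wt α := by
  have h1 : ∀ k, c = D.R.form (wt k) (wt k) +
      ∑ α ∈ D.R.Φ, b.repr ((π (D.e α) * π (D.e (-α))) (b k)) k := by
    intro k
    have h2 := congrArg (fun w => b.repr w k) (LinearMap.congr_fun hc (b k))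
    have h3 : ∀ j, (π (D.i (SplitData.hb j)) * π (D.i (D.hb' j))) (b k) =
        (wt k (SplitData.hb j) * wt k (D.hb' j)) • b k := fun j => by
      have h4 := hb (D.hb' j) k
      have h5 := hb (SplitData.hb j) k
      rw [tact_apply] at h4 h5
      rw [Module.End.mul_apply, h4, map_smul, h5, smul_smul, mul_comm]
    simp only [casimir, LinearMap.add_apply, LinearMap.sum_apply, h3, map_add, map_sum,
      ← Finset.sum_smul, ← D.form_self, LinearMap.smul_apply, LinearMap.id_apply, map_smul,
      Finsupp.add_apply, Finsupp.smul_apply, Module.Basis.repr_self, Finsupp.single_eq_same,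
      smul_eq_mul, mul_one, Finsupp.finsetSum_apply] at h2
    exact h2.symm
  simp only [gfun]
  rw [Finset.sum_comm, chi, map_sum, Finset.smul_sum, ← Finset.sum_add_distrib]
  refine Finset.sum_congr rfl fun k _ => ?_
  rw [lap_ex, ← Finset.sum_smul, ← add_smul, ← h1 k]

/-- `(χ · den)` is an eigenvector of the Laplacian, up to `Δ(den)`. -/
theorem lap_chi_den (hb : IsWeightBasis (D.tact π) b wt) {c : ℂ}
    (hc : D.casimir π = c • LinearMap.id) :
    lap D.R.form (chi wt * D.R.den) = c • (chi wt * D.R.den) + chi wt * lap D.R.form D.R.den := by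
  classical
  have h1 : lap D.R.form (chi wt * D.R.den) = lap D.R.form (chi wt) * D.R.den +
      (2 : ℂ) • ∑ k, ex (wt k) * dLin D.R.form (wt k) D.R.den +
      chi wt * lap D.R.form D.R.den := by
    simp only [chi, Finset.sum_mul, map_sum, Finset.smul_sum]
    rw [← Finset.sum_add_distrib, ← Finset.sum_add_distrib]
    exact Finset.sum_congr rfl fun k _ => lap_ex_mul _ D.R.symm _ _
  have h2 : (2 : ℂ) • ∑ k, ex (wt k) * dLin D.R.form (wt k) D.R.den =
      (∑ α ∈ D.R.Φ, D.gfun π b wt α) * D.R.den := by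
    rw [D.R.sum_roots, Finset.sum_mul]
    have h3 : ∀ k, dLin D.R.form (wt k) D.R.den = ∑ α ∈ D.R.pos,
        (1 / 2 * D.R.form α (wt k)) • ((∏ β ∈ D.R.pos.erase α,
          (ex ((1 / 2 : ℂ) • β) - ex (-((1 / 2 : ℂ) • β)))) *
          (ex ((1 / 2 : ℂ) • α) + ex (-((1 / 2 : ℂ) • α)))) := by
      intro k
      rw [RootSys.den, dLin_prod]
      refine Finset.sum_congr rfl fun α _ => ?_
      rw [map_sub, dLin_ex, dLin_ex, map_neg, map_smul, D.R.symm (wt k), smul_eq_mul, neg_smul,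
        sub_neg_eq_add, ← smul_add, mul_smul_comm]
    simp only [h3, Finset.mul_sum, Finset.smul_sum]
    rw [Finset.sum_comm]
    refine Finset.sum_congr rfl fun α hα => ?_
    have hden : D.R.den = (ex ((1 / 2 : ℂ) • α) - ex (-((1 / 2 : ℂ) • α))) *
        ∏ β ∈ D.R.pos.erase α, (ex ((1 / 2 : ℂ) • β) - ex (-((1 / 2 : ℂ) • β))) :=
      (Finset.mul_prod_erase D.R.pos
        (fun β => ex ((1 / 2 : ℂ) • β) - ex (-((1 / 2 : ℂ) • β))) hα).symm
    have hΦ := D.R.pos_sub hα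
    have r1 := D.gfun_rec hb hΦ
    have r2 := D.gfun_rec hb (D.R.neg_mem hΦ)
    have hab : ex ((1 / 2 : ℂ) • α) * ex (-((1 / 2 : ℂ) • α)) = 1 := by
      rw [ex_mul, add_neg_cancel, ex_zero]
    have haa : ex (- -α) = ex ((1 / 2 : ℂ) • α) * ex ((1 / 2 : ℂ) • α) := by
      rw [ex_mul]; congr 1; module
    have hbb : ex (-α) = ex (-((1 / 2 : ℂ) • α)) * ex (-((1 / 2 : ℂ) • α)) := by
      rw [ex_mul]; congr 1; module
    rw [haa] at r2
    rw [hbb] at r1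
    simp only [map_neg, LinearMap.neg_apply, neg_smul, Finset.sum_neg_distrib] at r2
    rw [hden]
    generalize ex ((1 / 2 : ℂ) • α) = a at *
    generalize ex (-((1 / 2 : ℂ) • α)) = a' at *
    generalize (∏ β ∈ D.R.pos.erase α, (ex ((1 / 2 : ℂ) • β) - ex (-((1 / 2 : ℂ) • β)))) = P
    have e4 : ∑ k, (2 : ℂ) • (ex (wt k) * (1 / 2 * D.R.form α (wt k)) • (P * (a + a'))) =
        (∑ k, D.R.form α (wt k) • ex (wt k)) * (P * (a + a')) := by
      rw [Finset.sum_mul]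
      refine Finset.sum_congr rfl fun k _ => ?_
      rw [mul_smul_comm, smul_smul, smul_mul_assoc]
      congr 1
      ring
    rw [e4]
    set d := ∑ k, D.R.form α (wt k) • ex (wt k) with hd
    -- combining the recursions for `α` and `-α`, which are the only ones that involve this factor
    linear_combination (-(P * a)) * r1 + (P * a') * r2 +
      (-P * (a' * D.gfun π b wt α - a * D.gfun π b wt (-α))) * hab
  rw [h1, h2, ← smul_mul_assoc, D.freudenthal hb hc]
  ring

omit [FiniteDimensional ℂ t] in
/-- Characters are invariant under the Weyl group. -/
theorem gact_chi [FiniteDimensional ℂ V] (hb : IsWeightBasis (D.tact π) b wt)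
    {w : Module.Dual ℂ t ≃ₗ[ℂ] Module.Dual ℂ t} (hw : w ∈ D.R.weyl) :
    gact w (chi wt) = chi wt := by
  have hs : ∀ α ∈ D.R.Φ, gact (D.R.refl α) (chi wt) = chi wt := by
    intro α hα
    ext μ
    obtain ⟨ν, rfl⟩ := (D.R.refl α).surjective μ
    rw [coeff_gact, coeff_chi hb, coeff_chi hb, D.R.refl_apply, ← D.apply_coroot,
      (D.sl2 π hα).finrank_reflect hb]
  refine D.R.weyl_induction (p := fun w => gact w (chi wt) = chi wt) (gact_one _)
    (fun α hα w h => ?_) hw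
  rw [gact_mul, h, hs α hα]

end Freudenthal

/-- The Weyl character formula. The product of the character and the Weyl denominator is alternating
with top term `e^{λ + ρ}`. The Casimir operator being a scalar, it is an eigenvector of the
Laplacian, so that all its exponents have the same length as `λ + ρ`; the only dominant exponent of
this length is `λ + ρ` itself. -/
theorem IsHighest.weyl_character [FiniteDimensional ℂ V] (h : D.IsHighest π lam v)
    {ι : Type*} [Fintype ι] {b : Module.Basis ι ℂ V} {wt : ι → Module.Dual ℂ t}
    (hb : IsWeightBasis (D.tact π) b wt) (htop : D.R.HasTop (chi wt) lam) :
    chi wt * D.R.den = D.R.alt (lam + D.R.hρ) := by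
  set Λ := lam + D.R.hρ with hΛ
  have hstrict : D.R.StrictDom Λ := by
    intro α hα
    obtain ⟨h1, h2⟩ := h.dom D α hα
    obtain ⟨h3, h4⟩ := D.R.hρ_strictDom α hα
    rw [hΛ, map_add, Complex.add_im, Complex.add_re, h1, h3]
    exact ⟨by simp, by linarith⟩
  refine D.R.eq_alt (fun w hw => ?_) (RootSys.HasTop.mul _ htop D.R.den_hasTop) hstrict
    (fun μ hμ hdom => ?_) fun w hw => D.R.sgn_weyl_ne hw
  · rw [map_mul, D.gact_chi hb hw, D.R.den_alternating w hw, mul_smul_comm]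
  · have hlap : lap D.R.form D.R.den = D.R.form D.R.hρ D.R.hρ • D.R.den := by
      rw [D.R.den_eq_alt, RootSys.alt, map_sum, Finset.smul_sum]
      refine Finset.sum_congr rfl fun w _ => ?_
      rw [map_smul, lap_ex, D.R.form_weyl w.2, smul_comm]
    have hQ := D.lap_chi_den hb (h.casimir_eq D)
    rw [hlap, mul_smul_comm, ← add_smul] at hQ
    have hc := congrArg (fun f => f.coeff μ) hQ
    simp only [coeff_lap, AddMonoidAlgebra.coeff_smul, Finsupp.smul_apply, smul_eq_mul] at hc
    have hnorm := mul_right_cancel₀ hμ hc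
    obtain ⟨β, hβ, rfl⟩ := (RootSys.HasTop.mul _ htop D.R.den_hasTop).coeff_support D.R hμ
    -- `Λ` and `Λ - β` have the same length, so `β` is orthogonal to the strictly dominant
    -- `2Λ - β`, which forces `β = 0`
    have hz : D.R.form (Λ + (Λ - β)) β = 0 := by
      have e : D.R.form lam lam + 2 * D.R.form D.R.hρ lam + D.R.form D.R.hρ D.R.hρ =
          D.R.form Λ Λ := by
        rw [hΛ]
        simp only [map_add, LinearMap.add_apply, D.R.symm lam D.R.hρ]
        ring
      rw [e] at hnorm
      change D.R.form (Λ - β) (Λ - β) = _ at hnorm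
      simp only [map_add, map_sub, LinearMap.add_apply, LinearMap.sub_apply,
        D.R.symm β Λ] at hnorm ⊢
      linear_combination -hnorm
    have hpos : ∀ γ ∈ D.R.pos, 0 < D.R.reForm (Λ + (Λ - β)) γ := fun γ hγ => by
      rw [RootSys.reForm_apply, D.R.symm, map_add, Complex.add_re]
      have h1 := (hstrict γ hγ).2
      have h2 := (hdom γ hγ).2
      linarith
    rcases D.R.Qp_pos (D.R.reForm (Λ + (Λ - β))) hpos hβ with h0 | h0
    · rw [h0, sub_zero]
    · rw [RootSys.reForm_apply, hz] at h0
      simp at h0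

end SplitData

end WeylChar

namespace WeylChar

/-! ### Exponentials of diagonalisable actions -/

section DiagExp

variable {t V ι : Type*} [AddCommGroup t] [Module ℂ t] [AddCommGroup V] [Module ℂ V]
  {ρ : t →ₗ[ℂ] Module.End ℂ V} {b : Module.Basis ι ℂ V} {wt : ι → Module.Dual ℂ t}

/-- The exponential of the action of `Y`, which is diagonal in a basis of weight vectors. -/
def dexp (b : Module.Basis ι ℂ V) (wt : ι → Module.Dual ℂ t) (Y : t) : Module.End ℂ V :=
  b.constr ℂ fun i => Complex.exp (wt i Y) • b i

theorem dexp_basis (Y : t) (i : ι) : dexp b wt Y (b i) = Complex.exp (wt i Y) • b i :=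
  b.constr_basis ℂ _ i

theorem dexp_wspace [Fintype ι] (hb : IsWeightBasis ρ b wt) {μ : Module.Dual ℂ t} {v : V}
    (hv : v ∈ wspace ρ μ) (Y : t) : dexp b wt Y v = Complex.exp (μ Y) • v := by
  conv_lhs => rw [← b.sum_repr v]
  conv_rhs => rw [← b.sum_repr v]
  rw [map_sum, Finset.smul_sum]
  refine Finset.sum_congr rfl fun i _ => ?_
  by_cases h : b.repr v i = 0
  · simp [h]
  · rw [map_smul, dexp_basis, hb.wt_of_repr hv h, smul_comm]

/-- An operator shifting weights by `α` is an eigenvector of the conjugation action. -/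
theorem dexp_shift [Fintype ι] (hb : IsWeightBasis ρ b wt) {α : Module.Dual ℂ t}
    {A : Module.End ℂ V} (hA : ∀ Y, ρ Y * A = A * ρ Y + α Y • A) (Y : t) :
    dexp b wt Y * A = Complex.exp (α Y) • (A * dexp b wt Y) := by
  refine b.ext fun i => ?_
  have h : A (b i) ∈ wspace ρ (wt i + α) := fun Z => by
    have := LinearMap.congr_fun (hA Z) (b i)
    simp only [Module.End.mul_apply, LinearMap.add_apply, LinearMap.smul_apply, hb Z, map_smul]
      at this
    rw [this, LinearMap.add_apply, add_smul]
  rw [Module.End.mul_apply, dexp_wspace hb h, LinearMap.smul_apply, Module.End.mul_apply,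
    dexp_basis, map_smul, smul_smul, LinearMap.add_apply, Complex.exp_add, mul_comm]

theorem dexp_comm [Fintype ι] (hb : IsWeightBasis ρ b wt) {A : Module.End ℂ V}
    (hA : ∀ Y, ρ Y * A = A * ρ Y) (Y : t) : dexp b wt Y * A = A * dexp b wt Y := by
  have := dexp_shift hb (α := 0) (A := A) (fun Y => by rw [hA]; simp) Y
  simpa using this

theorem dexp_add (Y Y' : t) : dexp b wt (Y + Y') = dexp b wt Y * dexp b wt Y' :=
  b.ext fun i => by
    rw [Module.End.mul_apply, dexp_basis, dexp_basis, map_smul, dexp_basis, smul_smul, map_add,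
      Complex.exp_add, mul_comm]

theorem dexp_congr {Y Y' : t} (h : ∀ i, Complex.exp (wt i Y) = Complex.exp (wt i Y')) :
    dexp b wt Y = dexp b wt Y' :=
  b.ext fun i => by rw [dexp_basis, dexp_basis, h]

theorem trace_dexp [Fintype ι] (Y : t) :
    LinearMap.trace ℂ V (dexp b wt Y) = ∑ i, Complex.exp (wt i Y) := by
  classical
  rw [LinearMap.trace_eq_matrix_trace ℂ b, Matrix.trace]
  refine Finset.sum_congr rfl fun i _ => ?_
  rw [Matrix.diag_apply, LinearMap.toMatrix_apply, dexp_basis]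
  simp

theorem hasDerivAt_dexp [Fintype ι] (hb : IsWeightBasis ρ b wt) (Y : t) (v : V)
    (f : Module.Dual ℂ V) :
    HasDerivAt (fun s : ℝ => f (dexp b wt ((s : ℂ) • Y) v)) (f (ρ Y v)) 0 := by
  have h1 : ∀ s : ℝ, f (dexp b wt ((s : ℂ) • Y) v) =
      ∑ i, b.repr v i * (Complex.exp ((s : ℂ) * wt i Y) * f (b i)) := fun s => by
    conv_lhs => rw [← b.sum_repr v]
    simp only [map_sum, map_smul, dexp_basis, smul_eq_mul]
  have h2 : f (ρ Y v) = ∑ i, b.repr v i * (wt i Y * f (b i)) := by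
    conv_lhs => rw [← b.sum_repr v]
    simp only [map_sum, map_smul, hb Y, smul_eq_mul]
  simp only [h1]
  rw [h2]
  refine HasDerivAt.fun_sum fun i _ => HasDerivAt.const_mul _ (HasDerivAt.mul_const ?_ _)
  have h3 : HasDerivAt (fun s : ℝ => (s : ℂ) * wt i Y) (wt i Y) 0 := by
    simpa using (Complex.ofRealCLM.hasDerivAt (x := (0 : ℝ))).mul_const (wt i Y)
  simpa using h3.cexp

end DiagExp

/-! ### Traces -/

section Trace

variable {V : Type*} [AddCommGroup V] [Module ℂ V]

theorem traceOn_of_invariant {A : Module.End ℂ V} {U : Submodule ℂ V} (h : ∀ v ∈ U, A v ∈ U) :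
    traceOn A U = LinearMap.trace ℂ U (A.restrict h) := by
  rw [traceOn, dif_pos h]

/-- The trace on `U`, computed with a projection onto `U`. -/
theorem traceOn_eq_trace_comp [FiniteDimensional ℂ V] {A : Module.End ℂ V} {U : Submodule ℂ V}
    (h : ∀ v ∈ U, A v ∈ U) (p : V →ₗ[ℂ] U) (hp : ∀ u : U, p u = u) :
    traceOn A U = LinearMap.trace ℂ V (A ∘ₗ U.subtype ∘ₗ p) := by
  rw [traceOn_of_invariant h, ← LinearMap.comp_assoc, LinearMap.trace_comp_comm']
  congr 1
  ext u
  have := hp (A.restrict h u)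
  simpa using congrArg Subtype.val this.symm

/-- The Euler-Poincaré principle: the trace of an operator commuting with `D` on `U` is the sum of
its traces on the kernel and on the image of `D`. -/
theorem traceOn_ker_add_map [FiniteDimensional ℂ V] {A D : Module.End ℂ V} {U : Submodule ℂ V}
    (h : ∀ v ∈ U, A v ∈ U) (hAD : A * D = D * A) :
    traceOn A U = traceOn A (LinearMap.ker D ⊓ U) + traceOn A (U.map D) := by
  have hc : ∀ v, A (D v) = D (A v) := fun v => LinearMap.congr_fun hAD v
  have hK : ∀ v ∈ LinearMap.ker D ⊓ U, A v ∈ LinearMap.ker D ⊓ U := fun v hv =>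
    ⟨LinearMap.mem_ker.2 (by rw [← hc, LinearMap.mem_ker.1 hv.1, map_zero]), h v hv.2⟩
  have hI : ∀ v ∈ U.map D, A v ∈ U.map D := by
    rintro _ ⟨v, hv, rfl⟩
    exact ⟨A v, h v hv, (hc v).symm⟩
  let D' : U →ₗ[ℂ] U.map D := D.restrict fun v hv => ⟨v, hv, rfl⟩
  have hD' : LinearMap.range D' = ⊤ := by
    rw [LinearMap.range_eq_top]
    rintro ⟨_, v, hv, rfl⟩
    exact ⟨⟨v, hv⟩, rfl⟩
  obtain ⟨s, hs⟩ := D'.exists_rightInverse_of_surjective hD'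
  have hs' : ∀ w, D' (s w) = w := fun w => LinearMap.congr_fun hs w
  let AU : Module.End ℂ U := A.restrict h
  have hAU : ∀ u, D' (AU u) = (A.restrict hI) (D' u) := fun u => Subtype.ext (hc u).symm
  -- `1 - s D'` is a projection of `U` onto the kernel
  let r : U →ₗ[ℂ] U := LinearMap.id - s ∘ₗ D'
  let p : U →ₗ[ℂ] ↥(LinearMap.ker D ⊓ U) :=
    LinearMap.codRestrict _ (U.subtype ∘ₗ r) fun u =>
      ⟨by
        have : D' (r u) = 0 := by simp [r, hs']
        exact congrArg Subtype.val this, (r u).2⟩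
  let j : ↥(LinearMap.ker D ⊓ U) →ₗ[ℂ] U := Submodule.inclusion inf_le_right
  have e1 : LinearMap.trace ℂ U (AU ∘ₗ r) =
      traceOn A (LinearMap.ker D ⊓ U) := by
    have : AU ∘ₗ r = (AU ∘ₗ j) ∘ₗ p := rfl
    rw [this, LinearMap.trace_comp_comm', traceOn_of_invariant hK]
    congr 1
    ext ⟨u, hu⟩
    have h0 : D' (AU (j ⟨u, hu⟩)) = 0 := by
      rw [hAU]
      have : D' (j ⟨u, hu⟩) = 0 := Subtype.ext (LinearMap.mem_ker.1 hu.1)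
      rw [this, map_zero]
    change (r (AU (j ⟨u, hu⟩)) : U).1 = A u
    rw [LinearMap.sub_apply, LinearMap.comp_apply, h0, map_zero, sub_zero]
    rfl
  have e2 : LinearMap.trace ℂ U (AU ∘ₗ (s ∘ₗ D')) = traceOn A (U.map D) := by
    rw [← LinearMap.comp_assoc, LinearMap.trace_comp_comm', traceOn_of_invariant hI]
    congr 1
    ext w
    change (D' (AU (s w))).1 = _
    rw [hAU, hs']
  rw [traceOn_of_invariant h, ← e1, ← e2, ← map_add, ← LinearMap.comp_add, sub_add_cancel]
  rfl

/-- An operator whose range lies in the line of `v` has the eigenvalue of `v` as its trace. -/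
theorem trace_of_range_line [FiniteDimensional ℂ V] {f : Module.End ℂ V} {v : V} (hv : v ≠ 0)
    (hf : ∀ w, ∃ c : ℂ, f w = c • v) {z : ℂ} (hz : f v = z • v) : LinearMap.trace ℂ V f = z := by
  obtain ⟨ψ, hψ⟩ : ∃ ψ : Module.Dual ℂ V, ψ v = 1 :=
    Module.Projective.exists_dual_eq_one ℂ hv
  have : f = (ψ ∘ₗ f).smulRight v := by
    ext w
    obtain ⟨c, hc⟩ := hf w
    simp [hc, hψ]
  rw [this, LinearMap.trace_smulRight, LinearMap.comp_apply, hz, map_smul, hψ, smul_eq_mul, mul_one]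

/-- The grading operator of a decomposition `V = P ⊕ M`: the identity on `P` and `-1` on `M`. -/
def grading {P M : Submodule ℂ V} (h : IsCompl P M) : Module.End ℂ V :=
  P.subtype ∘ₗ P.projectionOnto M h - M.subtype ∘ₗ M.projectionOnto P h.symm

section Grading

variable {P M : Submodule ℂ V} (h : IsCompl P M)

theorem grading_left {v : V} (hv : v ∈ P) : grading h v = v := by
  have h1 := Submodule.projectionOnto_apply_left h ⟨v, hv⟩
  have h2 := Submodule.projectionOnto_apply_right h.symm ⟨v, hv⟩
  simp only [grading, LinearMap.sub_apply, LinearMap.comp_apply]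
  erw [h1, h2]
  simp

theorem grading_right {v : V} (hv : v ∈ M) : grading h v = -v := by
  have h1 := Submodule.projectionOnto_apply_left h.symm ⟨v, hv⟩
  have h2 := Submodule.projectionOnto_apply_right h ⟨v, hv⟩
  simp only [grading, LinearMap.sub_apply, LinearMap.comp_apply]
  erw [h1, h2]
  simp

theorem end_ext_of_isCompl (h : IsCompl P M) {A A' : Module.End ℂ V} (hP : ∀ v ∈ P, A v = A' v)
    (hM : ∀ v ∈ M, A v = A' v) : A = A' := by
  ext v
  obtain ⟨p, hp, q, hq, rfl⟩ := Submodule.mem_sup.1 (h.sup_eq_top ▸ Submodule.mem_top : v ∈ P ⊔ M)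
  rw [map_add, map_add, hP p hp, hM q hq]

theorem mem_left_of_grading {v : V} (hv : grading h v = v) : v ∈ P := by
  obtain ⟨p, hp, q, hq, rfl⟩ := Submodule.mem_sup.1 (h.sup_eq_top ▸ Submodule.mem_top : v ∈ P ⊔ M)
  rw [map_add, grading_left h hp, grading_right h hq, add_right_inj, neg_eq_iff_add_eq_zero,
    ← two_smul ℂ] at hv
  rw [(smul_eq_zero.1 hv).resolve_left two_ne_zero, add_zero]
  exact hp

theorem mem_right_of_grading {v : V} (hv : grading h v = -v) : v ∈ M := by
  obtain ⟨p, hp, q, hq, rfl⟩ := Submodule.mem_sup.1 (h.sup_eq_top ▸ Submodule.mem_top : v ∈ P ⊔ M)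
  rw [map_add, grading_left h hp, grading_right h hq, neg_add, add_left_inj,
    eq_neg_iff_add_eq_zero, ← two_smul ℂ] at hv
  rw [(smul_eq_zero.1 hv).resolve_left two_ne_zero, zero_add]
  exact hq

/-- The difference of the traces on the two parts of a grading. -/
theorem traceOn_sub_traceOn [FiniteDimensional ℂ V] {A : Module.End ℂ V}
    (hP : ∀ v ∈ P, A v ∈ P) (hM : ∀ v ∈ M, A v ∈ M) :
    traceOn A P - traceOn A M = LinearMap.trace ℂ V (A * grading h) := by
  rw [traceOn_eq_trace_comp hP (P.projectionOnto M h) fun u =>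
      Submodule.projectionOnto_apply_left h u,
    traceOn_eq_trace_comp hM (M.projectionOnto P h.symm) fun u =>
      Submodule.projectionOnto_apply_left h.symm u, ← map_sub, grading, mul_sub]
  rfl

end Grading

/-- Traces on `V ⊗ U` are products. -/
theorem traceOn_tensor [FiniteDimensional ℂ V] {S : Type*} [AddCommGroup S] [Module ℂ S]
    [FiniteDimensional ℂ S] (A : Module.End ℂ V) (A' : Module.End ℂ S) {U : Submodule ℂ S}
    (h : ∀ v ∈ U, A' v ∈ U) :
    traceOn (TensorProduct.map A A')
      (LinearMap.range (TensorProduct.map (LinearMap.id : V →ₗ[ℂ] V) U.subtype)) =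
      LinearMap.trace ℂ V A * traceOn A' U := by
  obtain ⟨p, hp⟩ := U.subtype.exists_leftInverse_of_injective (Submodule.ker_subtype U)
  set W := LinearMap.range (TensorProduct.map (LinearMap.id : V →ₗ[ℂ] V) U.subtype) with hW
  have hp' : ∀ w ∈ W, TensorProduct.map LinearMap.id (U.subtype ∘ₗ p) w = w := by
    rintro _ ⟨w, rfl⟩
    rw [← LinearMap.comp_apply, ← TensorProduct.map_comp, LinearMap.comp_assoc, hp]
    rfl
  have hq : ∀ w, TensorProduct.map LinearMap.id (U.subtype ∘ₗ p) w ∈ W := fun w => by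
    have : TensorProduct.map (LinearMap.id : V →ₗ[ℂ] V) (U.subtype ∘ₗ p) =
      TensorProduct.map LinearMap.id U.subtype ∘ₗ TensorProduct.map LinearMap.id p := by
      rw [← TensorProduct.map_comp, LinearMap.id_comp]
    rw [this]
    exact ⟨_, rfl⟩
  have hinv : ∀ w ∈ W, TensorProduct.map A A' w ∈ W := by
    rintro _ ⟨w, rfl⟩
    rw [← LinearMap.comp_apply, ← TensorProduct.map_comp]
    have : A' ∘ₗ U.subtype = U.subtype ∘ₗ A'.restrict h := rfl
    rw [this, LinearMap.comp_id, ← LinearMap.id_comp A, TensorProduct.map_comp]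
    exact ⟨_, rfl⟩
  rw [traceOn_eq_trace_comp hinv (LinearMap.codRestrict W _ hq) fun w => Subtype.ext (hp' w w.2),
    traceOn_eq_trace_comp h p (LinearMap.congr_fun hp), ← LinearMap.trace_tensorProduct']
  have : TensorProduct.map A (A' ∘ₗ U.subtype ∘ₗ p) =
      TensorProduct.map A A' ∘ₗ TensorProduct.map LinearMap.id (U.subtype ∘ₗ p) := by
    rw [← TensorProduct.map_comp, LinearMap.comp_id]
  rw [this]
  rfl

end Trace

/-! ### The Fock representation of the canonical anticommutation relations -/

/-- Operators satisfying the canonical anticommutation relations. -/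
structure IsCAR {ι S : Type*} [DecidableEq ι] [AddCommGroup S] [Module ℂ S]
    (a b : ι → Module.End ℂ S) : Prop where
  aa : ∀ i j, a i * a j + a j * a i = 0
  bb : ∀ i j, b i * b j + b j * b i = 0
  ab : ∀ i j, a i * b j + b j * a i = if i = j then 1 else 0
  irr : ∀ U : Submodule ℂ S, (∀ i, ∀ v ∈ U, a i v ∈ U) → (∀ i, ∀ v ∈ U, b i v ∈ U) →
    U = ⊥ ∨ U = ⊤

namespace IsCAR

variable {ι S : Type*} [DecidableEq ι] [AddCommGroup S] [Module ℂ S] {a b : ι → Module.End ℂ S}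
  (h : IsCAR a b)

theorem mul_self_eq_zero {ι : Type*} {a : ι → Module.End ℂ S}
    (h : ∀ i j, a i * a j + a j * a i = 0) (i : ι) : a i * a i = 0 := by
  have := h i i
  rw [← two_smul ℂ] at this
  exact (smul_eq_zero.1 this).resolve_left two_ne_zero

include h

/-- A vacuum vector: apply to a nonzero vector all the `a i` that do not kill it. -/
theorem exists_vacuum [Fintype ι] [Nontrivial S] : ∃ v : S, v ≠ 0 ∧ ∀ i, a i v = 0 := by
  suffices ∀ s : Finset ι, ∃ v : S, v ≠ 0 ∧ ∀ i ∈ s, a i v = 0 by simpa using this Finset.univ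
  intro s
  induction s using Finset.induction_on with
  | empty => simpa using exists_ne (0 : S)
  | insert i s _ ih =>
    obtain ⟨v, hv, hs⟩ := ih
    by_cases h0 : a i v = 0
    · exact ⟨v, hv, by simpa [h0] using hs⟩
    · refine ⟨a i v, h0, fun j hj => ?_⟩
      rcases Finset.mem_insert.1 hj with rfl | hj
      · rw [← Module.End.mul_apply, mul_self_eq_zero h.aa, LinearMap.zero_apply]
      · have := LinearMap.congr_fun (h.aa j i) v
        simpa [hs j hj] using this

/-- A vacuum vector generates the whole module under creation operators. -/
theorem span_gen {v : S} (hv : v ≠ 0) (hav : ∀ i, a i v = 0) :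
    Submodule.span ℂ {w | Gen b v w} = ⊤ := by
  set U := Submodule.span ℂ {w | Gen b v w} with hU
  have hvU : v ∈ U := Submodule.subset_span .base
  have hb : ∀ i, ∀ w ∈ U, b i w ∈ U := fun i w hw => Gen.map_span i hw
  have ha : ∀ w, Gen b v w → ∀ i, a i w ∈ U := by
    intro w hw
    induction hw with
    | base => intro i; rw [hav]; exact zero_mem _
    | step j w hw ih =>
      intro i
      have := LinearMap.congr_fun (h.ab i j) w
      rw [LinearMap.add_apply, Module.End.mul_apply, Module.End.mul_apply] at this
      rw [eq_sub_of_add_eq this]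
      refine sub_mem ?_ (hb j _ (ih i))
      split_ifs
      · exact Submodule.subset_span hw
      · exact zero_mem _
  refine (h.irr U (fun i w hw => ?_) hb).resolve_left fun h0 => hv (by
    rw [h0] at hvU; simpa using hvU)
  induction hw using Submodule.span_induction with
  | mem x hx => exact ha x hx i
  | zero => simp
  | add x y _ _ hx hy => rw [map_add]; exact add_mem hx hy
  | smul c x _ hx => rw [map_smul]; exact Submodule.smul_mem _ _ hx

/-- The product of the projections `a i * b i` over a finite set of indices, with the recursion for
the trace of an operator that commutes with the `a i` up to scalars. -/
theorem exists_partial_projection [FiniteDimensional ℂ S] {g : Module.End ℂ S} {c : ι → ℂ}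
    (hg : ∀ i, a i * g = -c i • (g * a i)) (s : Finset ι) :
    ∃ Q : Module.End ℂ S, (∀ i ∉ s, Q * a i = a i * Q ∧ Q * b i = b i * Q) ∧
      (∀ i ∈ s, Q * b i = 0) ∧ (∀ v, (∀ i, a i v = 0) → Q v = v) ∧
      LinearMap.trace ℂ S g = (∏ i ∈ s, (1 - c i)) * LinearMap.trace ℂ S (g * Q) := by
  induction s using Finset.induction_on with
  | empty => exact ⟨1, by simp, by simp, by simp, by simp⟩
  | insert i s hi ih =>
    obtain ⟨Q, h1, h2, h3, h4⟩ := ih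
    obtain ⟨ha, hb⟩ := h1 i hi
    refine ⟨Q * (a i * b i), fun j hj => ?_, fun j hj => ?_, fun v hv => ?_, ?_⟩
    · have hji : i ≠ j := fun h => hj (h ▸ Finset.mem_insert_self _ _)
      obtain ⟨ha', hb'⟩ := h1 j fun h => hj (Finset.mem_insert_of_mem h)
      have e1 := h.aa i j
      have e2 := h.bb i j
      have e3 := h.ab i j
      have e4 := h.ab j i
      rw [if_neg hji] at e3
      rw [if_neg hji.symm] at e4
      rw [← eq_neg_iff_add_eq_zero] at e1 e2 e3 e4
      constructor
      · rw [← mul_assoc (a j), ← ha', mul_assoc, mul_assoc, mul_assoc,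
          show b i * a j = -(a j * b i) by rw [e4, neg_neg], mul_neg,
          ← mul_assoc (a i), e1, neg_mul, neg_neg, mul_assoc]
      · rw [← mul_assoc (b j), ← hb', mul_assoc, mul_assoc, mul_assoc, e2, mul_neg,
          ← mul_assoc (a i), e3, neg_mul, neg_neg, mul_assoc]
    · rcases Finset.mem_insert.1 hj with rfl | hj
      · rw [mul_assoc, mul_assoc, mul_self_eq_zero h.bb, mul_zero, mul_zero]
      · have hij : i ≠ j := fun h => hi (h ▸ hj)
        have e2 := eq_neg_iff_add_eq_zero.2 (h.bb i j)
        have e3 := h.ab i j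
        rw [if_neg hij, ← eq_neg_iff_add_eq_zero] at e3
        rw [mul_assoc, mul_assoc, e2, mul_neg, ← mul_assoc (a i), e3, neg_mul, neg_neg, mul_assoc,
          ← mul_assoc, h2 j hj, zero_mul]
    · have e := LinearMap.congr_fun (h.ab i i) v
      simp only [LinearMap.add_apply, Module.End.mul_apply, hv, map_zero, add_zero, if_true,
        Module.End.one_apply] at e
      rw [Module.End.mul_apply, Module.End.mul_apply, e, h3 v hv]
    · have e1 : LinearMap.trace ℂ S (g * Q) = LinearMap.trace ℂ S (g * (Q * (a i * b i))) +
          LinearMap.trace ℂ S (g * Q * (b i * a i)) := by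
        have := h.ab i i
        rw [if_pos rfl] at this
        rw [← map_add, ← mul_assoc g, ← mul_add, this, mul_one]
      have e2 : LinearMap.trace ℂ S (g * Q * (b i * a i)) =
          -c i * LinearMap.trace ℂ S (g * (Q * (a i * b i))) := by
        rw [← mul_assoc, LinearMap.trace_mul_comm, ← mul_assoc, ← mul_assoc, hg, smul_mul_assoc,
          smul_mul_assoc, map_smul, smul_eq_mul, mul_assoc g (a i), ← ha]
        simp only [mul_assoc]
      rw [h4, Finset.prod_insert hi, e1, e2]
      ring

/-- The trace of an operator commuting with the `a i` up to scalars is determined by its action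
on the vacuum vector. -/
theorem trace_eq [Fintype ι] [FiniteDimensional ℂ S] {g : Module.End ℂ S} {c : ι → ℂ}
    (hg : ∀ i, a i * g = -c i • (g * a i)) {v : S} (hv : v ≠ 0) (hav : ∀ i, a i v = 0) {z : ℂ}
    (hz : g v = z • v) : LinearMap.trace ℂ S g = (∏ i, (1 - c i)) * z := by
  obtain ⟨Q, -, h2, h3, h4⟩ := h.exists_partial_projection hg Finset.univ
  rw [h4]
  congr 1
  have hQ : ∀ w, ∃ y : ℂ, Q w = y • v := by
    intro w
    have hw : w ∈ Submodule.span ℂ {w | Gen b v w} := by rw [h.span_gen hv hav]; trivial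
    induction hw using Submodule.span_induction with
    | mem x hx =>
      cases hx with
      | base => exact ⟨1, by rw [h3 v hav, one_smul]⟩
      | step k w _ => exact ⟨0, by
          rw [← Module.End.mul_apply, h2 k (Finset.mem_univ _)]; simp⟩
    | zero => exact ⟨0, by simp⟩
    | add x y _ _ hx hy =>
      obtain ⟨c1, h1⟩ := hx
      obtain ⟨c2, h2⟩ := hy
      exact ⟨c1 + c2, by rw [map_add, h1, h2, add_smul]⟩
    | smul c x _ hx =>
      obtain ⟨c1, h1⟩ := hx
      exact ⟨c * c1, by rw [map_smul, h1, smul_smul]⟩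
  refine trace_of_range_line hv (fun w => ?_) (by rw [Module.End.mul_apply, h3 v hav, hz])
  obtain ⟨y, hy⟩ := hQ w
  exact ⟨y * z, by rw [Module.End.mul_apply, hy, map_smul, hz, smul_smul]⟩

/-- If the operators `b i` shift the weights by `-α i`, and the vacuum has weight `μ`, then there is
a basis of weight vectors; its weights have any property that `μ` has and that is preserved by
subtracting the `α i`. -/
theorem exists_weightBasis {t : Type*} [AddCommGroup t] [Module ℂ t] [FiniteDimensional ℂ S]
    {ρ : t →ₗ[ℂ] Module.End ℂ S} {α : ι → Module.Dual ℂ t}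
    (hb : ∀ i Y, ρ Y * b i = b i * ρ Y + (-α i) Y • b i) {v : S} (hv : v ≠ 0)
    (hav : ∀ i, a i v = 0) {μ : Module.Dual ℂ t} (hμ : v ∈ wspace ρ μ)
    (p : Module.Dual ℂ t → Prop) (hp : p μ) (hpα : ∀ i ν, p ν → p (ν - α i)) :
    ∃ (B : Module.Basis (Fin (Module.finrank ℂ S)) ℂ S)
      (wt : Fin (Module.finrank ℂ S) → Module.Dual ℂ t), IsWeightBasis ρ B wt ∧ ∀ j, p (wt j) := by
  obtain ⟨B, hB⟩ := WeylChar.exists_weightBasis _ (h.span_gen hv hav)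
  have hw : ∀ w, Gen b v w → ∃ ν, p ν ∧ w ∈ wspace ρ ν := by
    intro w hw
    induction hw with
    | base => exact ⟨μ, hp, hμ⟩
    | step i w _ ih =>
      obtain ⟨ν, hν, hw⟩ := ih
      refine ⟨ν - α i, hpα i ν hν, fun Y => ?_⟩
      have := LinearMap.congr_fun (hb i Y) w
      simp only [Module.End.mul_apply, LinearMap.add_apply, LinearMap.smul_apply, hw Y, map_smul]
        at this
      rw [this, LinearMap.sub_apply, LinearMap.neg_apply, ← add_smul, sub_eq_add_neg]
  choose wt hp' hwt using fun j => hw (B j) (hB j)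
  exact ⟨B, wt, fun Y j => hwt j Y, hp'⟩

end IsCAR

end WeylChar

namespace WeylChar

/-! ### The spin module and the cubic Dirac operator -/

section Spin

variable {n : ℕ} {H G : RealAlgGroup n} {B : LinearMap.BilinForm ℂ G.lie}

/-- The embedding of `𝔰` into its Clifford algebra. -/
abbrev cl (u : orthCompl H G B) : CliffordAlgebra (cliffordForm H G B) :=
  CliffordAlgebra.ι (cliffordForm H G B) u

theorem cl_mul_add_swap (hs : ∀ X Y, B X Y = B Y X) (u w : orthCompl H G B) :
    cl u * cl w + cl w * cl u =
      algebraMap ℂ (CliffordAlgebra (cliffordForm H G B)) (-2 * B (u : G.lie) (w : G.lie)) := by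
  rw [CliffordAlgebra.ι_mul_ι_add_swap]
  congr 1
  have : ∀ u : orthCompl H G B, cliffordForm H G B u = -B (u : G.lie) (u : G.lie) := fun u => by
    rw [cliffordForm, neg_apply, LinearMap.BilinMap.toQuadraticMap_apply]
    rfl
  simp only [QuadraticMap.polar, this, Submodule.coe_add, map_add, LinearMap.add_apply]
  rw [hs (w : G.lie) u]
  ring

variable {m : ℕ} {Z : Module.Basis (Fin m) ℂ (orthCompl H G B)}

theorem eq_sum_orthonormal (hZ : IsOrthonormalBasis Z) (u : orthCompl H G B) :
    u = ∑ j, B (Z j : G.lie) (u : G.lie) • Z j := by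
  conv_lhs => rw [← Z.sum_repr u]
  refine Finset.sum_congr rfl fun j _ => ?_
  congr 1
  conv_rhs => rw [← Z.sum_repr u]
  rw [Submodule.coe_sum, map_sum]
  simp only [Submodule.coe_smul, map_smul, hZ j, smul_eq_mul]
  simp

theorem B_skew (hinv : ∀ X Y W, B ⁅X, Y⁆ W = B X ⁅Y, W⁆)
    (X U W : G.lie) : B ⁅X, U⁆ W = -B U ⁅X, W⁆ := by
  rw [← lie_skew, map_neg, LinearMap.neg_apply, hinv]

variable (hs : ∀ X Y, B X Y = B Y X) (hinv : ∀ X Y W, B ⁅X, Y⁆ W = B X ⁅Y, W⁆)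
  (hZ : IsOrthonormalBasis Z)

/-- The action of an element of `𝔤` preserving `𝔰`. -/
def adS (X : G.lie) (hX : ∀ u : orthCompl H G B, ⁅X, (u : G.lie)⁆ ∈ orthCompl H G B) :
    orthCompl H G B →ₗ[ℂ] orthCompl H G B where
  toFun u := ⟨⁅X, (u : G.lie)⁆, hX u⟩
  map_add' u w := Subtype.ext (by simp)
  map_smul' c u := Subtype.ext (by simp)

variable {X : G.lie} (hX : ∀ u : orthCompl H G B, ⁅X, (u : G.lie)⁆ ∈ orthCompl H G B)

theorem spinMap_eq (hs : ∀ X Y, B X Y = B Y X) (hZ : IsOrthonormalBasis Z) :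
    spinMap Z X = (-(1 / 4) : ℂ) • ∑ j, cl (adS X hX (Z j)) * cl (Z j) := by
  rw [spinMap]
  congr 1
  refine Finset.sum_congr rfl fun j _ => ?_
  conv_rhs => rw [eq_sum_orthonormal hZ (adS X hX (Z j)), cl, map_sum, Finset.sum_mul]
  refine Finset.sum_congr rfl fun k _ => ?_
  rw [map_smul, smul_mul_assoc, hs]
  rfl

include hs hinv hZ in
/-- The adjoint action of `spinMap X` on vectors is the action of `X` on `𝔰`. -/
theorem spinMap_comm (u : orthCompl H G B) :
    spinMap Z X * cl u = cl u * spinMap Z X + cl (adS X hX u) := by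
  have e1 : ∀ j, cl (adS X hX (Z j)) * cl (Z j) * cl u =
      cl u * (cl (adS X hX (Z j)) * cl (Z j)) +
      ((-2 * B (Z j : G.lie) u) • cl (adS X hX (Z j)) -
        (-2 * B (adS X hX (Z j) : G.lie) u) • cl (Z j)) := by
    intro j
    have h1 := cl_mul_add_swap hs (Z j) u
    have h2 := cl_mul_add_swap hs (adS X hX (Z j)) u
    rw [Algebra.algebraMap_eq_smul_one] at h1 h2
    rw [mul_assoc, eq_sub_of_add_eq h1, mul_sub, ← mul_assoc, ← mul_assoc,
      eq_sub_of_add_eq h2, sub_mul]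
    simp only [mul_smul_comm, smul_mul_assoc, mul_one, one_mul]
    abel
  have e2 : ∑ j, (-2 * B (Z j : G.lie) u) • cl (adS X hX (Z j)) = (-2 : ℂ) • cl (adS X hX u) := by
    conv_rhs => rw [eq_sum_orthonormal hZ u]
    simp only [map_sum, map_smul, Finset.smul_sum, smul_smul]
  have e3 : ∑ j, (-2 * B (adS X hX (Z j) : G.lie) u) • cl (Z j) = (2 : ℂ) • cl (adS X hX u) := by
    conv_rhs => rw [eq_sum_orthonormal hZ (adS X hX u)]
    simp only [map_sum, map_smul, Finset.smul_sum, smul_smul]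
    refine Finset.sum_congr rfl fun j _ => ?_
    congr 1
    change -2 * B ⁅X, (Z j : G.lie)⁆ u = 2 * B (Z j : G.lie) ⁅X, (u : G.lie)⁆
    rw [B_skew hinv]
    ring
  rw [spinMap_eq hX hs hZ, smul_mul_assoc, Finset.sum_mul, Finset.sum_congr rfl fun j _ => e1 j,
    Finset.sum_add_distrib, Finset.sum_sub_distrib, e2, e3, ← Finset.mul_sum, mul_smul_comm,
    smul_add, ← sub_smul, smul_smul]
  norm_num

/-- `spinMap` as a linear map. -/
def spinLin (Z : Module.Basis (Fin m) ℂ (orthCompl H G B)) :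
    G.lie →ₗ[ℂ] CliffordAlgebra (cliffordForm H G B) where
  toFun := spinMap Z
  map_add' X Y := by
    simp only [spinMap, add_lie, map_add, LinearMap.add_apply, add_smul, Finset.sum_add_distrib,
      smul_add]
  map_smul' c X := by
    simp only [spinMap, smul_lie, map_smul, LinearMap.smul_apply, smul_assoc, ← Finset.smul_sum,
      RingHom.id_apply]
    rw [smul_comm]

include hinv hZ in
/-- Elements preserving `𝔰` act skew-symmetrically. -/
theorem sum_adS_skew (hs : ∀ X Y, B X Y = B Y X) {M : Type*} [AddCommGroup M] [Module ℂ M]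
    (β : orthCompl H G B →ₗ[ℂ] orthCompl H G B →ₗ[ℂ] M) :
    ∑ i, (β (adS X hX (Z i)) (Z i) + β (Z i) (adS X hX (Z i))) = 0 := by
  have h1 : ∀ i, adS X hX (Z i) = ∑ l, B (Z l : G.lie) ⁅X, (Z i : G.lie)⁆ • Z l := fun i =>
    eq_sum_orthonormal hZ _
  simp only [h1, map_sum, map_smul, LinearMap.sum_apply, LinearMap.smul_apply]
  rw [Finset.sum_add_distrib, Finset.sum_comm, ← Finset.sum_add_distrib]
  refine Finset.sum_eq_zero fun i _ => ?_
  rw [← Finset.sum_add_distrib]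
  refine Finset.sum_eq_zero fun l _ => ?_
  rw [← add_smul, hs (Z i : G.lie), B_skew hinv, neg_add_cancel, zero_smul]

/-! ### Invariance of the cubic element -/

theorem sum_eq_six_mul_sum_lt {M : Type*} [AddCommMonoid M] (f : Fin m → Fin m → Fin m → M)
    (h1 : ∀ i j k, f j i k = f i j k) (h2 : ∀ i j k, f i k j = f i j k)
    (h0 : ∀ i k, f i i k = 0) :
    ∑ i, ∑ j, ∑ k, f i j k = 6 • ∑ i, ∑ j, ∑ k, if i < j ∧ j < k then f i j k else 0 := by
  have h02 : ∀ i k, f i k k = 0 := fun i k => by rw [← h1, ← h2, h0]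
  have h03 : ∀ i k, f i k i = 0 := fun i k => by rw [← h2, h0]
  have e : ∀ i j k, f i j k = (if i < j ∧ j < k then f i j k else 0) +
      (if i < k ∧ k < j then f i k j else 0) + (if j < i ∧ i < k then f j i k else 0) +
      (if j < k ∧ k < i then f j k i else 0) + (if k < i ∧ i < j then f k i j else 0) +
      (if k < j ∧ j < i then f k j i else 0) := by
    intro i j k
    have p1 := h1 i j k
    have p2 := h2 i j k
    have p3 : f j k i = f i j k := by rw [h2, h1]
    have p4 : f k i j = f i j k := by rw [h1, h2]
    have p5 : f k j i = f i j k := by rw [h2, p4]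
    rw [p1, p2, p3, p4, p5]
    rcases lt_trichotomy i j with hij | rfl | hij
    · rcases lt_trichotomy j k with hjk | rfl | hjk
      · have := hij.trans hjk
        simp [hij, hjk, this, hij.not_gt, hjk.not_gt, this.not_gt]
      · simp [h02]
      · rcases lt_trichotomy i k with hik | rfl | hik
        · simp [hij, hjk, hik, hij.not_gt, hjk.not_gt, hik.not_gt]
        · simp [h03]
        · simp [hij, hjk, hik, hij.not_gt, hjk.not_gt, hik.not_gt]
    · simp [h0]
    · rcases lt_trichotomy j k with hjk | rfl | hjk
      · rcases lt_trichotomy i k with hik | rfl | hik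
        · simp [hij, hjk, hik, hij.not_gt, hjk.not_gt, hik.not_gt]
        · simp [h03]
        · simp [hij, hjk, hik, hij.not_gt, hjk.not_gt, hik.not_gt]
      · simp [h02]
      · have := hjk.trans hij
        simp [hij, hjk, this, hij.not_gt, hjk.not_gt, this.not_gt]
  set g : Fin m → Fin m → Fin m → M := fun i j k => if i < j ∧ j < k then f i j k else 0 with hg
  have e' : ∀ i j k, f i j k = g i j k + g i k j + g j i k + g j k i + g k i j + g k j i := e
  have s1 : ∑ i, ∑ j, ∑ k, g i k j = ∑ i, ∑ j, ∑ k, g i j k :=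
    Finset.sum_congr rfl fun i _ => Finset.sum_comm
  have s2 : ∑ i, ∑ j, ∑ k, g j i k = ∑ i, ∑ j, ∑ k, g i j k := Finset.sum_comm
  have s3 : ∑ i, ∑ j, ∑ k, g j k i = ∑ i, ∑ j, ∑ k, g i j k := by
    rw [Finset.sum_comm]
    exact Finset.sum_congr rfl fun i _ => Finset.sum_comm
  have s4 : ∑ i, ∑ j, ∑ k, g k i j = ∑ i, ∑ j, ∑ k, g i j k := by
    rw [Finset.sum_congr rfl fun i _ => Finset.sum_comm, Finset.sum_comm]
  have s5 : ∑ i, ∑ j, ∑ k, g k j i = ∑ i, ∑ j, ∑ k, g i j k := by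
    rw [Finset.sum_congr rfl fun i _ => Finset.sum_comm, Finset.sum_comm]
    exact Finset.sum_congr rfl fun i _ => Finset.sum_comm
  have e6 : ∑ i, ∑ j, ∑ k, f i j k = 6 • ∑ i, ∑ j, ∑ k, g i j k := by
    rw [Finset.sum_congr rfl fun i _ => Finset.sum_congr rfl fun j _ =>
      Finset.sum_congr rfl fun k _ => e' i j k]
    simp only [Finset.sum_add_distrib]
    rw [s1, s2, s3, s4, s5]
    generalize ∑ i, ∑ j, ∑ k, g i j k = y
    abel
  exact e6

include hs hinv hZ in
/-- The cubic element as an unrestricted sum: its summands are invariant under permutations of the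
indices, as both factors are alternating. -/
theorem cubicElement_eq :
    cubicElement Z = (1 / 12 : ℂ) • ∑ i, ∑ j, ∑ k,
      B ⁅(Z i : G.lie), (Z j : G.lie)⁆ (Z k : G.lie) • (cl (Z i) * cl (Z j) * cl (Z k)) := by
  have hanti : ∀ i j, i ≠ j → cl (Z i) * cl (Z j) = -(cl (Z j) * cl (Z i)) := fun i j hij => by
    have := cl_mul_add_swap hs (Z i) (Z j)
    rw [hZ, if_neg hij, mul_zero, map_zero] at this
    exact eq_neg_of_add_eq_zero_left this
  have hB1 : ∀ i j k, B ⁅(Z j : G.lie), (Z i : G.lie)⁆ (Z k : G.lie) =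
      -B ⁅(Z i : G.lie), (Z j : G.lie)⁆ (Z k : G.lie) := fun i j k => by
    rw [← lie_skew, map_neg, LinearMap.neg_apply]
  have hB2 : ∀ i j k, B ⁅(Z i : G.lie), (Z k : G.lie)⁆ (Z j : G.lie) =
      -B ⁅(Z i : G.lie), (Z j : G.lie)⁆ (Z k : G.lie) := fun i j k => by
    rw [B_skew hinv, hs]
  rw [sum_eq_six_mul_sum_lt, cubicElement, ← Nat.cast_smul_eq_nsmul ℂ, smul_smul]
  · norm_num
  · intro i j k
    rcases eq_or_ne i j with rfl | hij
    · rfl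
    · rw [hB1, hanti i j hij, neg_mul, smul_neg, neg_smul]
  · intro i j k
    rcases eq_or_ne j k with rfl | hjk
    · rfl
    · rw [hB2, mul_assoc, mul_assoc, hanti j k hjk, mul_neg, smul_neg, neg_smul]
  · intro i k
    rw [lie_self, map_zero, LinearMap.zero_apply, zero_smul]

section Skew

variable {E C ι : Type*} [AddCommGroup E] [Module ℂ E] [Ring C] [Algebra ℂ C] [Fintype ι]
  {A : E →ₗ[ℂ] E} {z : ι → E}

/-- Invariance of `∑ t(zᵢ, zⱼ, zₖ) zᵢ zⱼ zₖ` under a derivation `τ` extending a map `A` for which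
`∑ zᵢ ⊗ zᵢ` and the trilinear form `t` are invariant. -/
theorem comm_sum_trilinear {c : E →ₗ[ℂ] C} {τ : C} (hc : ∀ u, τ * c u = c u * τ + c (A u))
    (hsk : ∀ β : E →ₗ[ℂ] E →ₗ[ℂ] C, ∑ i, (β (A (z i)) (z i) + β (z i) (A (z i))) = 0)
    {t : E → E → E → ℂ} (t1 : ∀ y w, IsLinearMap ℂ fun x => t x y w)
    (t2 : ∀ y w, IsLinearMap ℂ fun x => t y x w) (t3 : ∀ y w, IsLinearMap ℂ fun x => t y w x)
    (ht : ∀ x y w, t (A x) y w + t x (A y) w + t x y (A w) = 0) :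
    τ * ∑ i, ∑ j, ∑ k, t (z i) (z j) (z k) • (c (z i) * c (z j) * c (z k)) =
      (∑ i, ∑ j, ∑ k, t (z i) (z j) (z k) • (c (z i) * c (z j) * c (z k))) * τ := by
  have e1 : ∀ x y w, τ * (c x * c y * c w) = c x * c y * c w * τ +
      (c (A x) * c y * c w + c x * c (A y) * c w + c x * c y * c (A w)) := by
    intro x y w
    rw [← mul_assoc, ← mul_assoc, hc, add_mul, add_mul, mul_assoc (c x) τ, hc, mul_add,
      add_mul, ← mul_assoc, mul_assoc _ τ, hc, mul_add, ← mul_assoc]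
    abel
  have s1 : ∑ i, ∑ j, ∑ k, (t (A (z i)) (z j) (z k) • (c (z i) * c (z j) * c (z k)) +
      t (z i) (z j) (z k) • (c (A (z i)) * c (z j) * c (z k))) = 0 := by
    rw [Finset.sum_comm]
    refine Finset.sum_eq_zero fun j _ => ?_
    rw [Finset.sum_comm]
    refine Finset.sum_eq_zero fun k _ => ?_
    exact hsk (LinearMap.mk₂ ℂ (fun x y => t x (z j) (z k) • (c y * c (z j) * c (z k)))
      (fun x x' y => by rw [(t1 _ _).map_add, add_smul])
      (fun r x y => by rw [(t1 _ _).map_smul, smul_assoc])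
      (fun x y y' => by rw [map_add, add_mul, add_mul, smul_add])
      (fun r x y => by rw [map_smul, smul_mul_assoc, smul_mul_assoc, smul_comm]))
  have s2 : ∑ i, ∑ j, ∑ k, (t (z i) (A (z j)) (z k) • (c (z i) * c (z j) * c (z k)) +
      t (z i) (z j) (z k) • (c (z i) * c (A (z j)) * c (z k))) = 0 := by
    refine Finset.sum_eq_zero fun i _ => ?_
    rw [Finset.sum_comm]
    refine Finset.sum_eq_zero fun k _ => ?_
    exact hsk (LinearMap.mk₂ ℂ (fun x y => t (z i) x (z k) • (c (z i) * c y * c (z k)))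
      (fun x x' y => by rw [(t2 _ _).map_add, add_smul])
      (fun r x y => by rw [(t2 _ _).map_smul, smul_assoc])
      (fun x y y' => by rw [map_add, mul_add, add_mul, smul_add])
      (fun r x y => by rw [map_smul, mul_smul_comm, smul_mul_assoc, smul_comm]))
  have s3 : ∑ i, ∑ j, ∑ k, (t (z i) (z j) (A (z k)) • (c (z i) * c (z j) * c (z k)) +
      t (z i) (z j) (z k) • (c (z i) * c (z j) * c (A (z k)))) = 0 := by
    refine Finset.sum_eq_zero fun i _ => Finset.sum_eq_zero fun j _ => ?_
    exact hsk (LinearMap.mk₂ ℂ (fun x y => t (z i) (z j) x • (c (z i) * c (z j) * c y))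
      (fun x x' y => by rw [(t3 _ _).map_add, add_smul])
      (fun r x y => by rw [(t3 _ _).map_smul, smul_assoc])
      (fun x y y' => by rw [map_add, mul_add, smul_add])
      (fun r x y => by rw [map_smul, mul_smul_comm, smul_comm]))
  have h0 := congrArg₂ (· + ·) (congrArg₂ (· + ·) s1 s2) s3
  simp only [add_zero, ← Finset.sum_add_distrib] at h0
  rw [← sub_eq_zero, ← h0]
  simp only [Finset.mul_sum, Finset.sum_mul, ← Finset.sum_sub_distrib]
  refine Finset.sum_congr rfl fun i _ => Finset.sum_congr rfl fun j _ =>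
    Finset.sum_congr rfl fun k _ => ?_
  have h1 := congrArg (· • (c (z i) * c (z j) * c (z k))) (ht (z i) (z j) (z k))
  simp only [zero_smul, add_smul] at h1
  rw [mul_smul_comm, e1, smul_mul_assoc, ← smul_sub, add_sub_cancel_left, smul_add, smul_add,
    ← add_zero (t (z i) (z j) (z k) • _ + _ + _), ← h1]
  abel

/-- An operator `∑ zᵢ ⊗ zᵢ + 1 ⊗ κ` commutes with the diagonal action of a symmetry. -/
theorem comm_sum_tensor {V S : Type*} [AddCommGroup V] [Module ℂ V] [AddCommGroup S] [Module ℂ S]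
    {f : E →ₗ[ℂ] Module.End ℂ V} {c : E →ₗ[ℂ] Module.End ℂ S} {τ κ : Module.End ℂ S}
    {X : Module.End ℂ V} (hf : ∀ u, X * f u = f u * X + f (A u))
    (hc : ∀ u, τ * c u = c u * τ + c (A u)) (hκ : τ * κ = κ * τ)
    (hsk : ∀ β : E →ₗ[ℂ] E →ₗ[ℂ] Module.End ℂ (V ⊗[ℂ] S),
      ∑ i, (β (A (z i)) (z i) + β (z i) (A (z i))) = 0) :
    (TensorProduct.map X LinearMap.id + TensorProduct.map LinearMap.id τ :
        Module.End ℂ (V ⊗[ℂ] S)) *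
        (∑ i, TensorProduct.map (f (z i)) (c (z i)) + TensorProduct.map LinearMap.id κ) =
      (∑ i, TensorProduct.map (f (z i)) (c (z i)) + TensorProduct.map LinearMap.id κ) *
        (TensorProduct.map X LinearMap.id + TensorProduct.map LinearMap.id τ) := by
  have hmul : ∀ (f f' : Module.End ℂ V) (g g' : Module.End ℂ S),
      (TensorProduct.map f g * TensorProduct.map f' g' : Module.End ℂ (V ⊗[ℂ] S)) =
        TensorProduct.map (f * f') (g * g') := fun f f' g g' =>
    (TensorProduct.map_comp f g f' g').symm
  have hid : ∀ f : Module.End ℂ V, LinearMap.id * f = f ∧ f * LinearMap.id = f :=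
    fun f => ⟨rfl, rfl⟩
  have hid' : ∀ f : Module.End ℂ S, LinearMap.id * f = f ∧ f * LinearMap.id = f :=
    fun f => ⟨rfl, rfl⟩
  let β : E →ₗ[ℂ] E →ₗ[ℂ] Module.End ℂ (V ⊗[ℂ] S) :=
    (TensorProduct.mapBilinear (.id ℂ) V S V S).compl₁₂ f c
  have hβ : ∀ x y, β x y = TensorProduct.map (f x) (c y) := fun x y => rfl
  have h1 : ∀ i, (TensorProduct.map X LinearMap.id + TensorProduct.map LinearMap.id τ :
        Module.End ℂ (V ⊗[ℂ] S)) * TensorProduct.map (f (z i)) (c (z i)) =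
      TensorProduct.map (f (z i)) (c (z i)) *
        (TensorProduct.map X LinearMap.id + TensorProduct.map LinearMap.id τ) +
      (β (A (z i)) (z i) + β (z i) (A (z i))) := by
    intro i
    rw [add_mul, mul_add, hmul, hmul, hmul, hmul, (hid _).1, (hid' _).1, (hid _).2, (hid' _).2, hf,
      hc, TensorProduct.map_add_left, TensorProduct.map_add_right, hβ, hβ]
    abel
  rw [mul_add, add_mul (Finset.sum _ _), Finset.mul_sum, Finset.sum_mul,
    Finset.sum_congr rfl fun i _ => h1 i,
    Finset.sum_add_distrib, hsk β, add_zero]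
  congr 1
  rw [add_mul, mul_add, hmul, hmul, hmul, hmul, (hid _).1, (hid' _).1, (hid _).2, (hid' _).2, hκ,
    (hid X).1]

end Skew

include hs hinv hZ hX in
/-- The cubic element is invariant under elements of `𝔤` preserving `𝔰`. -/
theorem spinMap_comm_cubicElement :
    spinMap Z X * cubicElement Z = cubicElement Z * spinMap Z X := by
  rw [cubicElement_eq hs hinv hZ, mul_smul_comm, smul_mul_assoc]
  congr 1
  refine comm_sum_trilinear (spinMap_comm hs hinv hZ hX)
    (fun β => sum_adS_skew hinv hZ hX hs β)
    (t := fun x y z => B ⁅(x : G.lie), (y : G.lie)⁆ (z : G.lie))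
    (fun y w => ⟨fun a b => ?_, fun r a => ?_⟩) (fun y w => ⟨fun a b => ?_, fun r a => ?_⟩)
    (fun y w => ⟨fun a b => ?_, fun r a => ?_⟩) fun x y w => ?_
  · rw [Submodule.coe_add, add_lie, map_add, LinearMap.add_apply]
  · rw [Submodule.coe_smul, smul_lie, map_smul, LinearMap.smul_apply]
  · rw [Submodule.coe_add, lie_add, map_add, LinearMap.add_apply]
  · rw [Submodule.coe_smul, lie_smul, map_smul, LinearMap.smul_apply]
  · rw [Submodule.coe_add, map_add]
  · rw [Submodule.coe_smul, map_smul]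
  · change B ⁅⁅X, (x : G.lie)⁆, (y : G.lie)⁆ (w : G.lie) +
      B ⁅(x : G.lie), ⁅X, (y : G.lie)⁆⁆ (w : G.lie) +
      B ⁅(x : G.lie), (y : G.lie)⁆ ⁅X, (w : G.lie)⁆ = 0
    rw [← LinearMap.add_apply, ← map_add, ← leibniz_lie, B_skew hinv]
    ring

/-- The Clifford action of vectors. -/
def clS (S : SpinModule.{v} (cliffordForm H G B)) : orthCompl H G B →ₗ[ℂ] Module.End ℂ S.S :=
  S.c.toLinearMap ∘ₗ CliffordAlgebra.ι (cliffordForm H G B)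

theorem clS_apply (S : SpinModule.{v} (cliffordForm H G B)) (u : orthCompl H G B) :
    clS S u = S.c (cl u) := rfl

theorem clS_anticomm (S : SpinModule.{v} (cliffordForm H G B)) (hs : ∀ X Y, B X Y = B Y X)
    (u w : orthCompl H G B) : clS S u * clS S w + clS S w * clS S u =
      (-2 * B (u : G.lie) (w : G.lie)) • 1 := by
  have := congrArg S.c (cl_mul_add_swap hs u w)
  rwa [map_add, map_mul, map_mul, AlgHom.commutes, Algebra.algebraMap_eq_smul_one] at this

include hs hinv hZ in
theorem clS_comm (S : SpinModule.{v} (cliffordForm H G B)) (u : orthCompl H G B) :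
    S.c (spinMap Z X) * clS S u = clS S u * S.c (spinMap Z X) + clS S (adS X hX u) := by
  have := congrArg S.c (spinMap_comm hs hinv hZ hX u)
  rwa [map_add, map_mul, map_mul] at this

include hs hinv hZ hX in
/-- The cubic Dirac operator commutes with the action of elements of `𝔤` preserving `𝔰`. -/
theorem diracOp_comm (S : SpinModule.{v} (cliffordForm H G B)) (F : RealRep.{u} G) :
    (TensorProduct.map (F.lieAct X) LinearMap.id +
      TensorProduct.map LinearMap.id (S.c (spinMap Z X)) : Module.End ℂ (F.V ⊗[ℂ] S.S)) *
        diracOp Z S F =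
      diracOp Z S F * (TensorProduct.map (F.lieAct X) LinearMap.id +
        TensorProduct.map LinearMap.id (S.c (spinMap Z X))) := by
  let f : orthCompl H G B →ₗ[ℂ] Module.End ℂ F.V :=
    (F.lieAct : G.lie →ₗ[ℂ] Module.End ℂ F.V) ∘ₗ (orthCompl H G B).subtype
  have hf : ∀ u, F.lieAct X * f u = f u * F.lieAct X + f (adS X hX u) := fun u => by
    have := LieHom.map_lie F.lieAct X (u : G.lie)
    rw [Ring.lie_def, eq_sub_iff_add_eq'] at this
    exact this.symm
  have hκ : S.c (spinMap Z X) * S.c (cubicElement Z) =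
      S.c (cubicElement Z) * S.c (spinMap Z X) := by
    rw [← map_mul, spinMap_comm_cubicElement hs hinv hZ hX, map_mul]
  have h := comm_sum_tensor (z := Z) hf (clS_comm hs hinv hZ hX S) hκ
    fun β => sum_adS_skew hinv hZ hX hs β
  have hf' : ∀ i, f (Z i) = F.lieAct (Z i : G.lie) := fun i => rfl
  simp only [hf', clS_apply] at h
  rw [diracOp]
  exact h

/-! ### The spin module as a Fock space -/

/-- A basis of `𝔰` consisting of two dual bases of isotropic subspaces. -/
structure PolarBasis (H G : RealAlgGroup n) (B : LinearMap.BilinForm ℂ G.lie) (ι : Type*)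
    [Fintype ι] [DecidableEq ι] where
  u : ι → orthCompl H G B
  u' : ι → orthCompl H G B
  B_uu : ∀ i j, B (u i : G.lie) (u j : G.lie) = 0
  B_uu'' : ∀ i j, B (u' i : G.lie) (u' j : G.lie) = 0
  B_uu' : ∀ i j, B (u i : G.lie) (u' j : G.lie) = if i = j then 1 else 0
  eq_sum : ∀ w : orthCompl H G B,
    w = ∑ i, (B (u' i : G.lie) (w : G.lie) • u i + B (u i : G.lie) (w : G.lie) • u' i)

namespace PolarBasis

variable {ι : Type*} [Fintype ι] [DecidableEq ι] (P : PolarBasis H G B ι)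
  (S : SpinModule.{v} (cliffordForm H G B))

/-- Annihilation operators. -/
def a (i : ι) : Module.End ℂ S.S := clS S (P.u i)

/-- Creation operators. -/
def b (i : ι) : Module.End ℂ S.S := (-(1 / 2) : ℂ) • clS S (P.u' i)

theorem isCAR (hs : ∀ X Y, B X Y = B Y X) : IsCAR (P.a S) (P.b S) := by
  have hcl := clS_anticomm S hs
  refine ⟨fun i j => ?_, fun i j => ?_, fun i j => ?_, fun U ha hb => ?_⟩
  · rw [a, a, hcl, P.B_uu, mul_zero, zero_smul]
  · rw [b, b, smul_mul_smul_comm, smul_mul_smul_comm, ← smul_add, hcl, P.B_uu'', mul_zero,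
      zero_smul, smul_zero]
  · rw [a, b, mul_smul_comm, smul_mul_assoc, ← smul_add, hcl, P.B_uu', smul_smul]
    split_ifs
    · norm_num
    · simp
  · have hu : ∀ w, ∀ v ∈ U, clS S w v ∈ U := fun w v hv => by
      rw [P.eq_sum w, map_sum, LinearMap.sum_apply]
      refine Submodule.sum_mem _ fun i _ => ?_
      rw [map_add, map_smul, map_smul, LinearMap.add_apply]
      refine add_mem (Submodule.smul_mem _ _ (ha i v hv)) (Submodule.smul_mem _ _ ?_)
      have := Submodule.smul_mem U (-2 : ℂ) (hb i v hv)
      rw [b, LinearMap.smul_apply, smul_smul] at this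
      simpa using this
    refine S.simple U fun x => ?_
    induction x using CliffordAlgebra.induction with
    | algebraMap r =>
      intro v hv
      rw [AlgHom.commutes, Module.algebraMap_end_apply]
      exact Submodule.smul_mem _ _ hv
    | ι x => exact hu x
    | mul x y hx hy => intro v hv; rw [map_mul]; exact hx _ (hy _ hv)
    | add x y hx hy => intro v hv; rw [map_add]; exact add_mem (hx _ hv) (hy _ hv)

include hZ in
theorem sum_adS (hs : ∀ X Y, B X Y = B Y X) {M : Type*} [AddCommGroup M] [Module ℂ M]
    (β : orthCompl H G B →ₗ[ℂ] orthCompl H G B →ₗ[ℂ] M) :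
    ∑ j, β (adS X hX (Z j)) (Z j) =
      ∑ i, (β (adS X hX (P.u i)) (P.u' i) + β (adS X hX (P.u' i)) (P.u i)) := by
  have h1 : ∀ j, β (adS X hX (Z j)) (Z j) = ∑ i, (B (P.u' i : G.lie) (Z j : G.lie) •
      β (adS X hX (P.u i)) (Z j) + B (P.u i : G.lie) (Z j : G.lie) •
      β (adS X hX (P.u' i)) (Z j)) := fun j => by
    have := congrArg (fun w => β (adS X hX w) (Z j)) (P.eq_sum (Z j))
    simpa only [map_sum, map_add, map_smul, LinearMap.sum_apply, LinearMap.add_apply,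
      LinearMap.smul_apply] using this
  have h2 : ∀ w u : orthCompl H G B, ∑ j, B (u : G.lie) (Z j : G.lie) • β w (Z j) = β w u :=
    fun w u => by
      conv_rhs => rw [eq_sum_orthonormal hZ u]
      simp only [map_sum, map_smul]
      exact Finset.sum_congr rfl fun j _ => by rw [hs]
  rw [Finset.sum_congr rfl fun j _ => h1 j, Finset.sum_comm]
  refine Finset.sum_congr rfl fun i _ => ?_
  rw [Finset.sum_add_distrib, h2, h2]

theorem clS_clS_vacuum (hs : ∀ X Y, B X Y = B Y X) {v : S.S} (hv : ∀ i, P.a S i v = 0) (i : ι) :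
    clS S (P.u i) (clS S (P.u' i) v) = (-2 : ℂ) • v := by
  have h := LinearMap.congr_fun (clS_anticomm S hs (P.u i) (P.u' i)) v
  rw [LinearMap.add_apply, Module.End.mul_apply, Module.End.mul_apply,
    show clS S (P.u i) v = 0 from hv i, map_zero, add_zero, P.B_uu', if_pos rfl, mul_one] at h
  exact h

include hZ hX in
/-- The weight of the vacuum vector. -/
theorem spinMap_vacuum (hs : ∀ X Y, B X Y = B Y X) {α : ι → ℂ}
    (h1 : ∀ i, ⁅X, (P.u i : G.lie)⁆ = α i • (P.u i : G.lie))
    (h2 : ∀ i, ⁅X, (P.u' i : G.lie)⁆ = -α i • (P.u' i : G.lie)) {v : S.S}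
    (hv : ∀ i, P.a S i v = 0) : S.c (spinMap Z X) v = (1 / 2 * ∑ i, α i) • v := by
  let β : orthCompl H G B →ₗ[ℂ] orthCompl H G B →ₗ[ℂ] Module.End ℂ S.S :=
    (LinearMap.mul ℂ (Module.End ℂ S.S)).compl₁₂ (clS S) (clS S)
  have hβ : ∀ x y, β x y = clS S x * clS S y := fun x y => rfl
  have e1 : S.c (spinMap Z X) = (-(1 / 4) : ℂ) • ∑ j, β (adS X hX (Z j)) (Z j) := by
    rw [spinMap_eq hX hs hZ, map_smul, map_sum]
    simp only [map_mul, hβ, clS_apply]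
  have a1 : ∀ i, adS X hX (P.u i) = α i • P.u i := fun i => Subtype.ext (h1 i)
  have a2 : ∀ i, adS X hX (P.u' i) = -α i • P.u' i := fun i => Subtype.ext (h2 i)
  have e2 : ∀ i, (β (adS X hX (P.u i)) (P.u' i) + β (adS X hX (P.u' i)) (P.u i)) v =
      (-2 * α i) • v := fun i => by
    have h3 : clS S (P.u i) v = 0 := hv i
    rw [LinearMap.add_apply, hβ, hβ, Module.End.mul_apply, Module.End.mul_apply, h3, map_zero,
      add_zero, a1, LinearMap.map_smul, LinearMap.smul_apply, P.clS_clS_vacuum S hs hv, smul_smul,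
      mul_comm]
  rw [e1, P.sum_adS hZ hX hs β, LinearMap.smul_apply, LinearMap.sum_apply,
    Finset.sum_congr rfl fun i _ => e2 i, ← Finset.sum_smul, smul_smul, ← Finset.mul_sum]
  congr 1
  ring

end PolarBasis

theorem grading_cl (S : SpinModule.{v} (cliffordForm H G B)) (u : orthCompl H G B) :
    grading S.isCompl * S.c (cl u) = -(S.c (cl u) * grading S.isCompl) := by
  refine end_ext_of_isCompl S.isCompl (fun v hv => ?_) fun v hv => ?_
  · rw [Module.End.mul_apply, grading_right _ (S.map_Sp u v hv), LinearMap.neg_apply,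
      Module.End.mul_apply, grading_left _ hv]
  · rw [Module.End.mul_apply, grading_left _ (S.map_Sm u v hv), LinearMap.neg_apply,
      Module.End.mul_apply, grading_right _ hv, map_neg, neg_neg]

theorem grading_spinMap (S : SpinModule.{v} (cliffordForm H G B)) (X : G.lie) :
    S.c (spinMap Z X) * grading S.isCompl = grading S.isCompl * S.c (spinMap Z X) := by
  have h : ∀ u w : orthCompl H G B, S.c (cl u * cl w) * grading S.isCompl =
      grading S.isCompl * S.c (cl u * cl w) := fun u w => by
    rw [map_mul, ← mul_assoc, grading_cl, neg_mul, mul_assoc (S.c (cl u)) (grading _), grading_cl,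
      mul_neg, neg_neg, mul_assoc]
  simp only [spinMap, map_smul, map_sum, smul_mul_assoc, mul_smul_comm, Finset.sum_mul,
    Finset.mul_sum, h]

end Spin

end WeylChar

namespace WeylChar

/-! ### One-parameter subgroups -/

section OneParam

variable {A : Type*} [NormedRing A] [NormedAlgebra ℝ A] [CompleteSpace A]

theorem eq_of_exp_smul_eq {X Y : A}
    (h : ∀ s : ℝ, NormedSpace.exp (s • X) = NormedSpace.exp (s • Y)) : X = Y := by
  have h1 := hasDerivAt_exp_smul_const (𝕂 := ℝ) X 0
  have h2 := hasDerivAt_exp_smul_const (𝕂 := ℝ) Y 0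
  rw [funext h] at h1
  simpa using h1.unique h2

/-- A continuous one-parameter group in a Banach algebra is given by the exponential function. It is
differentiable because it is a multiple of a difference of its own primitive. -/
theorem exists_exp_of_continuous {p : ℝ → A} (hp : Continuous p) (h0 : p 0 = 1)
    (hadd : ∀ s t, p (s + t) = p s * p t) : ∃ X, ∀ s : ℝ, p s = NormedSpace.exp (s • X) := by
  set P : ℝ → A := fun u => ∫ x in (0 : ℝ)..u, p x with hP
  have hint : ∀ a b, IntervalIntegrable p MeasureTheory.volume a b := fun a b =>
    hp.intervalIntegrable a b
  have hP' : ∀ u, HasDerivAt P (p u) u := fun u =>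
    intervalIntegral.integral_hasDerivAt_right (hint 0 u)
      hp.aestronglyMeasurable.stronglyMeasurableAtFilter hp.continuousAt
  obtain ⟨ε, hε⟩ : ∃ ε : ℝ, IsUnit (P ε) := by
    have h1 := (hP' 0).tendsto_slope
    rw [h0] at h1
    have h2 := h1.eventually (Units.isOpen.mem_nhds (isUnit_one (M := A)))
    obtain ⟨ε, hu, hne⟩ := (h2.and self_mem_nhdsWithin).exists
    refine ⟨ε, ?_⟩
    have h3 : slope P 0 ε = ε⁻¹ • P ε := by simp [slope, hP]
    have h4 : IsUnit (ε⁻¹ • P ε) := h3 ▸ hu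
    have h5 : IsUnit (ε • ε⁻¹ • P ε) := h4.smul (Units.mk0 ε hne)
    rwa [smul_inv_smul₀ hne] at h5
  obtain ⟨w, hw⟩ := hε
  have hshift : ∀ s, p s * P ε = P (s + ε) - P s := by
    intro s
    have h1 : p s * P ε = ∫ x in (0 : ℝ)..ε, p s * p x :=
      (((ContinuousLinearMap.mul ℝ A) (p s)).intervalIntegral_comp_comm (hint 0 ε)).symm
    rw [h1]
    simp only [← hadd]
    rw [intervalIntegral.integral_comp_add_left p s, add_zero, hP]
    exact (intervalIntegral.integral_interval_sub_left (hint _ _) (hint _ _)).symm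
  have hps : ∀ s, p s = (P (s + ε) - P s) * ↑w⁻¹ := fun s => by
    rw [← hshift, ← hw, mul_assoc, Units.mul_inv, mul_one]
  set X := (p ε - 1) * ↑w⁻¹ with hX
  have hd0 : HasDerivAt p X 0 := by
    have h1 : HasDerivAt (fun s => P (s + ε)) (p ε) 0 := by
      have := (hP' (0 + ε)).comp_add_const (0 : ℝ) ε
      simpa using this
    have h2 := (h1.sub (hP' 0)).mul_const (↑w⁻¹ : A)
    rw [h0] at h2
    exact h2.congr_of_eventuallyEq (Eventually.of_forall hps)
  have hd : ∀ s, HasDerivAt p (p s * X) s := fun s => by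
    have h1 : HasDerivAt (fun t => p s * p (t - s)) (p s * X) s := by
      have h2 : HasDerivAt (fun t => p (t - s)) X s := by
        have : HasDerivAt p X (s - s) := by rwa [sub_self]
        exact this.comp_sub_const s s
      exact h2.const_mul (p s)
    exact h1.congr_of_eventuallyEq (Eventually.of_forall fun t => by
      change p t = p s * p (t - s)
      rw [← hadd, add_sub_cancel])
  refine ⟨X, fun s => ?_⟩
  have hq : ∀ s, HasDerivAt (fun s => p s * NormedSpace.exp (s • (-X))) 0 s := fun s => by
    have h1 := (hd s).mul (hasDerivAt_exp_smul_const' (𝕂 := ℝ) (-X) s)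
    refine h1.congr_deriv ?_
    noncomm_ring
  have hconst : p s * NormedSpace.exp (s • (-X)) = 1 := by
    rw [is_const_of_deriv_eq_zero (fun s => (hq s).differentiableAt) (fun s => (hq s).deriv) s 0]
    simp [h0]
  have e : NormedSpace.exp (s • (-X)) * NormedSpace.exp (s • X) = 1 := by
    let _ : NormedAlgebra ℚ A := NormedAlgebra.restrictScalars ℚ ℝ A
    rw [← NormedSpace.exp_add_of_commute (by
      rw [smul_neg]; exact (Commute.refl _).neg_left), smul_neg, neg_add_cancel,
      NormedSpace.exp_zero]
  calc p s = p s * (NormedSpace.exp (s • (-X)) * NormedSpace.exp (s • X)) := by rw [e, mul_one]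
    _ = _ := by rw [← mul_assoc, hconst, one_mul]

end OneParam

/-! ### Real points and the exponential function -/

section RealGroup

variable {n : ℕ}

theorem matrix_eq_of_exp_smul_eq {X Y : Matrix (Fin n) (Fin n) ℂ}
    (h : ∀ s : ℝ, NormedSpace.exp ((s : ℂ) • X) = NormedSpace.exp ((s : ℂ) • Y)) : X = Y := by
  let _ := Matrix.linftyOpNormedRing (n := Fin n) (α := ℂ)
  let _ := Matrix.linftyOpNormedAlgebra (n := Fin n) (R := ℝ) (α := ℂ)
  exact eq_of_exp_smul_eq (A := Matrix (Fin n) (Fin n) ℂ) h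

theorem matrix_exists_exp {p : ℝ → Matrix (Fin n) (Fin n) ℂ} (hp : Continuous p) (h0 : p 0 = 1)
    (hadd : ∀ s t, p (s + t) = p s * p t) :
    ∃ X, ∀ s : ℝ, p s = NormedSpace.exp ((s : ℂ) • X) := by
  let _ := Matrix.linftyOpNormedRing (n := Fin n) (α := ℂ)
  let _ := Matrix.linftyOpNormedAlgebra (n := Fin n) (R := ℝ) (α := ℂ)
  exact exists_exp_of_continuous (A := Matrix (Fin n) (Fin n) ℂ) hp h0 hadd

theorem matrix_hasDerivAt_exp (l : Matrix (Fin n) (Fin n) ℂ →ₗ[ℂ] ℂ)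
    (X : Matrix (Fin n) (Fin n) ℂ) (z : ℂ) :
    HasDerivAt (fun z : ℂ => l (NormedSpace.exp (z • X))) (l (NormedSpace.exp (z • X) * X)) z := by
  let _ := Matrix.linftyOpNormedRing (n := Fin n) (α := ℂ)
  let _ := Matrix.linftyOpNormedAlgebra (n := Fin n) (R := ℂ) (α := ℂ)
  have h := hasDerivAt_exp_smul_const (𝕂 := ℂ) X z
  exact (LinearMap.toContinuousLinearMap l).hasFDerivAt.comp_hasDerivAt z h

/-- Entrywise complex conjugation. -/
def conjM (X : Matrix (Fin n) (Fin n) ℂ) : Matrix (Fin n) (Fin n) ℂ := Xᴴᵀ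

theorem conjM_apply (X : Matrix (Fin n) (Fin n) ℂ) (i j : Fin n) : conjM X i j = star (X i j) := rfl

theorem isRealMatrix_iff {X : Matrix (Fin n) (Fin n) ℂ} : IsRealMatrix X ↔ conjM X = X := by
  rw [← Matrix.ext_iff]
  exact forall_congr' fun i => forall_congr' fun j => Complex.conj_eq_iff_im.symm

theorem exp_conjM (X : Matrix (Fin n) (Fin n) ℂ) :
    NormedSpace.exp (conjM X) = conjM (NormedSpace.exp X) := by
  rw [conjM, Matrix.exp_transpose, Matrix.exp_conjTranspose]; rfl

theorem conjM_add (X Y : Matrix (Fin n) (Fin n) ℂ) : conjM (X + Y) = conjM X + conjM Y := by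
  ext i j; simp [conjM_apply]

theorem conjM_smul (c : ℂ) (X : Matrix (Fin n) (Fin n) ℂ) : conjM (c • X) = star c • conjM X := by
  ext i j; simp [conjM_apply]

theorem conjTranspose_eq_conjM (X : Matrix (Fin n) (Fin n) ℂ) : Xᴴ = (conjM X)ᵀ := rfl

variable (G : RealAlgGroup n)

theorem isReal_of_mem_realPts {g : GL (Fin n) ℂ} (h : g ∈ G.realPts) :
    IsRealMatrix (g : Matrix (Fin n) (Fin n) ℂ) := by
  obtain ⟨_, g, rfl⟩ := h
  intro i j
  simp [Matrix.GeneralLinearGroup.map]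

theorem mem_realPts {g : GL (Fin n) ℂ} (h : g ∈ G.cpts)
    (hr : IsRealMatrix (g : Matrix (Fin n) (Fin n) ℂ)) : g ∈ G.realPts := by
  refine ⟨h, ?_⟩
  let M : Matrix (Fin n) (Fin n) ℝ := fun i j => ((g : Matrix (Fin n) (Fin n) ℂ) i j).re
  have hM : Complex.ofRealHom.mapMatrix M = (g : Matrix (Fin n) (Fin n) ℂ) := by
    ext i j
    exact Complex.ext rfl (by simpa using (hr i j).symm)
  have hdet : M.det ≠ 0 := fun h0 => by
    have h1 : (g : Matrix (Fin n) (Fin n) ℂ).det ≠ 0 :=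
      ((Matrix.isUnit_iff_isUnit_det _).1 g.isUnit).ne_zero
    rw [← hM, ← RingHom.map_det, h0, map_zero] at h1
    exact h1 rfl
  exact ⟨Matrix.GeneralLinearGroup.mkOfDetNeZero M hdet, Units.ext hM⟩

theorem conj_mem_cpts {g : GL (Fin n) ℂ} (h : g ∈ G.cpts) :
    ∃ g' ∈ G.cpts, (g' : Matrix (Fin n) (Fin n) ℂ) = conjM (g : Matrix (Fin n) (Fin n) ℂ) := by
  obtain ⟨P, hP⟩ := G.isAlgebraic
  have hu : IsUnit (conjM (g : Matrix (Fin n) (Fin n) ℂ)) :=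
    (Matrix.isUnit_transpose _).2 ((Matrix.isUnit_conjTranspose _).2 g.isUnit)
  refine ⟨hu.unit, (hP _).2 fun p hp => ?_, hu.unit_spec⟩
  have h1 := congrArg (starRingEnd ℂ) ((hP g).1 h p hp)
  rw [map_zero] at h1
  rw [← h1]
  have h2 := MvPolynomial.comp_aeval_apply (Complex.conjAe : ℂ →ₐ[ℝ] ℂ) (R := ℝ)
    (f := fun ij : Fin n × Fin n => (g : Matrix (Fin n) (Fin n) ℂ) ij.1 ij.2) p
  exact h2.symm

theorem conjM_mem_lie {X : Matrix (Fin n) (Fin n) ℂ} (h : X ∈ G.lie) : conjM X ∈ G.lie := by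
  intro z
  obtain ⟨g, hg, hgX⟩ := h (star z)
  obtain ⟨g', hg', e⟩ := conj_mem_cpts G hg
  refine ⟨g', hg', ?_⟩
  rw [e, hgX, ← exp_conjM, conjM_smul, star_star]

theorem conjTranspose_mem_lie (hG : G.IsSelfAdjoint) {X : Matrix (Fin n) (Fin n) ℂ}
    (h : X ∈ G.lie) : Xᴴ ∈ G.lie := by
  intro z
  obtain ⟨g, hg, hgX⟩ := conjM_mem_lie G h z
  obtain ⟨g', hg', e⟩ := hG g hg
  refine ⟨g', hg', ?_⟩
  rw [e, hgX, conjTranspose_eq_conjM, ← Matrix.transpose_smul, Matrix.exp_transpose]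

/-- Zariski closedness: it suffices to test one-parameter subgroups at real parameters. -/
theorem mem_lie_of_real {X : Matrix (Fin n) (Fin n) ℂ}
    (h : ∀ s : ℝ, ∃ g ∈ G.cpts, (g : Matrix (Fin n) (Fin n) ℂ) = NormedSpace.exp ((s : ℂ) • X)) :
    X ∈ G.lie := by
  obtain ⟨P, hP⟩ := G.isAlgebraic
  intro z
  refine ⟨(Matrix.isUnit_exp (z • X)).unit, (hP _).2 fun p hp => ?_, IsUnit.unit_spec _⟩
  rw [IsUnit.unit_spec]
  let f : ℂ → ℂ := fun z => MvPolynomial.aeval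
    (fun ij : Fin n × Fin n => NormedSpace.exp (z • X) ij.1 ij.2) p
  have hf : Differentiable ℂ f := by
    have hent : ∀ ij : Fin n × Fin n,
        Differentiable ℂ fun z : ℂ => NormedSpace.exp (z • X) ij.1 ij.2 := fun ij z =>
      (matrix_hasDerivAt_exp (Matrix.entryLinearMap ℂ ℂ ij.1 ij.2) X z).differentiableAt
    have key : ∀ p : MvPolynomial (Fin n × Fin n) ℝ, Differentiable ℂ fun z : ℂ => MvPolynomial.aeval
      (fun ij : Fin n × Fin n => NormedSpace.exp (z • X) ij.1 ij.2) p := by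
      intro p
      induction p using MvPolynomial.induction_on with
      | C a => simp
      | add p q hp' hq' => simp only [map_add]; exact hp'.add hq'
      | mul_X p ij hp' =>
        simp only [map_mul, MvPolynomial.aeval_X]
        exact hp'.mul (hent ij)
    exact key p
  have hreal : ∀ s : ℝ, f s = 0 := fun s => by
    obtain ⟨g, hg, e⟩ := h s
    have := (hP g).1 hg p hp
    rw [e] at this
    exact this
  have han : AnalyticOnNhd ℂ f Set.univ := hf.differentiableOn.analyticOnNhd isOpen_univ
  have hz : Tendsto (fun k : ℕ => (k : ℂ)⁻¹) atTop (𝓝[≠] 0) := by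
    refine tendsto_nhdsWithin_iff.2 ⟨tendsto_inv_atTop_nhds_zero_nat, ?_⟩
    filter_upwards [eventually_gt_atTop 0] with k hk
    simp [hk.ne']
  have hfr : ∃ᶠ z in 𝓝[≠] (0 : ℂ), f z = 0 :=
    hz.frequently (Frequently.of_forall fun k => by
      have := hreal ((k : ℝ)⁻¹)
      push_cast at this
      exact this)
  exact han.eqOn_zero_of_preconnected_of_frequently_eq_zero isPreconnected_univ
    (Set.mem_univ 0) hfr (Set.mem_univ z)

theorem exp_mem_realPts {X : Matrix (Fin n) (Fin n) ℂ} (h : X ∈ G.lie) (hr : IsRealMatrix X) :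
    ∃ g : G.realPts, ((g : GL (Fin n) ℂ) : Matrix (Fin n) (Fin n) ℂ) = NormedSpace.exp X := by
  obtain ⟨g, hg, e⟩ := h 1
  rw [one_smul] at e
  refine ⟨⟨g, mem_realPts G hg ?_⟩, e⟩
  rw [isRealMatrix_iff] at hr ⊢
  rw [e, ← exp_conjM, hr]

theorem isReal_smul {X : Matrix (Fin n) (Fin n) ℂ} (hr : IsRealMatrix X) (s : ℝ) :
    IsRealMatrix ((s : ℂ) • X) := fun i j => by
  have := hr i j
  simp [this]

variable {G}

theorem lie_mono {H G : RealAlgGroup n} (h : H.cpts ≤ G.cpts) {X : Matrix (Fin n) (Fin n) ℂ}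
    (hX : X ∈ H.lie) : X ∈ G.lie := fun z => by
  obtain ⟨g, hg, e⟩ := hX z
  exact ⟨g, h hg, e⟩

theorem commute_of_commute_exp {A Y : Matrix (Fin n) (Fin n) ℂ}
    (h : ∀ z : ℂ, A * NormedSpace.exp (z • Y) = NormedSpace.exp (z • Y) * A) : A * Y = Y * A := by
  ext i j
  let e : Matrix (Fin n) (Fin n) ℂ →ₗ[ℂ] ℂ := Matrix.entryLinearMap ℂ ℂ i j
  have h1 := matrix_hasDerivAt_exp (e ∘ₗ LinearMap.mulLeft ℂ A) Y 0
  have h2 := matrix_hasDerivAt_exp (e ∘ₗ LinearMap.mulRight ℂ A) Y 0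
  simp only [LinearMap.comp_apply, LinearMap.mulLeft_apply, LinearMap.mulRight_apply, h] at h1 h2
  simpa [e] using h1.unique h2

variable {T : RealAlgGroup n} (hT : IsCompactMaximalTorus T G)
include hT

theorem lie_torus_comm {X Y : Matrix (Fin n) (Fin n) ℂ} (hX : X ∈ T.lie) (hY : Y ∈ T.lie) :
    X * Y = Y * X := by
  refine commute_of_commute_exp fun w => ?_
  refine (commute_of_commute_exp fun z => ?_).symm
  obtain ⟨a, ha, ea⟩ := hX z
  obtain ⟨b, hb, eb⟩ := hY w
  rw [← ea, ← eb]
  exact congrArg Units.val (hT.comm b hb a ha)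

/-- Every element of the compact torus `T(ℝ)` is the exponential of a real matrix in its Lie
algebra. -/
theorem exists_log (γ : T.realPts) : ∃ X : T.lie, IsRealMatrix (X : Matrix (Fin n) (Fin n) ℂ) ∧
    ((γ : GL (Fin n) ℂ) : Matrix (Fin n) (Fin n) ℂ) =
      NormedSpace.exp (X : Matrix (Fin n) (Fin n) ℂ) := by
  obtain ⟨r, ⟨φ⟩⟩ := hT.compact_torus
  choose a ha using fun k => Circle.exp_surjective (φ γ k)
  let θ : ℝ → Fin r → Circle := fun s k => Circle.exp (s * a k)
  let g : ℝ → T.realPts := fun s => φ.symm (θ s)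
  let p : ℝ → Matrix (Fin n) (Fin n) ℂ := fun s => ((g s : GL (Fin n) ℂ) : Matrix (Fin n) (Fin n) ℂ)
  have hp : Continuous p := by
    have h1 : Continuous θ := by fun_prop
    exact Units.continuous_val.comp (continuous_subtype_val.comp (φ.symm.continuous.comp h1))
  have hθ0 : θ 0 = 1 := by ext k; simp [θ]
  have hθ : ∀ s t, θ (s + t) = θ s * θ t := fun s t => by
    ext k; simp [θ, add_mul, Circle.exp_add]
  have hp0 : p 0 = 1 := by simp [p, g, hθ0]
  have hadd : ∀ s t, p (s + t) = p s * p t := fun s t => by simp [p, g, hθ]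
  obtain ⟨X, hX⟩ := matrix_exists_exp hp hp0 hadd
  have hmem : X ∈ T.lie := mem_lie_of_real T fun s => ⟨g s, (g s).2.1, hX s⟩
  refine ⟨⟨X, hmem⟩, isRealMatrix_iff.2 (matrix_eq_of_exp_smul_eq fun s => ?_), ?_⟩
  · have h1 := isRealMatrix_iff.1 (isReal_of_mem_realPts T (g s).2)
    have h2 : (s : ℂ) • conjM X = conjM ((s : ℂ) • X) := by ext i j; simp [conjM_apply]
    rw [h2, exp_conjM]
    change _ = NormedSpace.exp ((s : ℂ) • X)
    rw [← hX]
    exact h1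
  · have h1 : θ 1 = φ γ := by ext k; simp [θ, ha]
    have h2 : p 1 = NormedSpace.exp X := by simpa using hX 1
    rw [← h2]
    simp [p, g, h1]

theorem exists_bound : ∃ C : ℝ, ∀ γ : T.realPts, ∀ i j,
    ‖((γ : GL (Fin n) ℂ) : Matrix (Fin n) (Fin n) ℂ) i j‖ ≤ C := by
  obtain ⟨r, ⟨φ⟩⟩ := hT.compact_torus
  have : CompactSpace T.realPts := φ.toHomeomorph.symm.compactSpace
  have hc : Continuous fun γ : T.realPts => ((γ : GL (Fin n) ℂ) : Matrix (Fin n) (Fin n) ℂ) :=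
    Units.continuous_val.comp continuous_subtype_val
  choose C hC using fun ij : Fin n × Fin n =>
    (isCompact_univ (X := T.realPts)).exists_bound_of_continuousOn
    (f := fun γ : T.realPts => ((γ : GL (Fin n) ℂ) : Matrix (Fin n) (Fin n) ℂ) ij.1 ij.2)
    (hc.matrix_elem ij.1 ij.2).continuousOn
  refine ⟨∑ ij, |C ij|, fun γ i j =>
    (hC (i, j) γ (Set.mem_univ _)).trans ((le_abs_self _).trans ?_)⟩
  exact Finset.single_le_sum (f := fun ij => |C ij|) (fun _ _ => abs_nonneg _)
    (Finset.mem_univ (i, j))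

end RealGroup

end WeylChar

namespace WeylChar

/-! ### Simultaneous diagonalisation -/

/-- Commuting operators on a finite-dimensional space have a basis of common eigenvectors if the
operators of a set `R` spanning `t`, in the sense that `t = R + iR`, have no Jordan block of size
two. -/
theorem exists_weightBasis_of_semisimple {t V : Type*} [AddCommGroup t] [Module ℂ t]
    [AddCommGroup V] [Module ℂ V] [FiniteDimensional ℂ V] {ρ : t →ₗ[ℂ] Module.End ℂ V}
    (hcomm : ∀ Y Y', Commute (ρ Y) (ρ Y')) {R : Set t}
    (hR : ∀ Y, ∃ A ∈ R, ∃ A' ∈ R, Y = A + Complex.I • A')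
    (hss : ∀ Y ∈ R, ∀ (μ : ℂ) (v u : V), ρ Y v = μ • v + u → ρ Y u = μ • u → u = 0) :
    ∃ (b : Module.Basis (Fin (Module.finrank ℂ V)) ℂ V)
      (wt : Fin (Module.finrank ℂ V) → Module.Dual ℂ t), IsWeightBasis ρ b wt := by
  -- without Jordan blocks of size two, generalised eigenvectors are eigenvectors
  have heig : ∀ Y ∈ R, ∀ (μ : ℂ) (v : V), v ∈ (ρ Y).maxGenEigenspace μ → ρ Y v = μ • v := by
    intro Y hY μ v hv
    obtain ⟨k, hk⟩ := (Module.End.mem_maxGenEigenspace _ _ _).1 hv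
    have hN : ∀ w, (ρ Y - μ • (1 : Module.End ℂ V)) w = ρ Y w - μ • w := fun w => rfl
    have hstep : ∀ k, ((ρ Y - μ • (1 : Module.End ℂ V)) ^ (k + 1)) v = 0 →
        (ρ Y - μ • (1 : Module.End ℂ V)) v = 0 := by
      intro k
      induction k with
      | zero => simp
      | succ k ih =>
        intro h
        refine ih ?_
        rw [pow_succ', pow_succ', Module.End.mul_apply, Module.End.mul_apply] at h
        rw [pow_succ', Module.End.mul_apply]
        refine hss Y hY μ (((ρ Y - μ • (1 : Module.End ℂ V)) ^ k) v) _ ?_ ?_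
        · rw [hN]; abel
        · rw [hN] at h; exact sub_eq_zero.1 h
    rcases k with _ | k
    · rw [pow_zero, Module.End.one_apply] at hk; simp [hk]
    · exact sub_eq_zero.1 (hstep k hk)
  have htop := Module.End.iSup_iInf_maxGenEigenspace_eq_top_of_iSup_maxGenEigenspace_eq_top_of_commute
    (fun Y : R => ρ Y) (fun Y Y' _ => hcomm Y Y') fun Y =>
      Module.End.iSup_maxGenEigenspace_eq_top _
  have hwt : ∀ v : V, (∀ Y ∈ R, ∃ c : ℂ, ρ Y v = c • v) → ∃ μ, v ∈ wspace ρ μ := by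
    intro v hv
    by_cases h0 : v = 0
    · exact ⟨0, by rw [h0]; exact zero_mem _⟩
    obtain ⟨ψ, hψ⟩ := Module.Projective.exists_dual_eq_one ℂ h0
    refine ⟨ψ.comp ((LinearMap.applyₗ v).comp ρ), fun Y => ?_⟩
    obtain ⟨A, hA, A', hA', rfl⟩ := hR Y
    obtain ⟨c, hc⟩ := hv A hA
    obtain ⟨c', hc'⟩ := hv A' hA'
    have e : ρ (A + Complex.I • A') v = (c + Complex.I * c') • v := by
      rw [map_add, map_smul, LinearMap.add_apply, LinearMap.smul_apply, hc, hc', smul_smul, add_smul]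
    change _ = ψ (ρ (A + Complex.I • A') v) • v
    rw [e, map_smul, hψ, smul_eq_mul, mul_one]
  have hspan : Submodule.span ℂ {v | ∃ μ, v ∈ wspace ρ μ} = ⊤ := by
    rw [eq_top_iff, ← htop, iSup_le_iff]
    intro χ v hv
    refine Submodule.subset_span (hwt v fun Y hY => ⟨χ ⟨Y, hY⟩, ?_⟩)
    exact heig Y hY _ v ((Submodule.mem_iInf _).1 hv ⟨Y, hY⟩)
  obtain ⟨b, hb⟩ := exists_weightBasis _ hspan
  choose wt hwt using hb
  exact ⟨b, wt, fun Y i => hwt i Y⟩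

/-! ### The weights of a compact torus in the standard representation -/

section Std

variable {n : ℕ}

/-- The exponential on a Jordan block of size two. -/
theorem exp_mulVec_of_jordan {X : Matrix (Fin n) (Fin n) ℂ} {μ : ℂ} {v u : Fin n → ℂ}
    (hv : X *ᵥ v = μ • v + u) (hu : X *ᵥ u = μ • u) (z : ℂ) :
    NormedSpace.exp (z • X) *ᵥ v = Complex.exp (μ * z) • (v + z • u) := by
  ext i
  let l : (Fin n → ℂ) → Matrix (Fin n) (Fin n) ℂ →ₗ[ℂ] ℂ := fun w =>
    LinearMap.proj i ∘ₗ (Matrix.mulVecBilin ℂ ℂ).flip w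
  have hl : ∀ w M, l w M = (M *ᵥ w) i := fun w M => rfl
  have hd : ∀ w z, HasDerivAt (fun z : ℂ => Complex.exp (-μ * z) * (NormedSpace.exp (z • X) *ᵥ w) i)
      (Complex.exp (-μ * z) * (NormedSpace.exp (z • X) *ᵥ (X *ᵥ w - μ • w)) i) z := by
    intro w z
    have h1 := matrix_hasDerivAt_exp (l w) X z
    have h2 : HasDerivAt (fun z : ℂ => Complex.exp (-μ * z)) (Complex.exp (-μ * z) * -μ) z := by
      simpa using ((hasDerivAt_id z).const_mul (-μ)).cexp
    refine (h2.mul h1).congr_deriv ?_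
    rw [hl, hl, Matrix.mulVec_sub, Matrix.mulVec_smul, Matrix.mulVec_mulVec, Pi.sub_apply,
      Pi.smul_apply, smul_eq_mul]
    ring
  have hU : ∀ z : ℂ, Complex.exp (-μ * z) * (NormedSpace.exp (z • X) *ᵥ u) i = u i := by
    intro z
    have h1 : ∀ z, HasDerivAt (fun z : ℂ => Complex.exp (-μ * z) *
        (NormedSpace.exp (z • X) *ᵥ u) i) 0 z := fun z => by
      simpa [hu] using hd u z
    have := is_const_of_deriv_eq_zero (fun z => (h1 z).differentiableAt) (fun z => (h1 z).deriv) z 0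
    simpa using this
  have hV : Complex.exp (-μ * z) * (NormedSpace.exp (z • X) *ᵥ v) i = v i + z * u i := by
    have h1 : ∀ z, HasDerivAt (fun z : ℂ => Complex.exp (-μ * z) *
        (NormedSpace.exp (z • X) *ᵥ v) i - z * u i) 0 z := fun z => by
      have h2 := hd v z
      rw [hv, add_sub_cancel_left, hU] at h2
      have h3 : HasDerivAt (fun z : ℂ => z * u i) (1 * u i) z := (hasDerivAt_id z).mul_const (u i)
      exact (h2.fun_sub h3).congr_deriv (by ring)
    have := is_const_of_deriv_eq_zero (fun z => (h1 z).differentiableAt) (fun z => (h1 z).deriv) z 0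
    simp only [mul_zero, Complex.exp_zero, zero_smul, NormedSpace.exp_zero, Matrix.one_mulVec,
      one_mul, zero_mul, sub_zero] at this
    rw [← this]; ring
  rw [Pi.smul_apply, Pi.add_apply, Pi.smul_apply, smul_eq_mul, smul_eq_mul, ← hV, ← mul_assoc,
    ← Complex.exp_add]
  simp

theorem eq_zero_of_bounded {r c C : ℝ} (hc : 0 < c) (h : ∀ s : ℝ, (1 + s * r) * c ≤ C) : r = 0 := by
  by_contra hr
  have := h (C / (c * r))
  have e : (1 + C / (c * r) * r) * c = c + C := by field_simp
  linarith

variable {T G : RealAlgGroup n} (hT : IsCompactMaximalTorus T G)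
include hT

theorem exists_bound_mulVec {X : Matrix (Fin n) (Fin n) ℂ} (hX : X ∈ T.lie) (hr : IsRealMatrix X)
    (v : Fin n → ℂ) : ∃ C : ℝ, ∀ (s : ℝ) i, ‖(NormedSpace.exp ((s : ℂ) • X) *ᵥ v) i‖ ≤ C := by
  obtain ⟨C, hC⟩ := exists_bound hT
  refine ⟨∑ j, C * ‖v j‖, fun s i => ?_⟩
  obtain ⟨g, hg⟩ := exp_mem_realPts T (T.lie.smul_mem (s : ℂ) hX) (isReal_smul hr s)
  rw [← hg]
  refine (norm_sum_le Finset.univ fun j => ((g : GL (Fin n) ℂ) : Matrix (Fin n) (Fin n) ℂ) i j *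
    v j).trans (Finset.sum_le_sum fun j _ => ?_)
  rw [norm_mul]
  exact mul_le_mul_of_nonneg_right (hC g i j) (norm_nonneg _)

/-- Real elements of the Lie algebra of a compact torus have imaginary eigenvalues, as the
one-parameter groups that they generate are bounded. -/
theorem eigenvalue_re {X : Matrix (Fin n) (Fin n) ℂ} (hX : X ∈ T.lie) (hr : IsRealMatrix X)
    {u : Fin n → ℂ} (hu : u ≠ 0) {μ : ℂ} (h : X *ᵥ u = μ • u) : μ.re = 0 := by
  obtain ⟨C, hC⟩ := exists_bound_mulVec hT hX hr u
  obtain ⟨i, hi⟩ := Function.ne_iff.1 hu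
  refine eq_zero_of_bounded (C := C) (norm_pos_iff.2 hi) fun s => (le_trans ?_ (hC s i))
  rw [exp_mulVec_of_jordan (u := 0) (by rw [h, add_zero]) (by simp)]
  simp only [smul_zero, add_zero, Pi.smul_apply, smul_eq_mul, norm_mul, Complex.norm_exp]
  refine mul_le_mul_of_nonneg_right ?_ (norm_nonneg _)
  have := Real.add_one_le_exp ((μ * (s : ℂ)).re)
  simp only [Complex.re_mul_ofReal] at this ⊢
  linarith

/-- Real elements of the Lie algebra of a compact torus are semisimple, as the one-parameter groups
that they generate are bounded. -/
theorem no_jordan {X : Matrix (Fin n) (Fin n) ℂ} (hX : X ∈ T.lie) (hr : IsRealMatrix X)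
    {v u : Fin n → ℂ} {μ : ℂ} (hv : X *ᵥ v = μ • v + u) (hu : X *ᵥ u = μ • u) : u = 0 := by
  by_contra h0
  have hμ := eigenvalue_re hT hX hr h0 hu
  obtain ⟨C, hC⟩ := exists_bound_mulVec hT hX hr v
  obtain ⟨i, hi⟩ := Function.ne_iff.1 h0
  have hp : 0 < ‖u i‖ := norm_pos_iff.2 hi
  have h1 : ∀ s : ℝ, ‖v i + s * u i‖ ≤ C := fun s => by
    have := hC s i
    rw [exp_mulVec_of_jordan hv hu] at this
    simpa [Complex.norm_exp, hμ] using this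
  refine one_ne_zero (α := ℝ) (eq_zero_of_bounded (C := C + ‖v i‖ + ‖u i‖) hp fun s => ?_)
  have h2 : ‖(s : ℂ) * u i‖ ≤ C + ‖v i‖ := by
    have := norm_sub_le (v i + s * u i) (v i)
    rw [add_sub_cancel_left] at this
    linarith [h1 s]
  rw [norm_mul, Complex.norm_real, Real.norm_eq_abs] at h2
  have h3 : s * ‖u i‖ ≤ |s| * ‖u i‖ := mul_le_mul_of_nonneg_right (le_abs_self s) hp.le
  linarith

end Std

/-- The trace form `tr(XY)`. -/
def trForm (n : ℕ) : LinearMap.BilinForm ℂ (Matrix (Fin n) (Fin n) ℂ) :=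
  LinearMap.mk₂ ℂ (fun X Y => Matrix.trace (X * Y)) (fun X X' Y => by rw [add_mul, Matrix.trace_add])
    (fun c X Y => by rw [smul_mul_assoc, Matrix.trace_smul])
    (fun X Y Y' => by rw [mul_add, Matrix.trace_add])
    (fun c X Y => by rw [mul_smul_comm, Matrix.trace_smul])

theorem trForm_apply {n : ℕ} (X Y : Matrix (Fin n) (Fin n) ℂ) :
    trForm n X Y = Matrix.trace (X * Y) := rfl

theorem trForm_symm {n : ℕ} (X Y : Matrix (Fin n) (Fin n) ℂ) : trForm n X Y = trForm n Y X :=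
  Matrix.trace_mul_comm X Y

theorem trForm_inv {n : ℕ} (X Y W : Matrix (Fin n) (Fin n) ℂ) :
    trForm n ⁅X, Y⁆ W = trForm n X ⁅Y, W⁆ := by
  simp only [trForm_apply, Ring.lie_def, sub_mul, mul_sub, Matrix.trace_sub]
  rw [mul_assoc, ← mul_assoc X W Y, Matrix.trace_mul_comm (X * W) Y, mul_assoc Y X W]

/-- The standard representation of the Lie algebra of `T`. -/
def stdAct {n : ℕ} (T : RealAlgGroup n) : T.lie →ₗ[ℂ] Module.End ℂ (Fin n → ℂ) :=
  Matrix.toLin'.toLinearMap ∘ₗ T.lie.toSubmodule.subtype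

theorem stdAct_apply {n : ℕ} (T : RealAlgGroup n) (Y : T.lie) (v : Fin n → ℂ) :
    stdAct T Y v = (Y : Matrix (Fin n) (Fin n) ℂ) *ᵥ v := rfl

/-- The conjugation `Y ↦ -Ȳ` of the complexified Lie algebra of `T`, which fixes `i Lie T(ℝ)`. -/
def conjT {n : ℕ} {T : RealAlgGroup n} (Y : T.lie) : T.lie :=
  ⟨-conjM (Y : Matrix (Fin n) (Fin n) ℂ), neg_mem (conjM_mem_lie T Y.2)⟩

/-- The facts about the compact torus `T(ℝ)` that are needed for the root decomposition: the
standard representation is diagonalised by a basis `b` with weights `ε`, which are imaginary on the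
Lie algebra of `T(ℝ)`, and the trace form is non-degenerate on the Lie algebra. -/
structure TorusData {n : ℕ} (T : RealAlgGroup n) where
  N : ℕ
  b : Module.Basis (Fin N) ℂ (Fin n → ℂ)
  ε : Fin N → Module.Dual ℂ T.lie
  hb : IsWeightBasis (stdAct T) b ε
  ε_conj : ∀ k Y, ε k (conjT Y) = star (ε k Y)
  comm : ∀ X ∈ T.lie, ∀ Y ∈ T.lie, X * Y = Y * X
  tt : Module.Dual ℂ T.lie →ₗ[ℂ] T.lie
  tr_tt : ∀ μ (Y : T.lie), trForm n (tt μ) Y = μ Y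

section TorusData

variable {n : ℕ} {T G : RealAlgGroup n}

/-- The trace form on `𝔱` in terms of the weights of the standard representation. -/
theorem trace_mul_eq {N : ℕ} {b : Module.Basis (Fin N) ℂ (Fin n → ℂ)}
    {ε : Fin N → Module.Dual ℂ T.lie} (hb : IsWeightBasis (stdAct T) b ε) (Y Y' : T.lie) :
    trForm n Y Y' = ∑ k, ε k Y * ε k Y' := by
  classical
  rw [trForm_apply, ← Matrix.trace_toLin'_eq, LinearMap.trace_eq_matrix_trace ℂ b, Matrix.trace]
  refine Finset.sum_congr rfl fun k _ => ?_
  rw [Matrix.diag_apply, LinearMap.toMatrix_apply, Matrix.toLin'_mul]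
  change b.repr (stdAct T Y (stdAct T Y' (b k))) k = _
  rw [hb, map_smul, hb]
  simp [mul_comm]

theorem eq_zero_of_eps {N : ℕ} {b : Module.Basis (Fin N) ℂ (Fin n → ℂ)}
    {ε : Fin N → Module.Dual ℂ T.lie} (hb : IsWeightBasis (stdAct T) b ε) {Y : T.lie}
    (h : ∀ k, ε k Y = 0) : Y = 0 := by
  have h1 : stdAct T Y = 0 := b.ext fun k => by rw [hb, h, zero_smul]; rfl
  exact Subtype.ext (Matrix.toLin'.map_eq_zero_iff.1 h1)

/-- The trace form is non-degenerate on `𝔱`: pairing `Y` with its conjugate gives `∑ |ε k Y|²`. -/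
theorem eq_zero_of_trace {N : ℕ} {b : Module.Basis (Fin N) ℂ (Fin n → ℂ)}
    {ε : Fin N → Module.Dual ℂ T.lie} (hb : IsWeightBasis (stdAct T) b ε)
    (hc : ∀ k Y, ε k (conjT Y) = star (ε k Y)) {Y : T.lie}
    (h : ∀ Z : T.lie, trForm n Y Z = 0) : Y = 0 := by
  refine eq_zero_of_eps hb fun k => ?_
  have h1 := h (conjT Y)
  rw [trace_mul_eq hb] at h1
  have h2 : ∑ k, Complex.normSq (ε k Y) = 0 := by
    have : ((∑ k, Complex.normSq (ε k Y) : ℝ) : ℂ) = 0 := by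
      rw [← h1]
      push_cast
      refine Finset.sum_congr rfl fun k _ => ?_
      rw [hc]
      exact Complex.normSq_eq_conj_mul_self.trans (mul_comm _ _)
    exact_mod_cast this
  have := (Finset.sum_eq_zero_iff_of_nonneg fun k _ => Complex.normSq_nonneg _).1 h2 k
    (Finset.mem_univ k)
  exact Complex.normSq_eq_zero.1 this

/-- Decomposition of the complex Lie algebra into its real form and `i` times the real form. -/
theorem exists_real_decomp (Y : T.lie) : ∃ A : T.lie, IsRealMatrix (A : Matrix (Fin n) (Fin n) ℂ) ∧
    ∃ A' : T.lie, IsRealMatrix (A' : Matrix (Fin n) (Fin n) ℂ) ∧ Y = A + Complex.I • A' := by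
  let Yc : T.lie := ⟨conjM (Y : Matrix (Fin n) (Fin n) ℂ), conjM_mem_lie T Y.2⟩
  refine ⟨(1 / 2 : ℂ) • (Y + Yc), ?_, (-Complex.I / 2 : ℂ) • (Y - Yc), ?_, ?_⟩
  · intro i j
    change (((1 / 2 : ℂ) • ((Y : Matrix (Fin n) (Fin n) ℂ) +
      conjM (Y : Matrix (Fin n) (Fin n) ℂ)) : Matrix (Fin n) (Fin n) ℂ) i j).im = 0
    simp [conjM_apply]
  · intro i j
    change (((-Complex.I / 2 : ℂ) • ((Y : Matrix (Fin n) (Fin n) ℂ) -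
      conjM (Y : Matrix (Fin n) (Fin n) ℂ)) : Matrix (Fin n) (Fin n) ℂ) i j).im = 0
    simp [conjM_apply]
  · rw [smul_smul]
    have : Complex.I * (-Complex.I / 2) = 1 / 2 := by
      linear_combination (-1 / 2 : ℂ) * Complex.I_mul_I
    rw [this]
    module

theorem exists_torusData (hT : IsCompactMaximalTorus T G) : Nonempty (TorusData T) := by
  obtain ⟨b, ε, hb⟩ := exists_weightBasis_of_semisimple (ρ := stdAct T)
    (R := {A | IsRealMatrix (A : Matrix (Fin n) (Fin n) ℂ)})
    (fun Y Y' => by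
      have := congrArg Matrix.toLin' (lie_torus_comm hT Y.2 Y'.2)
      rwa [Matrix.toLin'_mul, Matrix.toLin'_mul] at this)
    exists_real_decomp (fun Y hY μ v u hv hu => no_jordan hT Y.2 hY hv hu)
  have hre : ∀ k (A : T.lie), IsRealMatrix (A : Matrix (Fin n) (Fin n) ℂ) → (ε k A).re = 0 :=
    fun k A hA => eigenvalue_re hT A.2 hA (b.ne_zero k) (hb A k)
  have hc : ∀ k (Y : T.lie), ε k (conjT Y) = star (ε k Y) := by
    intro k Y
    obtain ⟨A, hA, A', hA', rfl⟩ := exists_real_decomp Y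
    have e : conjT (A + Complex.I • A') = -A + Complex.I • A' := by
      apply Subtype.ext
      change -conjM ((A : Matrix (Fin n) (Fin n) ℂ) + Complex.I • (A' : Matrix (Fin n) (Fin n) ℂ)) =
        -(A : Matrix (Fin n) (Fin n) ℂ) + Complex.I • (A' : Matrix (Fin n) (Fin n) ℂ)
      rw [conjM_add, conjM_smul, isRealMatrix_iff.1 hA, isRealMatrix_iff.1 hA']
      simp [add_comm]
    have h1 := hre k A hA
    have h2 := hre k A' hA'
    rw [e, map_add, map_add, map_neg, map_smul]
    apply Complex.ext <;> simp [h1, h2]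
  let κ : T.lie →ₗ[ℂ] Module.Dual ℂ T.lie :=
    (trForm n).compl₁₂ T.lie.toSubmodule.subtype T.lie.toSubmodule.subtype
  have hinj : Function.Injective κ := by
    rw [← LinearMap.ker_eq_bot, LinearMap.ker_eq_bot']
    exact fun Y hY => eq_zero_of_trace hb hc fun Z => LinearMap.congr_fun hY Z
  let e := LinearEquiv.ofInjectiveOfFinrankEq κ hinj (Subspace.dual_finrank_eq).symm
  refine ⟨⟨_, b, ε, hb, hc, fun X hX Y hY => lie_torus_comm hT hX hY,
    e.symm.toLinearMap, fun μ Y => ?_⟩⟩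
  change κ (e.symm μ) Y = μ Y
  have : κ (e.symm μ) = e (e.symm μ) := rfl
  rw [this, LinearEquiv.apply_symm_apply]

end TorusData

end WeylChar

namespace WeylChar

/-! ### The root decomposition -/

/-- `𝔱` is a Cartan subalgebra of the self-adjoint Lie algebra `𝔤`. -/
structure IsCartanIn {n : ℕ} (T G : RealAlgGroup n) : Prop where
  le : ∀ X ∈ T.lie, X ∈ G.lie
  cartan : ∀ X ∈ G.lie, (∀ Y ∈ T.lie, ⁅Y, X⁆ = 0) → X ∈ T.lie
  adj : ∀ X ∈ G.lie, Xᴴ ∈ G.lie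

section Roots

variable {n : ℕ} {T G : RealAlgGroup n} (hC : IsCartanIn T G)

/-- The inclusion of `𝔱` in `𝔤`. -/
def inc : T.lie →ₗ[ℂ] G.lie where
  toFun Y := ⟨Y, hC.le Y Y.2⟩
  map_add' _ _ := rfl
  map_smul' _ _ := rfl

/-- The adjoint action of `𝔱` on `𝔤`. -/
def adT : T.lie →ₗ[ℂ] Module.End ℂ G.lie := (LieAlgebra.ad ℂ G.lie : G.lie →ₗ[ℂ] _) ∘ₗ inc hC

theorem adT_apply (Y : T.lie) (X : G.lie) : adT hC Y X = ⁅inc hC Y, X⁆ := rfl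

theorem mem_rootSpace_iff {α : Module.Dual ℂ T.lie} {X : Matrix (Fin n) (Fin n) ℂ} :
    X ∈ rootSpace G.lie T.lie α ↔ ∃ h : X ∈ G.lie, (⟨X, h⟩ : G.lie) ∈ wspace (adT hC) α :=
  ⟨fun h => ⟨h.1, fun Y => Subtype.ext (h.2 Y)⟩, fun ⟨h, h'⟩ =>
    ⟨h, fun Y => congrArg Subtype.val (h' Y)⟩⟩

/-- The trace form on `𝔤`. -/
def trG (G : RealAlgGroup n) : LinearMap.BilinForm ℂ G.lie :=
  (trForm n).compl₁₂ G.lie.toSubmodule.subtype G.lie.toSubmodule.subtype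

theorem trG_symm (X Y : G.lie) : trG G X Y = trG G Y X := trForm_symm _ _

theorem trG_inv (X Y W : G.lie) : trG G ⁅X, Y⁆ W = trG G X ⁅Y, W⁆ := trForm_inv _ _ _

/-- The coefficients of a matrix in the basis of weight vectors. -/
theorem repr_lie (D : TorusData T) (Y : T.lie) (X : Matrix (Fin n) (Fin n) ℂ) (k l : Fin D.N) :
    D.b.repr (⁅(Y : Matrix (Fin n) (Fin n) ℂ), X⁆ *ᵥ D.b l) k =
      (D.ε k - D.ε l) Y * D.b.repr (X *ᵥ D.b l) k := by
  have h1 : (Y : Matrix (Fin n) (Fin n) ℂ) *ᵥ D.b l = D.ε l Y • D.b l := D.hb Y l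
  have h2 := D.hb.repr_apply Y (X *ᵥ D.b l) k
  rw [stdAct_apply] at h2
  rw [Ring.lie_def, Matrix.sub_mulVec, ← Matrix.mulVec_mulVec, ← Matrix.mulVec_mulVec, h1,
    Matrix.mulVec_smul, map_sub, map_smul, Finsupp.sub_apply, Finsupp.smul_apply, h2,
    LinearMap.sub_apply, smul_eq_mul]
  ring

theorem eq_zero_of_repr (D : TorusData T) {X : Matrix (Fin n) (Fin n) ℂ}
    (h : ∀ k l, D.b.repr (X *ᵥ D.b l) k = 0) : X = 0 := by
  have h1 : Matrix.toLin' X = 0 := D.b.ext fun l => D.b.repr.injective (by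
    rw [LinearMap.zero_apply, map_zero]
    exact Finsupp.ext fun k => h k l)
  exact Matrix.toLin'.map_eq_zero_iff.1 h1

include hC in
/-- The adjoint action of `𝔱` on `𝔤` is diagonalisable, as it acts diagonally on all matrices by the
differences `ε k - ε l`. -/
theorem exists_adT_weightBasis (D : TorusData T) :
    ∃ (b : Module.Basis (Fin (Module.finrank ℂ G.lie)) ℂ G.lie)
      (wt : Fin (Module.finrank ℂ G.lie) → Module.Dual ℂ T.lie), IsWeightBasis (adT hC) b wt := by
  refine exists_weightBasis_of_semisimple (R := Set.univ) (fun Y Y' => ?_)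
    (fun Y => ⟨Y, trivial, 0, trivial, by simp⟩) fun Y _ μ v u hv hu => ?_
  · have h : ⁅inc hC Y, inc hC Y'⁆ = 0 := Subtype.ext (by
      change ⁅(Y : Matrix (Fin n) (Fin n) ℂ), (Y' : Matrix (Fin n) (Fin n) ℂ)⁆ = 0
      rw [Ring.lie_def, D.comm Y Y.2 Y' Y'.2, sub_self])
    have h2 := LieHom.map_lie (LieAlgebra.ad ℂ G.lie) (inc hC Y) (inc hC Y')
    rw [h, map_zero, Ring.lie_def] at h2
    exact (sub_eq_zero.1 h2.symm)
  · have hv' := congrArg Subtype.val hv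
    have hu' := congrArg Subtype.val hu
    change ⁅(Y : Matrix (Fin n) (Fin n) ℂ), (v : Matrix (Fin n) (Fin n) ℂ)⁆ =
      μ • (v : Matrix (Fin n) (Fin n) ℂ) + (u : Matrix (Fin n) (Fin n) ℂ) at hv'
    change ⁅(Y : Matrix (Fin n) (Fin n) ℂ), (u : Matrix (Fin n) (Fin n) ℂ)⁆ =
      μ • (u : Matrix (Fin n) (Fin n) ℂ) at hu'
    refine Subtype.ext (eq_zero_of_repr D fun k l => ?_)
    have e1 := repr_lie D Y v k l
    have e2 := repr_lie D Y u k l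
    rw [hv', Matrix.add_mulVec, Matrix.smul_mulVec, map_add, map_smul, Finsupp.add_apply,
      Finsupp.smul_apply, smul_eq_mul] at e1
    rw [hu', Matrix.smul_mulVec, map_smul, Finsupp.smul_apply, smul_eq_mul] at e2
    have e3 : ((D.ε k - D.ε l) Y - μ) * D.b.repr ((u : Matrix (Fin n) (Fin n) ℂ) *ᵥ D.b l) k =
        0 := by
      linear_combination -e2
    rcases mul_eq_zero.1 e3 with h | h
    · rw [sub_eq_zero] at h
      rw [h] at e1
      linear_combination e1
    · exact h

/-- A basis of `𝔤` consisting of weight vectors. -/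
def rootBasis (D : TorusData T) : Module.Basis (Fin (Module.finrank ℂ G.lie)) ℂ G.lie :=
  (exists_adT_weightBasis hC D).choose

/-- The weights of `𝔱` in `𝔤`, with multiplicities. -/
def rootWt (D : TorusData T) : Fin (Module.finrank ℂ G.lie) → Module.Dual ℂ T.lie :=
  (exists_adT_weightBasis hC D).choose_spec.choose

theorem rootBasis_spec (D : TorusData T) :
    IsWeightBasis (adT hC) (rootBasis hC D) (rootWt hC D) :=
  (exists_adT_weightBasis hC D).choose_spec.choose_spec

open Classical in
/-- The finite set of roots. -/
def rootFinset (D : TorusData T) : Finset (Module.Dual ℂ T.lie) :=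
  (Finset.univ.image (rootWt hC D)).erase 0

theorem mem_rootFinset (D : TorusData T) {α : Module.Dual ℂ T.lie} :
    α ∈ rootFinset hC D ↔ α ≠ 0 ∧ ∃ X ∈ wspace (adT hC) α, X ≠ 0 := by
  classical
  rw [rootFinset, Finset.mem_erase, Finset.mem_image]
  refine and_congr_right fun _ => ⟨?_, ?_⟩
  · rintro ⟨i, -, rfl⟩
    exact ⟨rootBasis hC D i, fun Y => rootBasis_spec hC D Y i, (rootBasis hC D).ne_zero i⟩
  · rintro ⟨X, hX, h0⟩
    obtain ⟨i, hi⟩ := (rootBasis_spec hC D).exists_wt hX h0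
    exact ⟨i, Finset.mem_univ i, hi⟩

theorem mem_rootFinset_iff_roots (D : TorusData T) {α : Module.Dual ℂ T.lie} :
    α ∈ rootFinset hC D ↔ α ∈ roots G.lie T.lie := by
  rw [mem_rootFinset, roots, Set.mem_ofPred_eq, Submodule.ne_bot_iff]
  refine and_congr_right fun _ => ⟨?_, ?_⟩
  · rintro ⟨X, hX, h0⟩
    exact ⟨X, (mem_rootSpace_iff hC).2 ⟨X.2, hX⟩, fun h => h0 (Subtype.ext h)⟩
  · rintro ⟨X, hX, h0⟩
    obtain ⟨h, h'⟩ := (mem_rootSpace_iff hC).1 hX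
    exact ⟨_, h', fun h => h0 (congrArg Subtype.val h)⟩

include hC in
/-- Roots are differences of weights of the standard representation. -/
theorem exists_eps_sub (D : TorusData T) {α : Module.Dual ℂ T.lie} {X : G.lie}
    (hX : X ∈ wspace (adT hC) α) (h0 : X ≠ 0) : ∃ k l, α = D.ε k - D.ε l := by
  by_contra! hne
  refine h0 (Subtype.ext (eq_zero_of_repr D fun k l => ?_))
  by_contra hkl
  refine hne k l (LinearMap.ext fun Y => ?_)
  have e := repr_lie D Y X k l
  have hX' : ⁅(Y : Matrix (Fin n) (Fin n) ℂ), (X : Matrix (Fin n) (Fin n) ℂ)⁆ =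
    α Y • (X : Matrix (Fin n) (Fin n) ℂ) := congrArg Subtype.val (hX Y)
  rw [hX', Matrix.smul_mulVec, map_smul, Finsupp.smul_apply, smul_eq_mul] at e
  exact mul_right_cancel₀ hkl e

/-- The real span of the weights: functionals that are real on the fixed points of `conjT`. -/
def realWts (T : RealAlgGroup n) : AddSubgroup (Module.Dual ℂ T.lie) where
  carrier := {μ | ∀ Y, μ (conjT Y) = star (μ Y)}
  add_mem' := fun {μ ν} h h' Y => by simp [h Y, h' Y]
  zero_mem' := fun Y => by simp
  neg_mem' := fun {μ} h Y => by simp [h Y]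

include hC in
theorem root_mem_realWts (D : TorusData T) {α : Module.Dual ℂ T.lie} (h : α ∈ rootFinset hC D) :
    α ∈ realWts T := by
  obtain ⟨_, X, hX, h0⟩ := (mem_rootFinset hC D).1 h
  obtain ⟨k, l, rfl⟩ := exists_eps_sub hC D hX h0
  exact sub_mem (S := AddSubgroup _) (fun Y => D.ε_conj k Y) (fun Y => D.ε_conj l Y)

namespace TorusData

variable (D : TorusData T)

/-- The form on `𝔱*` dual to the trace form. -/
def form : LinearMap.BilinForm ℂ (Module.Dual ℂ T.lie) := Module.Dual.eval ℂ T.lie ∘ₗ D.tt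

theorem form_apply (μ ν : Module.Dual ℂ T.lie) : D.form μ ν = ν (D.tt μ) := rfl

theorem form_eq_tr (μ ν : Module.Dual ℂ T.lie) : D.form μ ν = trForm n (D.tt μ) (D.tt ν) := by
  rw [form_apply, trForm_symm, D.tr_tt]

theorem form_symm (μ ν : Module.Dual ℂ T.lie) : D.form μ ν = D.form ν μ := by
  rw [form_eq_tr, form_eq_tr, trForm_symm]

include D in
theorem t_ext {Y Y' : T.lie} (h : ∀ Z : T.lie, trForm n Y Z = trForm n Y' Z) : Y = Y' := by
  refine sub_eq_zero.1 (eq_zero_of_trace D.hb D.ε_conj fun Z => ?_)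
  have : ((Y - Y' : T.lie) : Matrix (Fin n) (Fin n) ℂ) = Y - Y' := rfl
  rw [this, map_sub, LinearMap.sub_apply, h, sub_self]

theorem conjT_tt {μ : Module.Dual ℂ T.lie} (hμ : μ ∈ realWts T) : conjT (D.tt μ) = D.tt μ := by
  refine D.t_ext fun Z => ?_
  have h2 : conjT (conjT Z) = Z := Subtype.ext (by
    change -conjM (-conjM (Z : Matrix (Fin n) (Fin n) ℂ)) = _
    ext i j
    simp [conjM])
  have h1 : trForm n (conjT (D.tt μ)) Z = star (trForm n (D.tt μ) (conjT Z)) := by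
    rw [trace_mul_eq D.hb, trace_mul_eq D.hb, star_sum]
    refine Finset.sum_congr rfl fun k _ => ?_
    rw [star_mul', D.ε_conj, D.ε_conj, star_star]
  rw [h1, D.tr_tt, D.tr_tt, hμ Z, star_star]

theorem eps_tt_im {μ : Module.Dual ℂ T.lie} (hμ : μ ∈ realWts T) (k : Fin D.N) :
    (D.ε k (D.tt μ)).im = 0 := by
  have := D.ε_conj k (D.tt μ)
  rw [D.conjT_tt hμ] at this
  exact Complex.conj_eq_iff_im.1 this.symm

theorem form_im {μ ν : Module.Dual ℂ T.lie} (hμ : μ ∈ realWts T) (hν : ν ∈ realWts T) :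
    (D.form μ ν).im = 0 := by
  rw [form_eq_tr, trace_mul_eq D.hb, Complex.im_sum]
  refine Finset.sum_eq_zero fun k _ => ?_
  rw [Complex.mul_im, D.eps_tt_im hμ, D.eps_tt_im hν]
  simp

/-- The form is positive on weights, as it is the sum of the squares of the real numbers `ε k (tt μ)`. -/
theorem form_pos {μ : Module.Dual ℂ T.lie} (hμ : μ ∈ realWts T) (h0 : μ ≠ 0) :
    0 < (D.form μ μ).re := by
  rw [form_eq_tr, trace_mul_eq D.hb, Complex.re_sum]
  have h1 : ∀ k, (D.ε k (D.tt μ) * D.ε k (D.tt μ)).re = (D.ε k (D.tt μ)).re ^ 2 := fun k => by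
    rw [Complex.mul_re, D.eps_tt_im hμ]; ring
  simp only [h1]
  refine lt_of_le_of_ne (Finset.sum_nonneg fun k _ => sq_nonneg _) fun h => h0 ?_
  have h2 := (Finset.sum_eq_zero_iff_of_nonneg fun k _ => sq_nonneg _).1 h.symm
  have h3 : D.tt μ = 0 := eq_zero_of_eps D.hb fun k =>
    Complex.ext (by simpa using h2 k (Finset.mem_univ k)) (D.eps_tt_im hμ k)
  ext Y
  rw [← D.tr_tt μ Y, h3]
  simp

end TorusData

/-! ### The `sl₂` of a root -/

include hC in
/-- For an invariant form, a root space pairs only with the root space of the opposite root. -/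
theorem form_shift {B : LinearMap.BilinForm ℂ G.lie} (hinv : ∀ X Y W, B ⁅X, Y⁆ W = B X ⁅Y, W⁆)
    {α β : Module.Dual ℂ T.lie} {X Y : G.lie} (hX : X ∈ wspace (adT hC) α)
    (hY : Y ∈ wspace (adT hC) β) (h : B X Y ≠ 0) : β = -α := by
  rw [eq_neg_iff_add_eq_zero, add_comm]
  ext Z
  have h1 := hinv X (inc hC Z) Y
  rw [← adT_apply, hY Z, ← lie_skew, ← adT_apply, hX Z, map_neg, LinearMap.neg_apply, map_smul,
    map_smul, LinearMap.smul_apply, smul_eq_mul, smul_eq_mul] at h1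
  have h2 : (α + β) Z * B X Y = 0 := by rw [LinearMap.add_apply]; linear_combination -h1
  exact (mul_eq_zero.1 h2).resolve_right h

open scoped ComplexOrder in
include hC in
/-- The trace form pairs opposite root spaces nondegenerately, since `tr (X Xᴴ) ≠ 0` and `𝔤` is stable
under the adjoint. -/
theorem exists_dual_vector (D : TorusData T) {α : Module.Dual ℂ T.lie} {X : G.lie}
    (hX : X ∈ wspace (adT hC) α) (h0 : X ≠ 0) :
    ∃ Y ∈ wspace (adT hC) (-α), trG G X Y = 1 := by
  have h1 : ∃ Y, trG G X Y ≠ 0 := by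
    refine ⟨⟨(X : Matrix (Fin n) (Fin n) ℂ)ᴴ, hC.adj _ X.2⟩, fun h => h0 (Subtype.ext ?_)⟩
    exact Matrix.trace_mul_conjTranspose_self_eq_zero_iff.1 h
  obtain ⟨i, hi⟩ : ∃ i, trG G X (rootBasis hC D i) ≠ 0 := by
    by_contra! h
    obtain ⟨Y, hY⟩ := h1
    refine hY ?_
    rw [← (rootBasis hC D).sum_repr Y, map_sum]
    exact Finset.sum_eq_zero fun i _ => by rw [map_smul, h, smul_zero]
  have hw : rootBasis hC D i ∈ wspace (adT hC) (rootWt hC D i) := fun Y => rootBasis_spec hC D Y i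
  have e := form_shift hC trG_inv hX hw hi
  rw [e] at hw
  exact ⟨(trG G X (rootBasis hC D i))⁻¹ • rootBasis hC D i, Submodule.smul_mem _ _ hw, by
    rw [map_smul, smul_eq_mul, inv_mul_cancel₀ hi]⟩

include hC in
theorem lie_mem_wspace {α β : Module.Dual ℂ T.lie} {X Y : G.lie} (hX : X ∈ wspace (adT hC) α)
    (hY : Y ∈ wspace (adT hC) β) : ⁅X, Y⁆ ∈ wspace (adT hC) (α + β) := fun Z => by
  rw [adT_apply, leibniz_lie, ← adT_apply, ← adT_apply, hX Z, hY Z, smul_lie, lie_smul,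
    LinearMap.add_apply, add_smul]

theorem mem_wspace_zero {X : G.lie} (h : X ∈ wspace (adT hC) 0) : ∃ Z : T.lie, X = inc hC Z := by
  refine ⟨⟨X, hC.cartan X X.2 fun Y hY => ?_⟩, rfl⟩
  have := congrArg Subtype.val (h ⟨Y, hY⟩)
  rw [LinearMap.zero_apply, zero_smul] at this
  exact this

/-- The bracket of two vectors in opposite root spaces is the multiple of `t_α` given by their trace
form. -/
theorem lie_eq_tt (D : TorusData T) {α : Module.Dual ℂ T.lie} {X Y : G.lie}
    (hX : X ∈ wspace (adT hC) α) (hY : Y ∈ wspace (adT hC) (-α)) :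
    ⁅X, Y⁆ = trG G X Y • inc hC (D.tt α) := by
  have h1 := lie_mem_wspace hC hX hY
  rw [add_neg_cancel] at h1
  obtain ⟨Z, hZ⟩ := mem_wspace_zero hC h1
  have h2 : Z = trG G X Y • D.tt α := D.t_ext fun W => by
    have h3 : trForm n Z W = trG G ⁅X, Y⁆ (inc hC W) := by rw [hZ]; rfl
    have h4 : ((trG G X Y • D.tt α : T.lie) : Matrix (Fin n) (Fin n) ℂ) =
      trG G X Y • (D.tt α : Matrix (Fin n) (Fin n) ℂ) := rfl
    rw [h3, trG_inv, ← lie_skew, ← adT_apply, hY W, h4, map_smul, LinearMap.smul_apply, D.tr_tt,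
      map_neg, map_smul, LinearMap.neg_apply]
    simp [mul_comm]
  rw [hZ, h2, map_smul]

include hC in
theorem form_root_ne (D : TorusData T) {α : Module.Dual ℂ T.lie} (hα : α ∈ rootFinset hC D) :
    D.form α α ≠ 0 := fun h => by
  have := D.form_pos (root_mem_realWts hC D hα) ((mem_rootFinset hC D).1 hα).1
  simp [h] at this

theorem sl2_adT (D : TorusData T) {α : Module.Dual ℂ T.lie} (hα : α ∈ rootFinset hC D) {X Y : G.lie}
    (hX : X ∈ wspace (adT hC) α) (hY : Y ∈ wspace (adT hC) (-α)) (h : trG G X Y = 1) :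
    Sl2Act (adT hC) α ((2 / D.form α α) • D.tt α) (LieAlgebra.ad ℂ G.lie X)
      ((2 / D.form α α) • LieAlgebra.ad ℂ G.lie Y) := by
  have hsh : ∀ {β : Module.Dual ℂ T.lie} {X' : G.lie}, X' ∈ wspace (adT hC) β → ∀ Z,
      adT hC Z * LieAlgebra.ad ℂ G.lie X' =
        LieAlgebra.ad ℂ G.lie X' * adT hC Z + β Z • LieAlgebra.ad ℂ G.lie X' := by
    intro β X' hX Z
    have h1 := LieHom.map_lie (LieAlgebra.ad ℂ G.lie) (inc hC Z) X'
    rw [← adT_apply, hX Z, map_smul, Ring.lie_def, eq_sub_iff_add_eq'] at h1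
    exact h1.symm
  refine ⟨hsh hX, fun Z => ?_, ?_, ?_⟩
  · rw [mul_smul_comm, hsh hY, smul_mul_assoc, smul_add, smul_comm]
  · have h1 := LieHom.map_lie (LieAlgebra.ad ℂ G.lie) X Y
    rw [lie_eq_tt hC D hX hY, h, one_smul, Ring.lie_def] at h1
    rw [mul_smul_comm, smul_mul_assoc, map_smul]
    change _ = _ + (2 / D.form α α) • LieAlgebra.ad ℂ G.lie (inc hC (D.tt α))
    rw [h1, ← smul_add]
    congr 1
    abel
  · rw [map_smul, ← D.form_apply, smul_eq_mul, div_mul_cancel₀ _ (form_root_ne hC D hα)]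

theorem neg_mem_rootFinset (D : TorusData T) {α : Module.Dual ℂ T.lie} (hα : α ∈ rootFinset hC D) :
    -α ∈ rootFinset hC D := by
  obtain ⟨h0, X, hX, hX0⟩ := (mem_rootFinset hC D).1 hα
  obtain ⟨Y, hY, h⟩ := exists_dual_vector hC D hX hX0
  exact (mem_rootFinset hC D).2 ⟨neg_ne_zero.2 h0, Y, hY, by rintro rfl; simp at h⟩

/-- The root spaces are one-dimensional: a vector of weight `-α` orthogonal to the root vector `X`
would be killed by `X`, but its weight `-2` is negative. -/
theorem eq_smul_of_mem_wspace (D : TorusData T) {α : Module.Dual ℂ T.lie}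
    (hα : α ∈ rootFinset hC D) {X Y W : G.lie} (hX : X ∈ wspace (adT hC) α)
    (hY : Y ∈ wspace (adT hC) (-α)) (h : trG G X Y = 1) (hW : W ∈ wspace (adT hC) (-α)) :
    W = trG G X W • Y := by
  have h1 : W - trG G X W • Y ∈ wspace (adT hC) (-α) :=
    sub_mem hW (Submodule.smul_mem _ _ hY)
  by_contra hne
  have hs := sl2_adT hC D hα hX hY h
  have h2 : LieAlgebra.ad ℂ G.lie X (W - trG G X W • Y) = 0 := by
    rw [LieAlgebra.ad_apply, lie_eq_tt hC D hX h1, map_sub, map_smul, h, smul_eq_mul, mul_one,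
      sub_self, zero_smul]
  obtain ⟨k, hk⟩ := hs.exists_nat (sub_ne_zero.2 hne) (h1 _) h2
  rw [LinearMap.neg_apply, hs.hc] at hk
  have h3 := congrArg Complex.re hk
  rw [Complex.neg_re, Complex.re_ofNat, Complex.natCast_re] at h3
  have : (0 : ℝ) ≤ k := Nat.cast_nonneg k
  linarith

/-- Cartan integers are integral, being weights of a representation of `sl₂`. -/
theorem exists_int (D : TorusData T) {α β : Module.Dual ℂ T.lie} (hα : α ∈ rootFinset hC D)
    (hβ : β ∈ rootFinset hC D) : ∃ k : ℤ, 2 * D.form α β / D.form α α = k := by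
  obtain ⟨_, X, hX, hX0⟩ := (mem_rootFinset hC D).1 hα
  obtain ⟨Y, hY, h⟩ := exists_dual_vector hC D hX hX0
  obtain ⟨_, W, hW, hW0⟩ := (mem_rootFinset hC D).1 hβ
  obtain ⟨i, hi⟩ := (rootBasis_spec hC D).exists_wt hW hW0
  obtain ⟨k, hk⟩ := (sl2_adT hC D hα hX hY h).wt_int (rootBasis_spec hC D) i
  refine ⟨k, ?_⟩
  rw [← hk, hi, map_smul, ← D.form_apply, smul_eq_mul]
  ring

/-- Roots are permuted by reflections, since the multiplicities of the weights of a representation of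
`sl₂` are invariant under the reflection. -/
theorem refl_mem_rootFinset (D : TorusData T) {α β : Module.Dual ℂ T.lie}
    (hα : α ∈ rootFinset hC D) (hβ : β ∈ rootFinset hC D) :
    β - (2 * D.form α β / D.form α α) • α ∈ rootFinset hC D := by
  obtain ⟨hα0, X, hX, hX0⟩ := (mem_rootFinset hC D).1 hα
  obtain ⟨Y, hY, h⟩ := exists_dual_vector hC D hX hX0
  obtain ⟨hβ0, W, hW, hW0⟩ := (mem_rootFinset hC D).1 hβ
  have hs := sl2_adT hC D hα hX hY h
  have h1 := hs.finrank_reflect (rootBasis_spec hC D) β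
  have e : β ((2 / D.form α α) • D.tt α) = 2 * D.form α β / D.form α α := by
    rw [map_smul, ← D.form_apply, smul_eq_mul]; ring
  rw [e] at h1
  have h2 : wspace (adT hC) (β - (2 * D.form α β / D.form α α) • α) ≠ ⊥ := fun h0 => by
    rw [h0, finrank_bot] at h1
    have := Submodule.finrank_eq_zero.1 h1.symm
    rw [this] at hW
    exact hW0 ((Submodule.mem_bot ℂ).1 hW)
  obtain ⟨V, hV, hV0⟩ := (Submodule.ne_bot_iff _).1 h2
  refine (mem_rootFinset hC D).2 ⟨fun h0 => hβ0 ?_, V, hV, hV0⟩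
  rw [sub_eq_zero] at h0
  have h3 := congrArg (D.form α) h0
  rw [map_smul, smul_eq_mul, div_mul_cancel₀ _ (form_root_ne hC D hα)] at h3
  have h4 : D.form α β = 0 := by linear_combination -h3
  rw [h0, h4]; simp

/-- Twice a root is not a root. -/
theorem two_smul_notMem (D : TorusData T) {α : Module.Dual ℂ T.lie} (hα : α ∈ rootFinset hC D) :
    (2 : ℂ) • α ∉ rootFinset hC D := by
  intro h2α
  obtain ⟨hα0, X, hX, hX0⟩ := (mem_rootFinset hC D).1 hα
  obtain ⟨Y, hY, h⟩ := exists_dual_vector hC D hX hX0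
  obtain ⟨_, W, hW, hW0⟩ := (mem_rootFinset hC D).1 h2α
  -- `3α` is not a root, by integrality
  have h3 : ⁅X, W⁆ = 0 := by
    by_contra hne
    have hm := lie_mem_wspace hC hX hW
    have e3 : α + (2 : ℂ) • α = (3 : ℂ) • α := by module
    rw [e3] at hm
    have h3α : (3 : ℂ) • α ∈ rootFinset hC D :=
      (mem_rootFinset hC D).2 ⟨smul_ne_zero three_ne_zero hα0, _, hm, hne⟩
    obtain ⟨k, hk⟩ := exists_int hC D h3α hα
    have hne := form_root_ne hC D hα
    simp only [map_smul, LinearMap.smul_apply, smul_eq_mul] at hk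
    rw [div_eq_iff (mul_ne_zero three_ne_zero (mul_ne_zero three_ne_zero hne))] at hk
    have hk' : (2 : ℂ) = k * 3 := mul_right_cancel₀ (mul_ne_zero three_ne_zero hne) (by
      linear_combination hk)
    have : (2 : ℤ) = k * 3 := by exact_mod_cast hk'
    omega
  have h4 : ⁅X, ⁅Y, W⁆⁆ = 0 := by
    have hm := lie_mem_wspace hC hY hW
    have e1 : -α + (2 : ℂ) • α = - -α := by module
    rw [e1] at hm
    have hα' := neg_mem_rootFinset hC D hα
    have hXn : X ∈ wspace (adT hC) (- -α) := by rwa [neg_neg]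
    rw [eq_smul_of_mem_wspace hC D hα' hY hXn (by rw [trG_symm, h]) hm, lie_smul, lie_self,
      smul_zero]
  have h5 : ⁅X, ⁅Y, W⁆⁆ = ⁅⁅X, Y⁆, W⁆ + ⁅Y, ⁅X, W⁆⁆ := leibniz_lie X Y W
  rw [h4, h3, lie_zero, add_zero, lie_eq_tt hC D hX hY, h, one_smul, ← adT_apply, hW,
    LinearMap.smul_apply, ← D.form_apply] at h5
  have := form_root_ne hC D hα
  rcases smul_eq_zero.1 h5.symm with h6 | h6
  · rcases smul_eq_zero.1 h6 with h7 | h7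
    · exact two_ne_zero h7
    · exact this h7
  · exact hW0 h6

/-- The root system is reduced: if `β = cα`, then `2c` and `2 / c` are integers, and `c = ±2` and
`c = ±1/2` are excluded because twice a root is not a root. -/
theorem rootFinset_reduced (D : TorusData T) {α β : Module.Dual ℂ T.lie}
    (hα : α ∈ rootFinset hC D) (hβ : β ∈ rootFinset hC D) {c : ℝ} (hc : β = (c : ℂ) • α) :
    β = α ∨ β = -α := by
  have hne := form_root_ne hC D hα
  have hβ0 := ((mem_rootFinset hC D).1 hβ).1
  have hc0 : (c : ℂ) ≠ 0 := fun h => hβ0 (by rw [hc, h, zero_smul])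
  obtain ⟨k, hk⟩ := exists_int hC D hα hβ
  obtain ⟨l, hl⟩ := exists_int hC D hβ hα
  have hk' : (2 : ℂ) * c = k := by
    rw [← hk, hc, map_smul, smul_eq_mul]; field_simp
  have hl' : (2 : ℂ) = l * c := by
    rw [← hl, hc]
    simp only [map_smul, LinearMap.smul_apply, smul_eq_mul]
    field_simp
  have hkl : k * l = 4 := by
    have : (k : ℂ) * l = 4 := by rw [← hk']; linear_combination -2 * hl'
    exact_mod_cast this
  have hkd : k ∣ 4 := ⟨l, hkl.symm⟩
  have hkb : k ≤ 4 := Int.le_of_dvd (by norm_num) hkd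
  have hkb' : -4 ≤ k := by
    have : -k ≤ 4 := Int.le_of_dvd (by norm_num) ((neg_dvd).2 hkd)
    linarith
  have h2 := two_smul_notMem hC D hα
  have h2' := two_smul_notMem hC D (neg_mem_rootFinset hC D hα)
  have h3 := two_smul_notMem hC D hβ
  have h3' := two_smul_notMem hC D (neg_mem_rootFinset hC D hβ)
  have hcv : (c : ℂ) = k / 2 := by rw [← hk']; ring
  rw [hcv] at hc
  interval_cases k
  · exact absurd hβ (by rw [hc]; convert h2' using 2; push_cast; module)
  · omega
  · right; rw [hc]; push_cast; module
  · exact absurd hα (by convert h3' using 2; rw [hc]; push_cast; module)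
  · omega
  · exact absurd hα (by convert h3 using 2; rw [hc]; push_cast; module)
  · left; rw [hc]; push_cast; module
  · omega
  · exact absurd hβ (by rw [hc]; convert h2 using 2; push_cast; module)

/-- The root system of `𝔤`, with positive roots given by the Weyl chamber of `x`. -/
def rootSys (D : TorusData T) {x : T.lie} (hx : IsRegularElement G.lie T.lie x) :
    RootSys (Module.Dual ℂ T.lie) where
  Φ := rootFinset hC D
  form := D.form
  symm := D.form_symm
  ht := Complex.reLm ∘ₗ (Module.Dual.eval ℂ T.lie x).restrictScalars ℝ
  ht_ne := fun α hα h => by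
    obtain ⟨h1, h2⟩ := hx α ((mem_rootFinset_iff_roots hC D).1 hα)
    exact h2 (Complex.ext h h1)
  pos_def := fun β hβ h0 => D.form_pos
    ((AddSubgroup.closure_le _).2 (fun α hα => root_mem_realWts hC D hα) hβ) h0
  im_eq := fun α hα => D.form_im (root_mem_realWts hC D hα) (root_mem_realWts hC D hα)
  int := fun α hα β hβ => exists_int hC D hα hβ
  refl_mem := fun α hα β hβ => refl_mem_rootFinset hC D hα hβ
  reduced := fun α hα β hβ c hc => rootFinset_reduced hC D hα hβ hc

end Roots

end WeylChar

namespace WeylChar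

section Split

variable {n : ℕ} {T G : RealAlgGroup n} (hC : IsCartanIn T G) (D : TorusData T)

include hC in
/-- Root vectors `e α` with `tr (e_α e_{-α}) = 1`. -/
theorem exists_rootVectors {x : T.lie} (hx : IsRegularElement G.lie T.lie x) :
    ∃ e : Module.Dual ℂ T.lie → G.lie, ∀ α ∈ rootFinset hC D,
      e α ∈ wspace (adT hC) α ∧ trG G (e α) (e (-α)) = 1 := by
  classical
  have h1 : ∀ α : Module.Dual ℂ T.lie, ∃ X Y : G.lie, α ∈ rootFinset hC D →
      X ∈ wspace (adT hC) α ∧ Y ∈ wspace (adT hC) (-α) ∧ trG G X Y = 1 := by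
    intro α
    by_cases hα : α ∈ rootFinset hC D
    · obtain ⟨_, X, hX, hX0⟩ := (mem_rootFinset hC D).1 hα
      obtain ⟨Y, hY, h⟩ := exists_dual_vector hC D hX hX0
      exact ⟨X, Y, fun _ => ⟨hX, hY, h⟩⟩
    · exact ⟨0, 0, fun h => absurd h hα⟩
  choose X Y hXY using h1
  let R := rootSys hC D hx
  refine ⟨fun α => if α ∈ R.pos then X α else Y (-α), fun α hα => ?_⟩
  rcases R.pos_or_neg hα with h | h
  · have h' := R.neg_notMem_pos h
    obtain ⟨h1, h2, h3⟩ := hXY α hα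
    simpa only [if_pos h, if_neg h', neg_neg] using ⟨h1, h3⟩
  · have h' : α ∉ R.pos := fun h' => R.neg_notMem_pos h' h
    obtain ⟨h1, h2, h3⟩ := hXY (-α) (neg_mem_rootFinset hC D hα)
    rw [neg_neg] at h2
    rw [trG_symm] at h3
    simpa only [if_pos h, if_neg h'] using ⟨h2, h3⟩

/-- Root vectors normalised by the trace form. -/
def rootVec {x : T.lie} (hx : IsRegularElement G.lie T.lie x) : Module.Dual ℂ T.lie → G.lie :=
  (exists_rootVectors hC D hx).choose

variable {x : T.lie} (hx : IsRegularElement G.lie T.lie x)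

theorem rootVec_mem {α : Module.Dual ℂ T.lie} (hα : α ∈ rootFinset hC D) :
    rootVec hC D hx α ∈ wspace (adT hC) α :=
  ((exists_rootVectors hC D hx).choose_spec α hα).1

theorem trG_rootVec {α : Module.Dual ℂ T.lie} (hα : α ∈ rootFinset hC D) :
    trG G (rootVec hC D hx α) (rootVec hC D hx (-α)) = 1 :=
  ((exists_rootVectors hC D hx).choose_spec α hα).2

theorem eq_smul_rootVec {α : Module.Dual ℂ T.lie} (hα : α ∈ rootFinset hC D) {W : G.lie}
    (hW : W ∈ wspace (adT hC) α) : ∃ c : ℂ, W = c • rootVec hC D hx α := by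
  have hα' := neg_mem_rootFinset hC D hα
  have h1 := rootVec_mem hC D hx hα
  have h2 := trG_rootVec hC D hx hα'
  have h3 := rootVec_mem hC D hx hα'
  rw [neg_neg] at h2
  exact ⟨_, eq_smul_of_mem_wspace hC D hα' h3 (by rwa [neg_neg]) h2 (by rwa [neg_neg])⟩

theorem exists_decomp (X : G.lie) : ∃ Y, ∃ c : Module.Dual ℂ T.lie → ℂ,
    X = inc hC Y + ∑ α ∈ rootFinset hC D, c α • rootVec hC D hx α := by
  classical
  have h1 : ∀ i, ∃ Y, ∃ c : Module.Dual ℂ T.lie → ℂ,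
      rootBasis hC D i = inc hC Y + ∑ α ∈ rootFinset hC D, c α • rootVec hC D hx α := by
    intro i
    have hw : rootBasis hC D i ∈ wspace (adT hC) (rootWt hC D i) :=
      fun Y => rootBasis_spec hC D Y i
    by_cases h0 : rootWt hC D i = 0
    · rw [h0] at hw
      obtain ⟨Y, hY⟩ := mem_wspace_zero hC hw
      exact ⟨Y, 0, by simp [hY]⟩
    · have hm : rootWt hC D i ∈ rootFinset hC D :=
        (mem_rootFinset hC D).2 ⟨h0, _, hw, (rootBasis hC D).ne_zero i⟩
      obtain ⟨c, hc⟩ := eq_smul_rootVec hC D hx hm hw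
      refine ⟨0, Pi.single (rootWt hC D i) c, ?_⟩
      rw [map_zero, zero_add, Finset.sum_eq_single_of_mem _ hm, Pi.single_eq_same, hc]
      intro β _ hne
      rw [Pi.single_eq_of_ne hne, zero_smul]
  choose Y c hYc using h1
  refine ⟨∑ i, (rootBasis hC D).repr X i • Y i,
    fun α => ∑ i, (rootBasis hC D).repr X i * c i α, ?_⟩
  conv_lhs => rw [← (rootBasis hC D).sum_repr X]
  simp only [map_sum, map_smul, Finset.sum_smul, mul_smul]
  rw [Finset.sum_comm, ← Finset.sum_add_distrib]
  refine Finset.sum_congr rfl fun i _ => ?_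
  conv_lhs => rw [hYc i, smul_add, Finset.smul_sum]

/-- The root space decomposition of `𝔤`. -/
def splitData : SplitData T.lie G.lie where
  i := inc hC
  κ := trG G
  κ_symm := trG_symm
  κ_inv := trG_inv
  R := rootSys hC D hx
  tt := D.tt
  form_eq := D.form_apply
  κ_tt := D.tr_tt
  e := rootVec hC D hx
  lie_i := fun Y Y' => Subtype.ext (by
    change ⁅(Y : Matrix (Fin n) (Fin n) ℂ), (Y' : Matrix (Fin n) (Fin n) ℂ)⁆ = 0
    rw [Ring.lie_def, D.comm Y Y.2 Y' Y'.2, sub_self])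
  lie_e := fun α hα Y => rootVec_mem hC D hx hα Y
  lie_ee := fun α hα => by
    rw [lie_eq_tt hC D (rootVec_mem hC D hx hα)
      (rootVec_mem hC D hx (neg_mem_rootFinset hC D hα)), trG_rootVec hC D hx hα, one_smul]
  κ_e := fun α hα => trG_rootVec hC D hx hα
  span := exists_decomp hC D hx

/-! ### Comparison of the root system with roots, coroots and the Weyl group of `𝔤` -/

theorem mem_rootSys {α : Module.Dual ℂ T.lie} :
    α ∈ (rootSys hC D hx).Φ ↔ α ∈ roots G.lie T.lie := mem_rootFinset_iff_roots hC D

theorem mem_rootSys_pos {α : Module.Dual ℂ T.lie} :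
    α ∈ (rootSys hC D hx).pos ↔ α ∈ posRoots G.lie T.lie x := by
  rw [RootSys.mem_pos, mem_rootSys]; rfl

theorem rho_eq : rho G.lie T.lie x = (rootSys hC D hx).hρ := by
  have : posRoots G.lie T.lie x = ((rootSys hC D hx).pos : Set (Module.Dual ℂ T.lie)) := by
    ext α; exact (mem_rootSys_pos hC D hx).symm
  rw [rho, RootSys.hρ, this, finsum_mem_coe_finset]

include hC in
theorem isCoroot_iff {α : Module.Dual ℂ T.lie} (hα : α ∈ roots G.lie T.lie) {c : T.lie} :
    IsCoroot G.lie T.lie α c ↔ c = (2 / D.form α α) • D.tt α := by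
  have hα' := (mem_rootFinset_iff_roots hC D).2 hα
  have hne := form_root_ne hC D hα'
  constructor
  · rintro ⟨h2, e, he, f, hf, hef⟩
    obtain ⟨he1, he2⟩ := (mem_rootSpace_iff hC).1 he
    obtain ⟨hf1, hf2⟩ := (mem_rootSpace_iff hC).1 hf
    have h3 := congrArg Subtype.val (lie_eq_tt hC D he2 hf2)
    set k := trG G ⟨e, he1⟩ ⟨f, hf1⟩
    have h4 : c = k • D.tt α := Subtype.ext (hef.symm.trans h3)
    rw [h4, map_smul, smul_eq_mul, ← D.form_apply] at h2
    rw [h4, ← h2, mul_div_cancel_right₀ _ hne]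
  · rintro rfl
    refine ⟨by rw [map_smul, smul_eq_mul, ← D.form_apply, div_mul_cancel₀ _ hne], ?_⟩
    obtain ⟨_, X, hX, hX0⟩ := (mem_rootFinset hC D).1 hα'
    obtain ⟨Y, hY, h⟩ := exists_dual_vector hC D hX hX0
    refine ⟨_, (mem_rootSpace_iff hC).2 ⟨X.2, hX⟩, _, (mem_rootSpace_iff hC).2
      ⟨((2 / D.form α α) • Y).2, Submodule.smul_mem _ (2 / D.form α α) hY⟩, ?_⟩
    have h3 := congrArg Subtype.val (lie_eq_tt hC D hX
      (Submodule.smul_mem _ (2 / D.form α α) hY))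
    rw [map_smul, h, smul_eq_mul, mul_one] at h3
    exact h3

theorem weylGroup_eq : weylGroup G.lie T.lie = (rootSys hC D hx).weyl := by
  rw [weylGroup, RootSys.weyl]
  congr 1
  ext s
  constructor
  · rintro ⟨α, hα, c, hc, h⟩
    refine ⟨α, (mem_rootSys hC D hx).2 hα, LinearEquiv.ext fun μ => ?_⟩
    rw [h, RootSys.refl_apply, (isCoroot_iff hC D hα).1 hc]
    congr 2
    exact (splitData hC D hx).apply_coroot μ
  · rintro ⟨α, hα, rfl⟩
    have hα' := (mem_rootSys hC D hx).1 hα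
    refine ⟨α, hα', _, (isCoroot_iff hC D hα').2 rfl, fun μ => ?_⟩
    rw [RootSys.refl_apply]
    congr 2
    exact ((splitData hC D hx).apply_coroot μ).symm

/-- Evaluation of formal exponentials at `exp Y`. -/
def evT (Y : T.lie) : GA (Module.Dual ℂ T.lie) →ₐ[ℂ] ℂ :=
  ev (Module.Dual.eval ℂ T.lie Y).toAddMonoidHom

theorem evT_ex (Y : T.lie) (μ : Module.Dual ℂ T.lie) : evT Y (ex μ) = Complex.exp (μ Y) := by
  rw [evT, ev_ex]; rfl

theorem altSum_eq (μ : Module.Dual ℂ T.lie) (Y : T.lie) :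
    altSum G.lie T.lie μ Y = evT Y ((rootSys hC D hx).alt μ) := by
  rw [altSum, weylGroup_eq hC D hx, finsum_eq_sum_of_fintype, RootSys.alt, map_sum]
  refine Finset.sum_congr rfl fun w _ => ?_
  rw [map_smul, evT_ex, smul_eq_mul]
  rfl

theorem evT_den (Y : T.lie) : evT Y (rootSys hC D hx).den =
    Complex.exp ((rootSys hC D hx).hρ Y) *
      ∏ α ∈ (rootSys hC D hx).pos, (1 - Complex.exp (-(α Y))) := by
  rw [RootSys.den_eq, map_mul, evT_ex, map_prod]
  congr 1
  refine Finset.prod_congr rfl fun α _ => ?_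
  rw [map_sub, map_one, evT_ex, LinearMap.neg_apply]

theorem evT_chi {ι : Type*} [Fintype ι] (wt : ι → Module.Dual ℂ T.lie) (Y : T.lie) :
    evT Y (chi wt) = ∑ i, Complex.exp (wt i Y) := by
  rw [chi, map_sum]
  exact Finset.sum_congr rfl fun i _ => evT_ex Y _

end Split

end WeylChar

namespace WeylChar

/-! ### Cosets of the Weyl group of a subsystem -/

namespace RootSys

variable {V : Type*} [AddCommGroup V] [Module ℂ V] {R R' : RootSys V}

theorem weyl_mono (hform : R'.form = R.form) (hΦ : R'.Φ ⊆ R.Φ) : R'.weyl ≤ R.weyl := by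
  refine (Subgroup.closure_le _).2 ?_
  rintro _ ⟨α, hα, rfl⟩
  have : R'.refl α = R.refl α := LinearEquiv.ext fun μ => by
    rw [refl_apply, refl_apply, cor_apply, cor_apply, hform]
  rw [this]
  exact R.refl_mem_weyl (hΦ hα)

theorem hρ_weyl_im {w : V ≃ₗ[ℂ] V} (hw : w ∈ R.weyl) {α : V} (hα : α ∈ R.Φ) :
    (R.form α (w R.hρ)).im = 0 := R.weyl_form_im (fun _ h => R.hρ_form_im h) hw α hα

/-- In the `W`-orbit of `ρ`, dominance for a subsystem is strict. -/
theorem strictDom_of_dom (hform : R'.form = R.form) (hΦ : R'.Φ ⊆ R.Φ) {w : V ≃ₗ[ℂ] V}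
    (hw : w ∈ R.weyl) (h : R'.Dom (w R.hρ)) : R'.StrictDom (w R.hρ) := fun α hα => by
  refine ⟨(h α hα).1, lt_of_le_of_ne (h α hα).2 fun h0 => ?_⟩
  have hα' := hΦ (R'.pos_sub hα)
  have e : w (w⁻¹ α) = α := w.apply_symm_apply α
  have hβ : w⁻¹ α ∈ R.Φ := R.weyl_mem (R.weyl.inv_mem hw) hα'
  have h1 : (R.form (w⁻¹ α) R.hρ).re = 0 := by
    rw [← R.form_weyl hw, e, ← hform, ← h0]
  rcases R.pos_or_neg hβ with hp | hp
  · exact (R.hρ_strictDom _ hp).2.ne' h1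
  · have := (R.hρ_strictDom _ hp).2
    rw [map_neg, LinearMap.neg_apply, Complex.neg_re, h1, neg_zero] at this
    exact this.ne rfl

/-- The elements `w` of `W` such that `wρ` is dominant for a subsystem represent the cosets of the
Weyl group of the subsystem. -/
theorem alt_eq_sum (hform : R'.form = R.form) (hΦ : R'.Φ ⊆ R.Φ) {S : Set (V ≃ₗ[ℂ] V)} [Fintype S]
    (hS : ∀ w, w ∈ S ↔ w ∈ R.weyl ∧ R'.Dom (w R.hρ)) (Λ : V) :
    R.alt Λ = ∑ w : S, sgn w.1 • R'.alt (w.1 Λ) := by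
  have hle := weyl_mono hform hΦ
  let F : S × R'.weyl → R.weyl := fun p =>
    ⟨p.2.1 * p.1.1, R.weyl.mul_mem (hle p.2.2) ((hS _).1 p.1.2).1⟩
  have hF : Function.Bijective F := by
    constructor
    · rintro ⟨⟨w, hw⟩, ⟨u, hu⟩⟩ ⟨⟨w', hw'⟩, ⟨u', hu'⟩⟩ h
      have h1 : u * w = u' * w' := congrArg Subtype.val h
      obtain ⟨hw1, hw2⟩ := (hS _).1 hw
      obtain ⟨hw1', hw2'⟩ := (hS _).1 hw'
      have h2 : (u'⁻¹ * u) (w R.hρ) = w' R.hρ := by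
        have : u'⁻¹ * u * w = w' := by rw [mul_assoc, h1, inv_mul_cancel_left]
        exact LinearEquiv.congr_fun this R.hρ
      have h3 := R'.eq_one_of_strictDom (R'.weyl.mul_mem (R'.weyl.inv_mem hu') hu)
        (strictDom_of_dom hform hΦ hw1 hw2) (strictDom_of_dom hform hΦ hw1' hw2') h2
      have h4 : u' = u := inv_mul_eq_one.1 h3
      subst h4
      have h5 : w = w' := mul_left_cancel h1
      subst h5
      rfl
    · rintro ⟨g, hg⟩
      obtain ⟨u, hu, hd⟩ := R'.exists_dom (g R.hρ) fun α hα => by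
        rw [hform]; exact hρ_weyl_im hg (hΦ hα)
      refine ⟨⟨⟨u * g, (hS _).2 ⟨R.weyl.mul_mem (hle hu) hg, hd⟩⟩, ⟨u⁻¹, R'.weyl.inv_mem hu⟩⟩, ?_⟩
      exact Subtype.ext (inv_mul_cancel_left u g)
  rw [alt, ← (Equiv.ofBijective F hF).sum_comp, Fintype.sum_prod_type]
  refine Finset.sum_congr rfl fun w _ => ?_
  rw [alt, Finset.smul_sum]
  refine Finset.sum_congr rfl fun u _ => ?_
  change sgn (u.1 * w.1) • ex ((u.1 * w.1) Λ) = _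
  rw [sgn_mul, smul_smul, mul_comm (sgn u.1)]
  rfl

end RootSys

/-! ### The decomposition of `𝔰` into root spaces -/

section Pair

variable {n : ℕ} {T H G : RealAlgGroup n} (hG : IsCartanIn T G) (hH : IsCartanIn T H)
  (hle : ∀ X ∈ H.lie, X ∈ G.lie) (D : TorusData T)

include hle in
theorem roots_mono {α : Module.Dual ℂ T.lie} (h : α ∈ roots H.lie T.lie) :
    α ∈ roots G.lie T.lie := by
  refine ⟨h.1, ?_⟩
  obtain ⟨X, hX, h0⟩ := (Submodule.ne_bot_iff _).1 h.2
  exact (Submodule.ne_bot_iff _).2 ⟨X, ⟨hle X hX.1, hX.2⟩, h0⟩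

include hle in
theorem regular_mono {x : T.lie} (hx : IsRegularElement G.lie T.lie x) :
    IsRegularElement H.lie T.lie x := fun α hα =>
  hx α (roots_mono hle hα)

variable {x : T.lie} (hx : IsRegularElement G.lie T.lie x) (hxH : IsRegularElement H.lie T.lie x)

include hle in
theorem rootSys_mono : (rootSys hH D hxH).Φ ⊆ (rootSys hG D hx).Φ := fun _ hα =>
  (mem_rootSys hG D hx).2 (roots_mono hle ((mem_rootSys hH D hxH).1 hα))

include hle in
theorem rootSys_pos_mono : (rootSys hH D hxH).pos ⊆ (rootSys hG D hx).pos := fun α hα => by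
  obtain ⟨h1, h2⟩ := (RootSys.mem_pos _).1 hα
  exact (RootSys.mem_pos _).2 ⟨rootSys_mono hG hH hle D hx hxH h1, h2⟩

open Classical in
/-- The positive roots in `𝔰`. -/
def posS : Finset (Module.Dual ℂ T.lie) := (rootSys hG D hx).pos \ (rootSys hH D hxH).pos

theorem mem_posS {α : Module.Dual ℂ T.lie} : α ∈ posS hG hH D hx hxH ↔
    α ∈ (rootSys hG D hx).pos ∧ α ∉ (rootSys hH D hxH).pos := by
  classical
  exact Finset.mem_sdiff

theorem posS_notMem {α : Module.Dual ℂ T.lie} (h : α ∈ posS hG hH D hx hxH) :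
    α ∉ rootFinset hH D := fun h' => by
  obtain ⟨h1, h2⟩ := (mem_posS hG hH D hx hxH).1 h
  exact h2 ((RootSys.mem_pos _).2 ⟨h', ((RootSys.mem_pos _).1 h1).2⟩)

include hle in
theorem rho_sub_eq : (rootSys hG D hx).hρ - (rootSys hH D hxH).hρ =
    (1 / 2 : ℂ) • ∑ α ∈ posS hG hH D hx hxH, α := by
  classical
  rw [RootSys.hρ, RootSys.hρ, ← smul_sub, posS,
    ← Finset.sum_sdiff (rootSys_pos_mono hG hH hle D hx hxH), add_sub_cancel_right]

include hle in
theorem prod_posS (f : Module.Dual ℂ T.lie → ℂ) :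
    ∏ α ∈ (rootSys hG D hx).pos, f α =
      (∏ α ∈ posS hG hH D hx hxH, f α) * ∏ α ∈ (rootSys hH D hxH).pos, f α := by
  classical
  rw [← Finset.prod_sdiff (rootSys_pos_mono hG hH hle D hx hxH), posS]

/-- The inclusion of `𝔥` in `𝔤`. -/
def incH (X : H.lie) : G.lie := ⟨X, hle X X.2⟩

theorem incH_mem_wspace {α : Module.Dual ℂ T.lie} {X : H.lie} (h : X ∈ wspace (adT hH) α) :
    incH hle X ∈ wspace (adT hG) α := fun Y =>
  Subtype.ext (congrArg Subtype.val (h Y) : _)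

include hle in
/-- The root vectors of `𝔤` for roots of `𝔥` lie in `𝔥`. -/
theorem rootVec_mem_H {α : Module.Dual ℂ T.lie} (hα : α ∈ rootFinset hH D) :
    (rootVec hG D hx α : Matrix (Fin n) (Fin n) ℂ) ∈ H.lie := by
  have hα' := rootSys_mono hG hH hle D hx (regular_mono hle hx) hα
  obtain ⟨_, X, hX, h0⟩ := (mem_rootFinset hH D).1 hα
  obtain ⟨c, hc⟩ := eq_smul_rootVec hG D hx hα' (incH_mem_wspace hG hH hle hX)
  have hc' : (X : Matrix (Fin n) (Fin n) ℂ) = c • (rootVec hG D hx α : Matrix (Fin n) (Fin n) ℂ) :=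
    congrArg Subtype.val hc
  have hc0 : c ≠ 0 := by
    rintro rfl
    rw [zero_smul] at hc'
    exact h0 (Subtype.ext hc')
  have : (rootVec hG D hx α : Matrix (Fin n) (Fin n) ℂ) = c⁻¹ • (X : Matrix (Fin n) (Fin n) ℂ) := by
    rw [hc', smul_smul, inv_mul_cancel₀ hc0, one_smul]
  rw [this]
  exact H.lie.smul_mem _ X.2

variable {B : LinearMap.BilinForm ℂ G.lie} (hs : ∀ X Y, B X Y = B Y X)
  (hnd : ∀ X, (∀ Y, B X Y = 0) → X = 0) (hinv : ∀ X Y W, B ⁅X, Y⁆ W = B X ⁅Y, W⁆)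

include D in
theorem inc_mem_wspace (Y : T.lie) : inc hG Y ∈ wspace (adT hG) 0 := fun Z => by
  rw [LinearMap.zero_apply, zero_smul, adT_apply]
  refine Subtype.ext ?_
  change ⁅(Z : Matrix (Fin n) (Fin n) ℂ), (Y : Matrix (Fin n) (Fin n) ℂ)⁆ = 0
  rw [Ring.lie_def, D.comm Z Z.2 Y Y.2, sub_self]

include hnd hinv in
/-- A non-degenerate invariant form pairs opposite root spaces nondegenerately. -/
theorem form_rootVec_ne {α : Module.Dual ℂ T.lie} (hα : α ∈ rootFinset hG D) :
    B (rootVec hG D hx α) (rootVec hG D hx (-α)) ≠ 0 := fun h0 => by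
  have hα0 := ((mem_rootFinset hG D).1 hα).1
  have hm := rootVec_mem hG D hx hα
  have h1 : rootVec hG D hx α = 0 := hnd _ fun X => by
    obtain ⟨Y, c, rfl⟩ := exists_decomp hG D hx X
    rw [map_add, map_sum, Finset.sum_eq_zero fun β hβ => ?_, add_zero]
    · by_contra h
      have := form_shift hG hinv hm (inc_mem_wspace hG D Y) h
      exact hα0 (neg_eq_zero.1 this.symm)
    · rw [map_smul]
      by_cases h : B (rootVec hG D hx α) (rootVec hG D hx β) = 0
      · rw [h, smul_zero]
      · rw [form_shift hG hinv hm (rootVec_mem hG D hx hβ) h, h0, smul_zero]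
  have := trG_rootVec hG D hx hα
  simp [h1] at this

include hH hle hinv hxH in
/-- Root spaces for roots of `𝔤` that are not roots of `𝔥` lie in `𝔰`. -/
theorem wspace_le_orthCompl {α : Module.Dual ℂ T.lie} (h0 : α ≠ 0) (hα : α ∉ rootFinset hH D)
    {X : G.lie} (hX : X ∈ wspace (adT hG) α) : X ∈ orthCompl H G B := by
  intro W hW
  obtain ⟨Y, c, hY⟩ := exists_decomp hH D hxH ⟨W, hW⟩
  have hW' : W = inc hG Y + ∑ β ∈ rootFinset hH D, c β • incH hle (rootVec hH D hxH β) := by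
    refine Subtype.ext ?_
    have := congrArg Subtype.val hY
    change (W : Matrix (Fin n) (Fin n) ℂ) = _ at this
    rw [this]
    push_cast
    rfl
  rw [hW', map_add, map_sum, Finset.sum_eq_zero fun β hβ => ?_, add_zero]
  · by_contra h
    have := form_shift hG hinv hX (inc_mem_wspace hG D Y) h
    exact h0 (neg_eq_zero.1 this.symm)
  · rw [map_smul]
    by_contra h
    have := form_shift hG hinv hX (incH_mem_wspace hG hH hle (rootVec_mem hH D hxH hβ))
      fun h' => h (by rw [h', smul_zero])
    rw [this] at hβ
    have := neg_mem_rootFinset hH D hβ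
    rw [neg_neg] at this
    exact hα this

include hG hH hinv in
/-- `𝔱` preserves `𝔰`. -/
theorem inc_lie_mem (Y : T.lie) (u : orthCompl H G B) :
    ⁅inc hG Y, (u : G.lie)⁆ ∈ orthCompl H G B := fun W hW => by
  rw [B_skew hinv, neg_eq_zero]
  exact u.2 _ (H.lie.lie_mem (hH.le Y Y.2) hW)

theorem not_add_eq_zero {R : RootSys (Module.Dual ℂ T.lie)} {α β : Module.Dual ℂ T.lie}
    (hα : α ∈ R.pos) (hβ : β ∈ R.pos) : β ≠ -α := fun h => by
  rw [h] at hβ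
  exact R.neg_notMem_pos hα hβ

theorem posS_sub {α : Module.Dual ℂ T.lie} (h : α ∈ posS hG hH D hx hxH) :
    α ∈ rootFinset hG D := RootSys.pos_sub _ ((mem_posS hG hH D hx hxH).1 h).1

/-- Root vectors for the positive roots in `𝔰`. -/
def uS (α : posS hG hH D hx hxH) : orthCompl H G B :=
  ⟨rootVec hG D hx α, wspace_le_orthCompl hG hH hle D hxH hinv
    ((mem_rootFinset hG D).1 (posS_sub hG hH D hx hxH α.2)).1 (posS_notMem hG hH D hx hxH α.2)
    (rootVec_mem hG D hx (posS_sub hG hH D hx hxH α.2))⟩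

/-- Root vectors for the negative roots in `𝔰`, dual to the vectors `uS`. -/
def uS' (α : posS hG hH D hx hxH) : orthCompl H G B :=
  ⟨(B (rootVec hG D hx α) (rootVec hG D hx (-α.1)))⁻¹ • rootVec hG D hx (-α.1),
    Submodule.smul_mem _ _ (wspace_le_orthCompl hG hH hle D hxH hinv
      (neg_ne_zero.2 ((mem_rootFinset hG D).1 (posS_sub hG hH D hx hxH α.2)).1)
      (fun h => posS_notMem hG hH D hx hxH α.2 (by
        have := neg_mem_rootFinset hH D h
        rwa [neg_neg] at this))
      (rootVec_mem hG D hx (neg_mem_rootFinset hG D (posS_sub hG hH D hx hxH α.2))))⟩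

variable {hinv}

theorem uS_mem (α : posS hG hH D hx hxH) :
    (uS hG hH hle D hx hxH hinv α : G.lie) ∈ wspace (adT hG) α :=
  rootVec_mem hG D hx (posS_sub hG hH D hx hxH α.2)

theorem uS'_mem (α : posS hG hH D hx hxH) :
    (uS' hG hH hle D hx hxH hinv α : G.lie) ∈ wspace (adT hG) (-α) :=
  Submodule.smul_mem _ _
    (rootVec_mem hG D hx (neg_mem_rootFinset hG D (posS_sub hG hH D hx hxH α.2)))

include hinv in
/-- Vectors for two positive roots are orthogonal. -/
theorem form_pos_pos {α β : Module.Dual ℂ T.lie} (hα : α ∈ (rootSys hG D hx).pos)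
    (hβ : β ∈ (rootSys hG D hx).pos) {X Y : G.lie} (hX : X ∈ wspace (adT hG) α)
    (hY : Y ∈ wspace (adT hG) β) : B X Y = 0 := by
  by_contra h
  exact not_add_eq_zero hα hβ (form_shift hG hinv hX hY h)

theorem B_uS (α β : posS hG hH D hx hxH) :
    B (uS hG hH hle D hx hxH hinv α : G.lie) (uS hG hH hle D hx hxH hinv β : G.lie) = 0 :=
  form_pos_pos hG D hx (hinv := hinv) ((mem_posS hG hH D hx hxH).1 α.2).1
    ((mem_posS hG hH D hx hxH).1 β.2).1 (uS_mem hG hH hle D hx hxH α) (uS_mem hG hH hle D hx hxH β)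

theorem B_uS' (α β : posS hG hH D hx hxH) :
    B (uS' hG hH hle D hx hxH hinv α : G.lie) (uS' hG hH hle D hx hxH hinv β : G.lie) = 0 := by
  by_contra h
  have := form_shift hG hinv (uS'_mem hG hH hle D hx hxH α) (uS'_mem hG hH hle D hx hxH β) h
  exact not_add_eq_zero ((mem_posS hG hH D hx hxH).1 α.2).1 ((mem_posS hG hH D hx hxH).1 β.2).1
    (neg_injective this)

include hnd in
open Classical in
theorem B_uS_uS' (α β : posS hG hH D hx hxH) :
    B (uS hG hH hle D hx hxH hinv α : G.lie) (uS' hG hH hle D hx hxH hinv β : G.lie) =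
      if α = β then 1 else 0 := by
  split_ifs with h
  · subst h
    rw [uS, uS', map_smul, smul_eq_mul]
    exact inv_mul_cancel₀ (form_rootVec_ne hG D hx hnd hinv (posS_sub hG hH D hx hxH α.2))
  · by_contra hne
    have := form_shift hG hinv (uS_mem hG hH hle D hx hxH α) (uS'_mem hG hH hle D hx hxH β) hne
    exact h (Subtype.ext (neg_injective this)).symm

include hG hx hnd in
/-- An element of `𝔰` is determined by its pairings with the root vectors in `𝔰`. -/
theorem eq_of_form_uS {w w' : orthCompl H G B}
    (h1 : ∀ α, B (uS hG hH hle D hx hxH hinv α : G.lie) (w : G.lie) =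
      B (uS hG hH hle D hx hxH hinv α : G.lie) (w' : G.lie))
    (h2 : ∀ α, B (uS' hG hH hle D hx hxH hinv α : G.lie) (w : G.lie) =
      B (uS' hG hH hle D hx hxH hinv α : G.lie) (w' : G.lie))
    (hs : ∀ X Y, B X Y = B Y X) : w = w' := by
  refine Subtype.ext (sub_eq_zero.1 (hnd _ fun X => ?_))
  obtain ⟨Y, c, rfl⟩ := exists_decomp hG D hx X
  rw [map_add, map_sum, Finset.sum_eq_zero fun β hβ => ?_, add_zero]
  · exact (w - w').2 _ (hH.le Y Y.2)
  rw [map_smul]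
  suffices h : B ((w : G.lie) - w') (rootVec hG D hx β) = 0 by rw [h, smul_zero]
  by_cases hβH : β ∈ rootFinset hH D
  · exact (w - w').2 _ (rootVec_mem_H hG hH hle D hx hβH)
  have hne : -β ∉ rootFinset hH D := fun h => hβH (by
    have := neg_mem_rootFinset hH D h
    rwa [neg_neg] at this)
  rw [hs, map_sub, sub_eq_zero]
  rcases (rootSys hG D hx).pos_or_neg hβ with hp | hp
  · exact h1 ⟨β, (mem_posS hG hH D hx hxH).2 ⟨hp, fun h => hβH (RootSys.pos_sub _ h)⟩⟩
  · have e := h2 ⟨-β, (mem_posS hG hH D hx hxH).2 ⟨hp, fun h => hne (RootSys.pos_sub _ h)⟩⟩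
    have hk := form_rootVec_ne hG D hx hnd hinv (neg_mem_rootFinset hG D hβ)
    simp only [uS', neg_neg, map_smul, LinearMap.smul_apply, smul_eq_mul] at e
    rw [neg_neg] at hk
    exact mul_left_cancel₀ (inv_ne_zero hk) e

open Classical in
/-- The dual bases of `𝔰` consisting of root vectors for positive and for negative roots. -/
def polarS (hs : ∀ X Y, B X Y = B Y X) (hnd : ∀ X, (∀ Y, B X Y = 0) → X = 0)
    (hinv : ∀ X Y W, B ⁅X, Y⁆ W = B X ⁅Y, W⁆) : PolarBasis H G B (posS hG hH D hx hxH) where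
  u := uS hG hH hle D hx hxH hinv
  u' := uS' hG hH hle D hx hxH hinv
  B_uu := B_uS hG hH hle D hx hxH
  B_uu'' := B_uS' hG hH hle D hx hxH
  B_uu' := B_uS_uS' hG hH hle D hx hxH hnd
  eq_sum := fun w => by
    have h1 : ∀ β α, B (uS' hG hH hle D hx hxH hinv β : G.lie)
        (uS hG hH hle D hx hxH hinv α : G.lie) = if α = β then 1 else 0 := fun β α => by
      rw [hs, B_uS_uS' hG hH hle D hx hxH hnd]
    refine eq_of_form_uS hG hH hle D hx hxH hnd (hinv := hinv) (fun α => ?_) (fun α => ?_) hs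
    · push_cast
      simp only [map_sum, map_add, map_smul, smul_eq_mul, B_uS, B_uS_uS' hG hH hle D hx hxH hnd]
      simp
    · push_cast
      simp only [map_sum, map_add, map_smul, smul_eq_mul, B_uS', h1]
      simp

end Pair

end WeylChar

namespace WeylChar

/-! ### The action of the torus on the spin module -/

section SpinTorus

variable {n : ℕ} {T H G : RealAlgGroup n} (hG : IsCartanIn T G) (hH : IsCartanIn T H)
  (hle : ∀ X ∈ H.lie, X ∈ G.lie) (D : TorusData T)
  {x : T.lie} (hx : IsRegularElement G.lie T.lie x) (hxH : IsRegularElement H.lie T.lie x)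
  {B : LinearMap.BilinForm ℂ G.lie} (hs : ∀ X Y, B X Y = B Y X)
  (hnd : ∀ X, (∀ Y, B X Y = 0) → X = 0) (hinv : ∀ X Y W, B ⁅X, Y⁆ W = B X ⁅Y, W⁆)
  {m : ℕ} (Z : Module.Basis (Fin m) ℂ (orthCompl H G B)) (hZ : IsOrthonormalBasis Z)
  (S : SpinModule.{v} (cliffordForm H G B))

/-- The action of `𝔱` on the spin module. -/
def tactS : T.lie →ₗ[ℂ] Module.End ℂ S.S := S.c.toLinearMap ∘ₗ spinLin Z ∘ₗ inc hG

theorem tactS_apply (Y : T.lie) : tactS hG Z S Y = S.c (spinMap Z (inc hG Y)) := rfl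

variable {Z}

include hH hs hinv hZ in
theorem tactS_shift {α : Module.Dual ℂ T.lie} {u : orthCompl H G B}
    (hu : (u : G.lie) ∈ wspace (adT hG) α) (Y : T.lie) :
    tactS hG Z S Y * clS S u = clS S u * tactS hG Z S Y + α Y • clS S u := by
  rw [tactS_apply, clS_comm hs hinv hZ (inc_lie_mem hG hH hinv Y) S u]
  have : adS (inc hG Y) (inc_lie_mem hG hH hinv Y) u = α Y • u := Subtype.ext (hu Y)
  rw [this, map_smul]

include hH hs hnd hinv hZ in
/-- The vacuum of the spin module has weight `ρ - ρ_𝔥`. -/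
theorem vacuum_mem_wspace {v : S.S}
    (hv : ∀ i, clS S (uS hG hH hle D hx hxH hinv i) v = 0) :
    v ∈ wspace (tactS hG Z S) ((rootSys hG D hx).hρ - (rootSys hH D hxH).hρ) := fun Y => by
  classical
  rw [tactS_apply, (polarS hG hH hle D hx hxH hs hnd hinv).spinMap_vacuum
    hZ (inc_lie_mem hG hH hinv Y) S hs (α := fun i => i.1 Y)
    (fun i => uS_mem hG hH hle D hx hxH (hinv := hinv) i Y)
    (fun i => uS'_mem hG hH hle D hx hxH (hinv := hinv) i Y) hv,
    rho_sub_eq hG hH hle D hx hxH, LinearMap.smul_apply, LinearMap.sum_apply, smul_eq_mul,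
    Finset.sum_coe_sort (posS hG hH D hx hxH) fun α => α Y]

include hs hnd in
/-- The vacuum is killed by all positive root vectors in `𝔰`. -/
theorem vacuum_kill {v : S.S}
    (hv : ∀ i, clS S (uS hG hH hle D hx hxH hinv i) v = 0)
    {α : Module.Dual ℂ T.lie} (hα : α ∈ posRoots G.lie T.lie x) {u : orthCompl H G B}
    (hu : ((u : G.lie) : Matrix (Fin n) (Fin n) ℂ) ∈ rootSpace G.lie T.lie α) :
    clS S u v = 0 := by
  classical
  obtain ⟨_, hu'⟩ := (mem_rootSpace_iff hG).1 hu
  rw [(polarS hG hH hle D hx hxH hs hnd hinv).eq_sum u, map_sum, LinearMap.sum_apply]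
  refine Finset.sum_eq_zero fun i _ => ?_
  have h1 : B ((polarS hG hH hle D hx hxH hs hnd hinv).u i : G.lie) (u : G.lie) = 0 :=
    form_pos_pos hG D hx (hinv := hinv) ((mem_posS hG hH D hx hxH).1 i.2).1
      ((mem_rootSys_pos hG D hx).2 hα) (uS_mem hG hH hle D hx hxH (hinv := hinv) i) hu'
  rw [h1, zero_smul, add_zero, map_smul, LinearMap.smul_apply]
  exact (congrArg _ (hv i)).trans (smul_zero _)

include hs hnd in
/-- The normalisation of the half-spin modules fixes the parity of the vacuum. -/
theorem grading_vacuum (hS : IsNormalized S x) {v : S.S}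
    (hv : ∀ i, clS S (uS hG hH hle D hx hxH hinv i) v = 0) :
    grading S.isCompl v = (-1 : ℂ) ^ ((G.q : ℤ) - H.q) • v := by
  obtain ⟨h1, h2⟩ := hS v fun α hα u hu => vacuum_kill hG hH hle D hx hxH hs hnd hinv S hv hα hu
  by_cases he : Even ((G.q : ℤ) - H.q)
  · rw [grading_left _ (h1 he), he.neg_one_zpow, one_smul]
  · rw [grading_right _ (h2 he), (Int.not_even_iff_odd.1 he).neg_one_zpow, neg_smul, one_smul]

include hG hH hle D hx hxH hs hnd hinv hZ in
/-- The weights of the spin module, and its graded character: as a Fock space with vacuum of weight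
`ρ - ρ_𝔥` and creation operators of weights `-α`, it has the graded character
`e^{ρ - ρ_𝔥} ∏ (1 - e^{-α})`, up to the parity of the vacuum. -/
theorem exists_spin_basis (hS : IsNormalized S x) (p : Module.Dual ℂ T.lie → Prop)
    (hp : p ((rootSys hG D hx).hρ - (rootSys hH D hxH).hρ))
    (hpα : ∀ α ∈ rootFinset hG D, ∀ ν, p ν → p (ν - α)) :
    ∃ (b : Module.Basis (Fin (Module.finrank ℂ S.S)) ℂ S.S)
      (wt : Fin (Module.finrank ℂ S.S) → Module.Dual ℂ T.lie),
      IsWeightBasis (tactS hG Z S) b wt ∧ (∀ j, p (wt j)) ∧ ∀ Y,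
        LinearMap.trace ℂ S.S (dexp b wt Y * grading S.isCompl) =
          (-1 : ℂ) ^ ((G.q : ℤ) - H.q) *
            (Complex.exp (((rootSys hG D hx).hρ - (rootSys hH D hxH).hρ) Y) *
              ∏ α ∈ posS hG hH D hx hxH, (1 - Complex.exp (-(α Y)))) := by
  classical
  let P := polarS hG hH hle D hx hxH hs hnd hinv
  have hcar := P.isCAR S hs
  have := S.nontrivial
  obtain ⟨v, hv0, hv⟩ := hcar.exists_vacuum
  have hvw := vacuum_mem_wspace hG hH hle D hx hxH hs hnd hinv hZ S hv
  have hb : ∀ i Y, tactS hG Z S Y * P.b S i = P.b S i * tactS hG Z S Y + (-i.1) Y • P.b S i :=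
    fun i Y => by
      rw [PolarBasis.b, mul_smul_comm, smul_mul_assoc, smul_comm ((-i.1) Y), ← smul_add]
      congr 1
      exact tactS_shift hG hH hs hinv hZ S (uS'_mem hG hH hle D hx hxH (hinv := hinv) i) Y
  obtain ⟨b, wt, hbw, hpw⟩ := hcar.exists_weightBasis hb hv0 hv hvw p hp fun i ν =>
    hpα i (posS_sub hG hH D hx hxH i.2) ν
  refine ⟨b, wt, hbw, hpw, fun Y => ?_⟩
  have hg : ∀ i, P.a S i * (dexp b wt Y * grading S.isCompl) =
      -Complex.exp (-(i.1 Y)) • (dexp b wt Y * grading S.isCompl * P.a S i) := fun i => by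
    have h1 := dexp_shift hbw (tactS_shift hG hH hs hinv hZ S
      (uS_mem hG hH hle D hx hxH (hinv := hinv) i)) Y
    have h2 : P.a S i * dexp b wt Y = Complex.exp (-(i.1 Y)) • (dexp b wt Y * P.a S i) := by
      change clS S (uS hG hH hle D hx hxH hinv i) * _ =
        _ • (_ * clS S (uS hG hH hle D hx hxH hinv i))
      rw [h1, smul_smul, ← Complex.exp_add, neg_add_cancel, Complex.exp_zero, one_smul]
    have h3 : grading S.isCompl * P.a S i = -(P.a S i * grading S.isCompl) := grading_cl S _
    rw [← mul_assoc, h2, smul_mul_assoc, mul_assoc (dexp b wt Y) (grading _), h3, mul_assoc,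
      mul_neg, smul_neg, neg_smul, neg_neg]
  have hz : (dexp b wt Y * grading S.isCompl) v = ((-1 : ℂ) ^ ((G.q : ℤ) - H.q) *
      Complex.exp (((rootSys hG D hx).hρ - (rootSys hH D hxH).hρ) Y)) • v := by
    rw [Module.End.mul_apply, grading_vacuum hG hH hle D hx hxH hs hnd hinv S hS hv, map_smul,
      dexp_wspace hbw hvw, smul_smul]
  rw [hcar.trace_eq hg hv0 hv hz,
    Finset.prod_coe_sort (posS hG hH D hx hxH) fun α => 1 - Complex.exp (-(α Y))]
  ring

end SpinTorus

/-! ### Integral weights -/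

section Integral

variable {n : ℕ} {T H G : RealAlgGroup n}

/-- `e^μ` is well defined on `T(ℝ)`. -/
def IsIntegral (μ : Module.Dual ℂ T.lie) : Prop := ∀ X X' : T.lie,
  IsRealMatrix (X : Matrix (Fin n) (Fin n) ℂ) → IsRealMatrix (X' : Matrix (Fin n) (Fin n) ℂ) →
    NormedSpace.exp (X : Matrix (Fin n) (Fin n) ℂ) =
      NormedSpace.exp (X' : Matrix (Fin n) (Fin n) ℂ) → Complex.exp (μ X) = Complex.exp (μ X')

theorem IsIntegral.sub {μ ν : Module.Dual ℂ T.lie} (h : IsIntegral μ) (h' : IsIntegral ν) :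
    IsIntegral (μ - ν) := fun X X' hX hX' e => by
  rw [LinearMap.sub_apply, LinearMap.sub_apply, Complex.exp_sub, Complex.exp_sub, h X X' hX hX' e,
    h' X X' hX hX' e]

theorem IsCharacter.isIntegral {μ : Module.Dual ℂ T.lie} (h : IsCharacter T μ) : IsIntegral μ := by
  obtain ⟨χ, hχ⟩ := h
  intro X X' hX hX' e
  obtain ⟨γ, hγ⟩ := exp_mem_realPts T X.2 hX
  rw [← hχ X hX γ hγ, ← hχ X' hX' γ (hγ.trans e)]

/-- The action of `exp X` on a weight vector of the standard representation. -/
theorem exp_mulVec_wspace {μ : Module.Dual ℂ T.lie} {v : Fin n → ℂ} (hv : v ∈ wspace (stdAct T) μ)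
    (X : T.lie) : NormedSpace.exp (X : Matrix (Fin n) (Fin n) ℂ) *ᵥ v = Complex.exp (μ X) • v := by
  have h := exp_mulVec_of_jordan (X := (X : Matrix (Fin n) (Fin n) ℂ)) (v := v) (u := 0)
    (by rw [add_zero]; exact hv X) (by simp) 1
  simpa using h

theorem eps_isIntegral (D : TorusData T) (k : Fin D.N) : IsIntegral (D.ε k) :=
  fun X X' _ _ e => by
    have hv : D.b k ∈ wspace (stdAct T) (D.ε k) := fun Y => D.hb Y k
    have h := exp_mulVec_wspace hv X
    rw [e, exp_mulVec_wspace hv X'] at h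
    exact (smul_left_injective ℂ (D.b.ne_zero k) h).symm

theorem root_isIntegral (hG : IsCartanIn T G) (D : TorusData T) {α : Module.Dual ℂ T.lie}
    (hα : α ∈ rootFinset hG D) : IsIntegral α := by
  obtain ⟨_, X, hX, h0⟩ := (mem_rootFinset hG D).1 hα
  obtain ⟨k, l, rfl⟩ := exists_eps_sub hG D hX h0
  exact (eps_isIntegral D k).sub (eps_isIntegral D l)

/-- On an `H`-regular element the roots of `𝔥` take values different from `1`. -/
theorem exp_root_ne_one (hH : IsCartanIn T H) (D : TorusData T) {γ : T.realPts} {X : T.lie}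
    (hγ : ((γ : GL (Fin n) ℂ) : Matrix (Fin n) (Fin n) ℂ) =
      NormedSpace.exp (X : Matrix (Fin n) (Fin n) ℂ)) (hr : IsRegularIn T H γ)
    {α : Module.Dual ℂ T.lie} (hα : α ∈ rootFinset hH D) : Complex.exp (α X) ≠ 1 := fun h1 => by
  obtain ⟨hα0, E, hE, hE0⟩ := (mem_rootFinset hH D).1 hα
  have hb : ∀ l, D.b l ∈ wspace (stdAct T) (D.ε l) := fun l Y => D.hb Y l
  have hE' : ∀ Y : T.lie, ⁅(Y : Matrix (Fin n) (Fin n) ℂ), (E : Matrix (Fin n) (Fin n) ℂ)⁆ =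
    α Y • (E : Matrix (Fin n) (Fin n) ℂ) := fun Y => congrArg Subtype.val (hE Y)
  have hEb : ∀ l, (E : Matrix (Fin n) (Fin n) ℂ) *ᵥ D.b l ∈ wspace (stdAct T) (D.ε l + α) :=
    fun l Y => by
      have e := congrArg (· *ᵥ D.b l) (hE' Y)
      have e2 : (Y : Matrix (Fin n) (Fin n) ℂ) *ᵥ D.b l = D.ε l Y • D.b l := D.hb Y l
      simp only [Ring.lie_def, Matrix.sub_mulVec, ← Matrix.mulVec_mulVec, e2, Matrix.mulVec_smul,
        Matrix.smul_mulVec, sub_eq_iff_eq_add] at e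
      rw [stdAct_apply, e, LinearMap.add_apply, add_smul, add_comm]
  -- if `e^α = 1` at `γ`, then `γ` commutes with the root vector `E`
  have hc : NormedSpace.exp (X : Matrix (Fin n) (Fin n) ℂ) * (E : Matrix (Fin n) (Fin n) ℂ) =
      (E : Matrix (Fin n) (Fin n) ℂ) * NormedSpace.exp (X : Matrix (Fin n) (Fin n) ℂ) := by
    refine Matrix.toLin'.injective (D.b.ext fun l => ?_)
    rw [Matrix.toLin'_apply, Matrix.toLin'_apply, ← Matrix.mulVec_mulVec, ← Matrix.mulVec_mulVec,
      exp_mulVec_wspace (hEb l), exp_mulVec_wspace (hb l), Matrix.mulVec_smul, LinearMap.add_apply,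
      Complex.exp_add, h1, mul_one]
  have hET := hr E E.2 (by rw [hγ, hc])
  refine hα0 (LinearMap.ext fun Y => ?_)
  have h2 := hE' Y
  rw [Ring.lie_def, D.comm Y Y.2 E hET, sub_self] at h2
  exact (smul_eq_zero.1 h2.symm).resolve_right fun h => hE0 (Subtype.ext h)

end Integral

end WeylChar

namespace WeylChar

/-! ### Representations of the real group restricted to the torus -/

section Rep

variable {n : ℕ} {T H G : RealAlgGroup n} (hG : IsCartanIn T G) (hTG : T.cpts ≤ G.cpts)

/-- The action of `𝔱` on a representation. -/
def tactF (F : RealRep.{u} G) : T.lie →ₗ[ℂ] Module.End ℂ F.V :=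
  (F.lieAct : G.lie →ₗ[ℂ] Module.End ℂ F.V) ∘ₗ inc hG

theorem tactF_apply (F : RealRep.{u} G) (Y : T.lie) : tactF hG F Y = F.lieAct (inc hG Y) := rfl

theorem eq_exp_of_hasDerivAt {φ : ℝ → ℂ} {c : ℂ} (h : ∀ s, HasDerivAt φ (c * φ s) s) :
    φ 1 = Complex.exp c * φ 0 := by
  have h1 : ∀ s : ℝ, HasDerivAt (fun s : ℝ => Complex.exp (-c * s) * φ s) 0 s := fun s => by
    have e := ((hasDerivAt_id (s : ℂ)).const_mul (-c)).cexp.comp_ofReal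
    refine (e.mul (h s)).congr_deriv ?_
    simp only [id]
    ring
  have h2 := is_const_of_deriv_eq_zero (fun s => (h1 s).differentiableAt) (fun s => (h1 s).deriv)
    1 0
  simp only [Complex.ofReal_one, mul_one, Complex.ofReal_zero, mul_zero, Complex.exp_zero,
    one_mul] at h2
  rw [← h2, ← mul_assoc, ← Complex.exp_add, add_neg_cancel, Complex.exp_zero, one_mul]

/-- On a weight vector, `exp X` acts by the exponential of the weight. -/
theorem resAct_wspace (F : RealRep.{u} G) {μ : Module.Dual ℂ T.lie} {w : F.V}
    (hw : w ∈ wspace (tactF hG F) μ) {X : T.lie} (hX : IsRealMatrix (X : Matrix (Fin n) (Fin n) ℂ))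
    {γ : T.realPts} (hγ : ((γ : GL (Fin n) ℂ) : Matrix (Fin n) (Fin n) ℂ) =
      NormedSpace.exp (X : Matrix (Fin n) (Fin n) ℂ)) :
    F.resAct hTG γ w = Complex.exp (μ X) • w := by
  choose p hp using fun s : ℝ => exp_mem_realPts G
    (G.lie.smul_mem (s : ℂ) (hG.le X X.2)) (isReal_smul hX s)
  have hadd : ∀ s t : ℝ, p (s + t) = p s * p t := fun s t => by
    refine Subtype.ext (Units.ext ?_)
    change _ = ((p s : GL (Fin n) ℂ) : Matrix (Fin n) (Fin n) ℂ) *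
      ((p t : GL (Fin n) ℂ) : Matrix (Fin n) (Fin n) ℂ)
    rw [hp, hp, hp, ← Matrix.exp_add_of_commute, ← add_smul]
    · push_cast; rfl
    · exact ((Commute.refl _).smul_left _).smul_right _
  have h0 : p 0 = 1 := Subtype.ext (Units.ext (by rw [hp]; simp))
  have h1 : p 1 = Subgroup.inclusion (RealAlgGroup.realPts_mono hTG) γ :=
    Subtype.ext (Units.ext (by rw [hp]; simp [hγ]))
  have key : ∀ f : Module.Dual ℂ F.V, f (F.resAct hTG γ w) = Complex.exp (μ X) * f w := fun f => by
    -- the derivative of a matrix coefficient at `w` is `μ X` times the coefficient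
    have hd : ∀ s, HasDerivAt (fun s => f (F.act (p s) w)) (μ X * f (F.act (p s) w)) s :=
        fun s => by
      have h2 := F.hasDerivAt (inc hG X) hX p hp w (f ∘ₗ F.act (p s))
      rw [← tactF_apply, hw X, map_smul, smul_eq_mul] at h2
      have h3 : HasDerivAt (fun t => f (F.act (p (s + t)) w)) (μ X * f (F.act (p s) w)) 0 := by
        refine h2.congr_of_eventuallyEq (Eventually.of_forall fun t => ?_)
        simp only [hadd, map_mul]
        rfl
      have h4 : HasDerivAt (fun t => f (F.act (p (s + t)) w)) (μ X * f (F.act (p s) w))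
          (s - s) := by
        rwa [sub_self]
      have h5 := HasDerivAt.comp_sub_const s s h4
      simpa using h5
    have h6 := eq_exp_of_hasDerivAt hd
    rw [h0, h1, map_one] at h6
    exact h6
  rw [← sub_eq_zero, ← Module.forall_dual_apply_eq_zero_iff ℂ]
  intro f
  rw [map_sub, key, map_smul, smul_eq_mul, sub_self]

variable {ι : Type*} {F : RealRep.{u} G} {b : Module.Basis ι ℂ F.V} {wt : ι → Module.Dual ℂ T.lie}

theorem resAct_eq_dexp (hb : IsWeightBasis (tactF hG F) b wt) {X : T.lie}
    (hX : IsRealMatrix (X : Matrix (Fin n) (Fin n) ℂ))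
    {γ : T.realPts} (hγ : ((γ : GL (Fin n) ℂ) : Matrix (Fin n) (Fin n) ℂ) =
      NormedSpace.exp (X : Matrix (Fin n) (Fin n) ℂ)) : F.resAct hTG γ = dexp b wt X :=
  b.ext fun i => by
    rw [dexp_basis, resAct_wspace hG hTG F (fun Y => hb Y i) hX hγ]

theorem character_eq_evT [Fintype ι] (hb : IsWeightBasis (tactF hG F) b wt) {X : T.lie}
    (hX : IsRealMatrix (X : Matrix (Fin n) (Fin n) ℂ))
    {γ : T.realPts} (hγ : ((γ : GL (Fin n) ℂ) : Matrix (Fin n) (Fin n) ℂ) =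
      NormedSpace.exp (X : Matrix (Fin n) (Fin n) ℂ)) : F.character hTG γ = evT X (chi wt) := by
  rw [RealRep.character, resAct_eq_dexp hG hTG hb hX hγ, trace_dexp, evT_chi]

/-- An irreducible representation of the real group has a basis of weight vectors, and its weights
satisfy the Weyl character formula. -/
theorem exists_character (D : TorusData T) {x : T.lie} (hx : IsRegularElement G.lie T.lie x)
    (F : RealRep.{u} G) {lam : Module.Dual ℂ T.lie} (hirr : F.IsIrreducible)
    (hlam : F.HasHighestWeight x lam) :
    ∃ (b : Module.Basis (Fin (Module.finrank ℂ F.V)) ℂ F.V)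
      (wt : Fin (Module.finrank ℂ F.V) → Module.Dual ℂ T.lie),
      IsWeightBasis (tactF hG F) b wt ∧
        chi wt * (rootSys hG D hx).den = (rootSys hG D hx).alt (lam + (rootSys hG D hx).hρ) := by
  obtain ⟨w, hw0, hw, hkill⟩ := hlam
  have h : (splitData hG D hx).IsHighest F.lieAct lam w :=
    { irr := hirr.2
      ne := hw0
      wt := fun Y => hw (inc hG Y) Y rfl
      kill := fun α hα => hkill α ((mem_rootSys_pos hG D hx).1 hα) _
        ((mem_rootSpace_iff hG).2 ⟨(rootVec hG D hx α).2,
          rootVec_mem hG D hx (RootSys.pos_sub _ hα)⟩) }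
  obtain ⟨b, wt, hb, htop⟩ := h.exists_basis
  exact ⟨b, wt, hb, h.weyl_character _ hb htop⟩

end Rep

/-! ### The Dirac index -/

section Index

variable {t V S ι κ : Type*} [AddCommGroup t] [Module ℂ t] [AddCommGroup V] [Module ℂ V]
  [AddCommGroup S] [Module ℂ S]

/-- The action on a tensor product. -/
def tactT (ρ : t →ₗ[ℂ] Module.End ℂ V) (ρ' : t →ₗ[ℂ] Module.End ℂ S) :
    t →ₗ[ℂ] Module.End ℂ (V ⊗[ℂ] S) :=
  LinearMap.rTensorHom S ∘ₗ ρ + LinearMap.lTensorHom V ∘ₗ ρ'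

theorem tactT_apply (ρ : t →ₗ[ℂ] Module.End ℂ V) (ρ' : t →ₗ[ℂ] Module.End ℂ S) (Y : t) :
    tactT ρ ρ' Y = TensorProduct.map (ρ Y) LinearMap.id + TensorProduct.map LinearMap.id (ρ' Y) :=
  rfl

variable {ρ : t →ₗ[ℂ] Module.End ℂ V} {ρ' : t →ₗ[ℂ] Module.End ℂ S}
  {b : Module.Basis ι ℂ V} {b' : Module.Basis κ ℂ S} {wt : ι → Module.Dual ℂ t}
  {wt' : κ → Module.Dual ℂ t}

theorem IsWeightBasis.tensor (hb : IsWeightBasis ρ b wt) (hb' : IsWeightBasis ρ' b' wt') :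
    IsWeightBasis (tactT ρ ρ') (b.tensorProduct b') fun p => wt p.1 + wt' p.2 := fun Y p => by
  rw [Module.Basis.tensorProduct_apply, tactT_apply, LinearMap.add_apply, TensorProduct.map_tmul,
    TensorProduct.map_tmul, hb, hb', LinearMap.id_apply, LinearMap.id_apply, TensorProduct.tmul_smul,
    ← TensorProduct.smul_tmul', ← add_smul]
  rfl

theorem dexp_tensor (Y : t) : dexp (b.tensorProduct b') (fun p => wt p.1 + wt' p.2) Y =
    TensorProduct.map (dexp b wt Y) (dexp b' wt' Y) :=
  (b.tensorProduct b').ext fun p => by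
    rw [dexp_basis, Module.Basis.tensorProduct_apply, TensorProduct.map_tmul, dexp_basis,
      dexp_basis, TensorProduct.smul_tmul_smul, LinearMap.add_apply, Complex.exp_add]

end Index

section DiracIndex

variable {n : ℕ} {T H G : RealAlgGroup n} (hG : IsCartanIn T G) (hH : IsCartanIn T H)
  (hTG : T.cpts ≤ G.cpts)
  {B : LinearMap.BilinForm ℂ G.lie} (hs : ∀ X Y, B X Y = B Y X)
  (hinv : ∀ X Y W, B ⁅X, Y⁆ W = B X ⁅Y, W⁆)
  {m : ℕ} {Z : Module.Basis (Fin m) ℂ (orthCompl H G B)} (hZ : IsOrthonormalBasis Z)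
  (S : SpinModule.{v} (cliffordForm H G B))
  {ι κ : Type*} [Fintype ι] [Fintype κ] {F : RealRep.{u} G} {b : Module.Basis ι ℂ F.V}
  {wt : ι → Module.Dual ℂ T.lie} {bS : Module.Basis κ ℂ S.S} {wtS : κ → Module.Dual ℂ T.lie}

include hG hH hs hinv hZ in
/-- The character of the Dirac index is the product of the character of the representation and the
graded character of the spin module, since the Dirac operator commutes with the torus. -/
theorem diracIndexChar_eq (hb : IsWeightBasis (tactF hG F) b wt)
    (hbS : IsWeightBasis (tactS hG Z S) bS wtS) (σ : T.realPts →* Module.End ℂ S.S) {X : T.lie}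
    (hX : IsRealMatrix (X : Matrix (Fin n) (Fin n) ℂ))
    {γ : T.realPts} (hγ : ((γ : GL (Fin n) ℂ) : Matrix (Fin n) (Fin n) ℂ) =
      NormedSpace.exp (X : Matrix (Fin n) (Fin n) ℂ)) (hσ : σ γ = dexp bS wtS X)
    (hp : ∀ v ∈ S.Sp, σ γ v ∈ S.Sp) (hm : ∀ v ∈ S.Sm, σ γ v ∈ S.Sm) :
    diracIndexChar Z S F hTG σ γ =
      F.character hTG γ * (traceOn (σ γ) S.Sp - traceOn (σ γ) S.Sm) := by
  have hc : TensorProduct.map (F.resAct hTG γ) (σ γ) * diracOp Z S F =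
      diracOp Z S F * TensorProduct.map (F.resAct hTG γ) (σ γ) := by
    rw [resAct_eq_dexp hG hTG hb hX hγ, hσ, ← dexp_tensor]
    exact dexp_comm (hb.tensor hbS) (fun Y => diracOp_comm hs hinv hZ
      (inc_lie_mem hG hH hinv Y) S F) X
  have hinvt : ∀ w ∈ tensorSub S F S.Sp,
      TensorProduct.map (F.resAct hTG γ) (σ γ) w ∈ tensorSub S F S.Sp := by
    rintro _ ⟨w, rfl⟩
    refine ⟨TensorProduct.map (F.resAct hTG γ) ((σ γ).restrict hp) w, ?_⟩
    rw [← LinearMap.comp_apply, ← LinearMap.comp_apply, ← TensorProduct.map_comp,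
      ← TensorProduct.map_comp]
    rfl
  have h1 := traceOn_ker_add_map hinvt hc
  have h2 := traceOn_tensor (F.resAct hTG γ) (σ γ) hp
  have h3 := traceOn_tensor (F.resAct hTG γ) (σ γ) hm
  rw [diracIndexChar, RealRep.character, mul_sub, ← h2, ← h3]
  change _ = traceOn _ (tensorSub S F S.Sp) - traceOn _ (tensorSub S F S.Sm)
  rw [h1]
  ring

omit [Fintype κ] in
/-- The action of `𝔱` on the spin module integrates to `T(ℝ)`, since its weights do. -/
theorem exists_spinRep {G' : RealAlgGroup n} (hT : IsCompactMaximalTorus T G')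
    (hint : ∀ j, IsIntegral (wtS j)) :
    ∃ σ : T.realPts →* Module.End ℂ S.S, ∀ (X : T.lie) (γ : T.realPts),
      IsRealMatrix (X : Matrix (Fin n) (Fin n) ℂ) →
      ((γ : GL (Fin n) ℂ) : Matrix (Fin n) (Fin n) ℂ) =
        NormedSpace.exp (X : Matrix (Fin n) (Fin n) ℂ) → σ γ = dexp bS wtS X := by
  choose log hr hlog using exists_log hT
  have hu : ∀ (X : T.lie) (γ : T.realPts), IsRealMatrix (X : Matrix (Fin n) (Fin n) ℂ) →
      ((γ : GL (Fin n) ℂ) : Matrix (Fin n) (Fin n) ℂ) =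
        NormedSpace.exp (X : Matrix (Fin n) (Fin n) ℂ) → dexp bS wtS (log γ) = dexp bS wtS X :=
    fun X γ hX hγ => dexp_congr fun j => hint j _ _ (hr γ) hX ((hlog γ).symm.trans hγ)
  refine ⟨⟨⟨fun γ => dexp bS wtS (log γ), ?_⟩, fun γ γ' => ?_⟩, hu⟩
  · rw [hu 0 1 (fun i j => by simp) (by simp)]
    exact bS.ext fun j => by rw [dexp_basis]; simp
  · change _ = dexp bS wtS (log γ) * dexp bS wtS (log γ')
    rw [← dexp_add]
    refine hu _ _ (fun i j => ?_) ?_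
    · have h1 := hr γ i j
      have h2 := hr γ' i j
      simp [h1, h2]
    · change ((γ : GL (Fin n) ℂ) : Matrix (Fin n) (Fin n) ℂ) * ((γ' : GL (Fin n) ℂ) : Matrix _ _ ℂ) =
        NormedSpace.exp ((log γ : Matrix (Fin n) (Fin n) ℂ) + log γ')
      rw [Matrix.exp_add_of_commute _ _ (lie_torus_comm hT (log γ).2 (log γ').2), ← hlog, ← hlog]

end DiracIndex

end WeylChar

namespace WeylChar

/-! ### Characters and transfer factors -/

section Transfer

variable {n : ℕ} {T H G : RealAlgGroup n}

theorem isCartanIn_of_isCompactMaximalTorus (hT : IsCompactMaximalTorus T G)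
    (hG : G.IsSelfAdjoint) : IsCartanIn T G :=
  ⟨fun _ hX => lie_mono hT.le hX, hT.cartan, fun _ hX => conjTranspose_mem_lie G hG hX⟩

theorem IsCartanIn.mono (hG : IsCartanIn T G) (hTH : T.cpts ≤ H.cpts)
    (hle : ∀ X ∈ H.lie, X ∈ G.lie) (hH : H.IsSelfAdjoint) : IsCartanIn T H :=
  ⟨fun _ hX => lie_mono hTH hX, fun X hX => hG.cartan X (hle X hX),
    fun _ hX => conjTranspose_mem_lie H hH hX⟩

variable (hG : IsCartanIn T G) (hH : IsCartanIn T H) (hle : ∀ X ∈ H.lie, X ∈ G.lie)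
  (D : TorusData T) {x : T.lie} (hx : IsRegularElement G.lie T.lie x)
  (hxH : IsRegularElement H.lie T.lie x)

/-- The Weyl denominator formula for the alternating sums of the transfer factor. -/
theorem altSum_rho (X : T.lie) :
    altSum G.lie T.lie (rho G.lie T.lie x) X = evT X (rootSys hG D hx).den := by
  rw [rho_eq hG D hx, altSum_eq hG D hx, ← RootSys.den_eq_alt]

include hle in
/-- The quotient of the Weyl denominators of `𝔤` and `𝔥` is `e^{ρ - ρ_𝔥} ∏ (1 - e^{-α})`, with
`α` running over the positive roots in `𝔰`. -/
theorem evT_den_mul (X : T.lie) : evT X (rootSys hG D hx).den =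
    Complex.exp (((rootSys hG D hx).hρ - (rootSys hH D hxH).hρ) X) *
      (∏ α ∈ posS hG hH D hx hxH, (1 - Complex.exp (-(α X)))) * evT X (rootSys hH D hxH).den := by
  have h : Complex.exp ((rootSys hG D hx).hρ X) =
      Complex.exp (((rootSys hG D hx).hρ - (rootSys hH D hxH).hρ) X) *
        Complex.exp ((rootSys hH D hxH).hρ X) := by
    rw [← Complex.exp_add, LinearMap.sub_apply, sub_add_cancel]
  rw [evT_den, evT_den, prod_posS hG hH hle D hx hxH, h]
  ring

/-- The Weyl denominator of `𝔥` does not vanish on `H`-regular elements. -/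
theorem evT_den_ne_zero {γ : T.realPts} {X : T.lie}
    (hγ : ((γ : GL (Fin n) ℂ) : Matrix (Fin n) (Fin n) ℂ) =
      NormedSpace.exp (X : Matrix (Fin n) (Fin n) ℂ)) (hr : IsRegularIn T H γ) :
    evT X (rootSys hH D hxH).den ≠ 0 := by
  rw [evT_den]
  refine mul_ne_zero (Complex.exp_ne_zero _) (Finset.prod_ne_zero_iff.2 fun α hα => ?_)
  rw [sub_ne_zero]
  have h := exp_root_ne_one hH D hγ hr (neg_mem_rootFinset hH D (RootSys.pos_sub _ hα))
  rw [LinearMap.neg_apply] at h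
  exact h.symm

/-- The set `W¹` in terms of the root systems: pairing with coroots and with roots differ by positive
factors. -/
theorem mem_weylOne_iff (hle : ∀ X ∈ H.lie, X ∈ G.lie)
    {w : Module.Dual ℂ T.lie ≃ₗ[ℂ] Module.Dual ℂ T.lie} : w ∈ weylOne G.lie T.lie H.lie x ↔
      w ∈ (rootSys hG D hx).weyl ∧ (rootSys hH D hxH).Dom (w (rootSys hG D hx).hρ) := by
  rw [weylOne, Set.mem_ofPred_eq, weylGroup_eq hG D hx, rho_eq hG D hx]
  refine and_congr_right fun hw => forall_congr' fun α => ?_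
  rw [← mem_rootSys_pos hH D hxH]
  refine forall_congr' fun hα => ?_
  have hα' := RootSys.pos_sub _ hα
  have him : ((rootSys hH D hxH).form α (w (rootSys hG D hx).hρ)).im = 0 :=
    RootSys.hρ_weyl_im hw (rootSys_mono hG hH hle D hx hxH hα')
  have hpos := (rootSys hH D hxH).form_self_re_pos hα'
  have hc : (w (rootSys hG D hx).hρ ((2 / D.form α α) • D.tt α)).re =
      2 / ((rootSys hH D hxH).form α α).re *
        ((rootSys hH D hxH).form α (w (rootSys hG D hx).hρ)).re := by
    have h1 := (splitData hH D hxH).apply_coroot (α := α) (w (rootSys hG D hx).hρ)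
    have h2 : ((rootSys hH D hxH).cor α (w (rootSys hG D hx).hρ)).re = _ :=
      congrArg Complex.re ((rootSys hH D hxH).cor_eq_re hα' _ him)
    refine (congrArg Complex.re h1).trans (h2.trans ?_)
    rw [Complex.ofReal_re]
    ring
  constructor
  · intro h
    have := h _ ((isCoroot_iff hH D ((mem_rootSys hH D hxH).1 hα')).2 rfl)
    rw [hc] at this
    exact ⟨him, nonneg_of_mul_nonneg_right this (by positivity)⟩
  · rintro ⟨-, h⟩ c hcor
    rw [(isCoroot_iff hH D ((mem_rootSys hH D hxH).1 hα')).1 hcor, hc]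
    positivity

/-- The branching of Weyl numerators from `𝔤` to `𝔥`, in terms of characters. -/
theorem character_mul_den (hTG : T.cpts ≤ G.cpts) (hTH : T.cpts ≤ H.cpts)
    (hle : ∀ X ∈ H.lie, X ∈ G.lie) {F : RealRep.{u} G} {lam : Module.Dual ℂ T.lie}
    (hF : F.IsIrreducible) (hlam : F.HasHighestWeight x lam)
    {E : weylOne G.lie T.lie H.lie x → RealRep.{u} H}
    (hE : ∀ w, (E w).IsIrreducible ∧ (E w).HasHighestWeight x
      (w.1 (lam + rho G.lie T.lie x) - rho H.lie T.lie x))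
    {X : T.lie} (hX : IsRealMatrix (X : Matrix (Fin n) (Fin n) ℂ)) {γ : T.realPts}
    (hγ : ((γ : GL (Fin n) ℂ) : Matrix (Fin n) (Fin n) ℂ) =
      NormedSpace.exp (X : Matrix (Fin n) (Fin n) ℂ)) :
    F.character hTG γ * evT X (rootSys hG D hx).den =
      (∑ᶠ w : weylOne G.lie T.lie H.lie x, weylSign w.1 * (E w).character hTH γ) *
        evT X (rootSys hH D hxH).den := by
  have hfin : (weylOne G.lie T.lie H.lie x).Finite :=
    (Set.finite_coe_iff.1 (rootSys hG D hx).weyl_finite).subset fun w hw =>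
      ((mem_weylOne_iff hG hH D hx hxH hle).1 hw).1
  let _ := hfin.fintype
  obtain ⟨b, wt, hb, hchi⟩ := exists_character hG D hx F hF hlam
  rw [character_eq_evT hG hTG hb hX hγ, ← map_mul, hchi, RootSys.alt_eq_sum (R := rootSys hG D hx)
      (R' := rootSys hH D hxH) rfl (rootSys_mono hG hH hle D hx hxH)
      (fun w => mem_weylOne_iff hG hH D hx hxH hle),
    finsum_eq_sum_of_fintype, map_sum, Finset.sum_mul]
  refine Finset.sum_congr rfl fun w _ => ?_
  obtain ⟨b', wt', hb', hchi'⟩ := exists_character hH D hxH (E w) (hE w).1 (hE w).2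
  rw [rho_eq hG D hx, rho_eq hH D hxH, sub_add_cancel] at hchi'
  rw [character_eq_evT hH hTH hb' hX hγ, map_smul, ← hchi', map_mul, smul_eq_mul, mul_assoc]
  rfl

end Transfer

end WeylChar

end

open WeylChar in
theorem mainTheorem2 {n : ℕ} (T H G : RealAlgGroup n)
    (hH : H.IsSelfAdjoint) (hG : G.IsSelfAdjoint)
    (hTH : T.cpts ≤ H.cpts) (hHG : H.cpts ≤ G.cpts)
    (hT : IsCompactMaximalTorus T G)
    (x : T.lie) (hx : IsRegularElement G.lie T.lie x)
    (hρ : IsCharacter T (rho G.lie T.lie x - rho H.lie T.lie x))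
    (B : LinearMap.BilinForm ℂ G.lie)
    (hB_symm : ∀ X Y, B X Y = B Y X)
    (hB_nondeg : ∀ X, (∀ Y, B X Y = 0) → X = 0)
    (hB_inv : ∀ X Y W, B ⁅X, Y⁆ W = B X ⁅Y, W⁆)
    {m : ℕ} (Z : Module.Basis (Fin m) ℂ (orthCompl H G B)) (hZ : IsOrthonormalBasis Z)
    (S : SpinModule.{v} (cliffordForm H G B)) (hS : IsNormalized S x) :
    ∃ (Δ : T.realPts → ℂ) (σ : T.realPts →* Module.End ℂ S.S),
      IsTransferFactor T H G x Δ ∧ IsSpinRep Z S T σ ∧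
      ∀ γ : T.realPts, IsRegularIn T H γ →
        Δ γ⁻¹ = traceOn (σ γ) S.Sp - traceOn (σ γ) S.Sm ∧
        Δ γ⁻¹ = diracIndexChar Z S (RealRep.trivialRep G) hT.le σ γ ∧
        ∀ (F : RealRep.{u} G) (wt : Module.Dual ℂ T.lie),
          F.IsIrreducible → F.HasHighestWeight x wt →
          Δ γ⁻¹ * F.character hT.le γ = diracIndexChar Z S F hT.le σ γ ∧
          ∀ E : weylOne G.lie T.lie H.lie x → RealRep.{u} H,
            (∀ w, (E w).IsIrreducible ∧ (E w).HasHighestWeight x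
              (w.1 (wt + rho G.lie T.lie x) - rho H.lie T.lie x)) →
            Δ γ⁻¹ * F.character hT.le γ =
              (-1 : ℂ) ^ ((G.q : ℤ) - H.q) *
                ∑ᶠ w : weylOne G.lie T.lie H.lie x,
                  weylSign w.1 * (E w).character hTH γ := by
  have hCG := isCartanIn_of_isCompactMaximalTorus hT hG
  have hle : ∀ X ∈ H.lie, X ∈ G.lie := fun X hX => lie_mono hHG hX
  have hCH := hCG.mono hTH hle hH
  have hxH := regular_mono hle hx
  obtain ⟨D⟩ := exists_torusData hT
  rw [rho_eq hCG D hx, rho_eq hCH D hxH] at hρ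
  obtain ⟨b, wt, hb, hint, htr⟩ := exists_spin_basis hCG hCH hle D hx hxH hB_symm hB_nondeg hB_inv
    hZ S hS IsIntegral (IsCharacter.isIntegral hρ) fun α hα ν hν => hν.sub (root_isIntegral hCG D hα)
  obtain ⟨σ, hσ⟩ := exists_spinRep (bS := b) S hT hint
  have hcomm : ∀ Y, dexp b wt Y * grading S.isCompl = grading S.isCompl * dexp b wt Y :=
    dexp_comm hb fun Y => grading_spinMap S _
  have hpres : ∀ γ, (∀ v ∈ S.Sp, σ γ v ∈ S.Sp) ∧ ∀ v ∈ S.Sm, σ γ v ∈ S.Sm := fun γ => by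
    obtain ⟨X, hX, hγ⟩ := exists_log hT γ
    rw [hσ X γ hX hγ]
    refine ⟨fun v hv => mem_left_of_grading S.isCompl ?_,
      fun v hv => mem_right_of_grading S.isCompl ?_⟩
    · rw [← Module.End.mul_apply, ← hcomm, Module.End.mul_apply, grading_left _ hv]
    · rw [← Module.End.mul_apply, ← hcomm, Module.End.mul_apply, grading_right _ hv, map_neg]
  -- the graded character of the spin module is the quotient of the Weyl denominators
  have hch : ∀ (X : T.lie) (γ : T.realPts), IsRealMatrix (X : Matrix (Fin n) (Fin n) ℂ) →
      ((γ : GL (Fin n) ℂ) : Matrix (Fin n) (Fin n) ℂ) =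
        NormedSpace.exp (X : Matrix (Fin n) (Fin n) ℂ) →
      (traceOn (σ γ) S.Sp - traceOn (σ γ) S.Sm) * evT X (rootSys hCH D hxH).den =
        (-1 : ℂ) ^ ((G.q : ℤ) - H.q) * evT X (rootSys hCG D hx).den := fun X γ hX hγ => by
    rw [traceOn_sub_traceOn S.isCompl (hpres γ).1 (hpres γ).2, hσ X γ hX hγ, htr,
      evT_den_mul hCG hCH hle D hx hxH]
    ring
  refine ⟨fun γ => traceOn (σ γ⁻¹) S.Sp - traceOn (σ γ⁻¹) S.Sm, σ, ?_, ⟨hpres, ?_⟩, ?_⟩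
  · intro X hX γ hγ hr
    have hne := evT_den_ne_zero hCH D hxH hγ hr
    simp only [inv_inv]
    rw [altSum_rho hCG D hx, altSum_rho hCH D hxH, ← mul_div_assoc, ← hch X γ hX hγ,
      mul_div_cancel_right₀ _ hne]
  · intro X hXT hX p hp v f
    have h := hasDerivAt_dexp hb ⟨X, hXT⟩ v f
    refine h.congr_of_eventuallyEq (Eventually.of_forall fun s => ?_)
    change f (σ (p s) v) = _
    rw [hσ ((s : ℂ) • ⟨X, hXT⟩) (p s) (isReal_smul hX s) (hp s)]
  · intro γ hr
    obtain ⟨X, hX, hγ⟩ := exists_log hT γ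
    have hne := evT_den_ne_zero hCH D hxH hγ hr
    simp only [inv_inv]
    refine ⟨trivial, ?_, fun F lam hF hlam => ⟨?_, fun E hE => ?_⟩⟩
    · have h0 : IsWeightBasis (tactF hCG (RealRep.trivialRep G)) (Module.Basis.singleton Unit ℂ)
          fun _ => 0 := fun Y i => by
        rw [LinearMap.zero_apply, zero_smul]; rfl
      rw [diracIndexChar_eq hCG hCH hT.le hB_symm hB_inv hZ S h0 hb σ hX hγ (hσ X γ hX hγ)
        (hpres γ).1 (hpres γ).2, character_eq_evT hCG hT.le h0 hX hγ, evT_chi]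
      simp
    · obtain ⟨b', wt', hb', -⟩ := exists_character hCG D hx F hF hlam
      rw [diracIndexChar_eq hCG hCH hT.le hB_symm hB_inv hZ S hb' hb σ hX hγ (hσ X γ hX hγ)
        (hpres γ).1 (hpres γ).2, mul_comm]
    · have h1 := character_mul_den hCG hCH D hx hxH hT.le hTH hle hF hlam hE hX hγ
      refine mul_right_cancel₀ hne ?_
      rw [mul_right_comm, hch X γ hX hγ, mul_assoc, mul_comm (evT X _), h1, mul_assoc]
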